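/- **Setting.** Fix $\kappa\in(0,1/4)$ and $T\in(0,\infty)$. For $\beta\in(0,1)$ let $\mathcal C^\beta$ be the space of bounded functions $u:\mathbf R\to\mathbf R$ with finite norm $$\|u\|_{\mathcal C^\beta}=\|u\|_{L^\infty}+\sup_{|x-y|\le 1,\ x\neq y}\frac{|u(x)-u(y)|}{|x-y|^\beta}.$$ For $\alpha\in(-1,0)$ let $\mathcal C^\alpha$ be the space of distributions $u$ on $\mathbf R$ (extended to compactly supported $C^1$ test functions) with finite norm $$\|u\|_{\mathcal C^\alpha}=\sup\{\lambda^{-\alpha}|u(\eta_x^\lambda)| : x\in\mathbf R,\ \lambda\in(0,1],\ \eta\in C^1(\mathbf R),\ \operatorname{supp}\eta\subseteq[-1,1],\ \|\eta\|_{C^1}\le 1\},$$ where $\eta_x^\lambda(y)=\lambda^{-1}\eta(\lambda^{-1}(y-x))$ and $\|\eta\|_{C^1}=\max(\|\eta\|_\infty,\|\eta'\|_\infty)$; this is the Besov space $\mathcal B^\alpha_{\infty,\infty}$. Let $\mathcal B(\mathcal C^{\frac12+\kappa},\mathcal C^{-\kappa})$ be the space of bounded linear operators with the operator norm. For a normed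 space $\mathcal Y$ let $\mathcal X^\kappa_T(\mathcal Y)$ be the space of continuous functions $f:(0,T]\to\mathcal Y$ with finite norm $\|f\|_{\mathcal X^\kappa_T(\mathcal Y)}=\sup_{t\in(0,T]}t^{1-\kappa}\|f(t)\|_{\mathcal Y}$. Let $P_t(x)=\frac{t}{\pi(t^2+x^2)}$ be the Cauchy kernel. For $f\in\mathcal C^\alpha$, $\alpha\in(-1,0)$, the convolution is $(P_t*f)(x)=\lim_{R\to\infty}f\big(P_t(x-\cdot)\,\chi(\cdot/R)\big)$ for any compactly supported $C^1$ function $\chi$ equal to $1$ near $0$. The product of $v\in\mathcal C^{\frac12+\kappa}$ and $g\in\mathcal C^{-\kappa}$ is the element $vg$ of $\mathcal C^{-\kappa}$ given by $(vg)(\eta)=\lim_{\varepsilon\downarrow0}g\big((\rho_\varepsilon*v)\,\eta\big)$ for any mollifier $\rho_\varepsilon=\varepsilon^{-1}\rho(\varepsilon^{-1}\cdot)$, where $\rho$ is a compactly supported $C^1$ function with $\int\rho=1$. **Proposition.** For every $(g,\Psi,\underline v)\in\mathcal C^{-\kappa}\times\mathcal B(\mathcal C^{\frac12+\kappa},\mathcal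 C^{-\kappa})\times\mathcal C^{-\frac12+2\kappa}$ there is exactly one $v=\mathcal V_T(g,\Psi,\underline v)\in\mathcal X^\kappa_T(\mathcal C^{\frac12+\kappa})$ such that $$v(t,x)=\int_0^t\Big(P_{t-s}*\big(v(s,\cdot)\,g+\Psi v(s,\cdot)\big)\Big)(x)\,ds+(P_t*\underline v)(x)\qquad\text{for all }t\in(0,T],\ x\in\mathbf R,$$ and the map $$\mathcal V_T:\mathcal C^{-\kappa}\times\mathcal B(\mathcal C^{\frac12+\kappa},\mathcal C^{-\kappa})\times\mathcal C^{-\frac12+2\kappa}\to\mathcal X^\kappa_T(\mathcal C^{\frac12+\kappa})$$ is continuous. -/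

import Mathlib

open Set Filter Topology MeasureTheory TopologicalSpace
open scoped Distributions

noncomputable section

/-! ### Suprema of families of seminorms -/

theorem bddAbove_range_of_le_add {ι : Type*} {a b c : ι → ℝ} (ha : BddAbove (range a))
    (hb : BddAbove (range b)) (h : ∀ i, c i ≤ a i + b i) : BddAbove (range c) := by
  obtain ⟨A, hA⟩ := ha
  obtain ⟨B, hB⟩ := hb
  refine ⟨A + B, ?_⟩
  rintro _ ⟨i, rfl⟩
  exact (h i).trans (add_le_add (hA ⟨i, rfl⟩) (hB ⟨i, rfl⟩))

theorem bddAbove_range_of_eq_mul {ι : Type*} {a c : ι → ℝ} {r : ℝ} (hr : 0 ≤ r)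
    (ha : BddAbove (range a)) (h : ∀ i, c i = r * a i) : BddAbove (range c) := by
  obtain ⟨A, hA⟩ := ha
  refine ⟨r * A, ?_⟩
  rintro _ ⟨i, rfl⟩
  simpa [h i] using mul_le_mul_of_nonneg_left (hA ⟨i, rfl⟩) hr

theorem iSup_le_add_of_le_add {ι : Type*} {a b c : ι → ℝ} (ha : BddAbove (range a))
    (hb : BddAbove (range b)) (ha0 : ∀ i, 0 ≤ a i) (hb0 : ∀ i, 0 ≤ b i)
    (h : ∀ i, c i ≤ a i + b i) : (⨆ i, c i) ≤ (⨆ i, a i) + ⨆ i, b i :=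
  Real.iSup_le (fun i => (h i).trans (add_le_add (le_ciSup ha i) (le_ciSup hb i)))
    (add_nonneg (Real.iSup_nonneg ha0) (Real.iSup_nonneg hb0))

theorem iSup_eq_mul_of_eq_mul {ι : Type*} {a c : ι → ℝ} {r : ℝ} (hr : 0 ≤ r)
    (h : ∀ i, c i = r * a i) : (⨆ i, c i) = r * ⨆ i, a i := by
  rw [Real.mul_iSup_of_nonneg hr]
  exact iSup_congr h

/-! ### Hölder spaces of positive exponent -/

/-- The Hölder quotient `|f x - f y| / |x - y| ^ β` at a pair of points at distance at most `1`
(it is `0` when `x = y`). -/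
def holderQuotient (β : ℝ) (f : ℝ → ℝ) (p : {p : ℝ × ℝ // |p.1 - p.2| ≤ 1}) : ℝ :=
  |f p.1.1 - f p.1.2| / |p.1.1 - p.1.2| ^ β

theorem holderQuotient_nonneg (β : ℝ) (f : ℝ → ℝ) (p : {p : ℝ × ℝ // |p.1 - p.2| ≤ 1}) :
    0 ≤ holderQuotient β f p := by
  unfold holderQuotient; positivity

theorem holderQuotient_add_le (β : ℝ) (f g : ℝ → ℝ) (p : {p : ℝ × ℝ // |p.1 - p.2| ≤ 1}) :
    holderQuotient β (fun x => f x + g x) p ≤ holderQuotient β f p + holderQuotient β g p := by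
  unfold holderQuotient
  rw [← add_div]
  refine div_le_div_of_nonneg_right ?_ (by positivity)
  rw [add_sub_add_comm]
  exact abs_add_le _ _

theorem holderQuotient_smul (β c : ℝ) (f : ℝ → ℝ) (p : {p : ℝ × ℝ // |p.1 - p.2| ≤ 1}) :
    holderQuotient β (fun x => c * f x) p = |c| * holderQuotient β f p := by
  unfold holderQuotient
  rw [← mul_sub, abs_mul, mul_div_assoc]

/-- The bounded continuous functions on `ℝ` whose `β`-Hölder quotients are bounded. -/
def holderSubmodule (β : ℝ) : Submodule ℝ (BoundedContinuousFunction ℝ ℝ) where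
  carrier := {f | BddAbove (range (holderQuotient β f))}
  zero_mem' := ⟨0, by rintro _ ⟨p, rfl⟩; simp [holderQuotient]⟩
  add_mem' := fun {f g} hf hg => bddAbove_range_of_le_add hf hg (holderQuotient_add_le β f g)
  smul_mem' := fun c f hf =>
    bddAbove_range_of_eq_mul (abs_nonneg c) hf (holderQuotient_smul β c f)

/-- The Hölder space `𝒞^β` on `ℝ` for `β ∈ (0, 1)`. -/
def HolderSpace (β : ℝ) : Type := ↥(holderSubmodule β)

namespace HolderSpace

variable {β : ℝ}

instance : AddCommGroup (HolderSpace β) := inferInstanceAs (AddCommGroup ↥(holderSubmodule β))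

instance : Module ℝ (HolderSpace β) := inferInstanceAs (Module ℝ ↥(holderSubmodule β))

/-- The underlying bounded continuous function. -/
def toBCF (f : HolderSpace β) : BoundedContinuousFunction ℝ ℝ := f.1

instance : CoeFun (HolderSpace β) (fun _ => ℝ → ℝ) := ⟨fun f => f.toBCF⟩

/-- `‖f‖ = ‖f‖_{L^∞} + sup_{|x - y| ≤ 1} |f x - f y| / |x - y| ^ β`. -/
instance : Norm (HolderSpace β) := ⟨fun f => ‖f.toBCF‖ + ⨆ p, holderQuotient β f p⟩

theorem norm_def (f : HolderSpace β) : ‖f‖ = ‖f.toBCF‖ + ⨆ p, holderQuotient β f p := rfl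

theorem normCore : NormedSpace.Core ℝ (HolderSpace β) where
  norm_nonneg f :=
    add_nonneg (norm_nonneg f.toBCF) (Real.iSup_nonneg (holderQuotient_nonneg β f))
  norm_smul c f := by
    have h1 : ‖(c • f).toBCF‖ = ‖c‖ * ‖f.toBCF‖ := norm_smul c f.toBCF
    have h2 : (⨆ p, holderQuotient β (c • f).toBCF p) = |c| * ⨆ p, holderQuotient β f.toBCF p :=
      iSup_eq_mul_of_eq_mul (abs_nonneg c) (holderQuotient_smul β c f)
    rw [norm_def, norm_def, h1, h2, Real.norm_eq_abs, mul_add]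
  norm_triangle f g := by
    have h1 : ‖(f + g).toBCF‖ ≤ ‖f.toBCF‖ + ‖g.toBCF‖ := norm_add_le f.toBCF g.toBCF
    have h2 : (⨆ p, holderQuotient β (f + g).toBCF p)
        ≤ (⨆ p, holderQuotient β f p) + ⨆ p, holderQuotient β g p :=
      iSup_le_add_of_le_add f.2 g.2 (holderQuotient_nonneg β f) (holderQuotient_nonneg β g)
        (holderQuotient_add_le β f g)
    rw [norm_def, norm_def, norm_def]
    linarith
  norm_eq_zero_iff f := by
    constructor
    · intro h
      have h1 := norm_nonneg f.toBCF
      have h2 := Real.iSup_nonneg (holderQuotient_nonneg β f)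
      rw [norm_def] at h
      have h3 : f.toBCF = 0 := norm_eq_zero.1 (by linarith)
      exact Subtype.ext h3
    · rintro rfl
      have h1 : ‖(0 : HolderSpace β).toBCF‖ = 0 :=
        norm_zero (E := BoundedContinuousFunction ℝ ℝ)
      have h2 : ∀ p, holderQuotient β (0 : HolderSpace β) p = 0 := by
        intro p
        have h : ∀ x, (0 : HolderSpace β).toBCF x = 0 := fun _ => rfl
        simp [holderQuotient, h]
      rw [norm_def, h1]
      simp [h2]

instance : NormedAddCommGroup (HolderSpace β) := NormedAddCommGroup.ofCore normCore

instance : NormedSpace ℝ (HolderSpace β) := NormedSpace.ofCore normCore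

end HolderSpace

/-! ### Operations on test functions

`𝓓^{1}(⊤, ℝ)` is the space of compactly supported `C¹` functions on `ℝ`, and `𝓓'^{1}(⊤, ℝ)` is
its dual, i.e. the space of distributions that can be tested against `C¹` functions. -/

/-- The rescaled test function `η_x^l (y) = l⁻¹ η (l⁻¹ (y - x))`. -/
def rescale (η : 𝓓^{1}((⊤ : Opens ℝ), ℝ)) (x l : ℝ) : 𝓓^{1}((⊤ : Opens ℝ), ℝ) where
  toFun y := l⁻¹ * η (l⁻¹ * (y - x))
  contDiff' := by
    have h := η.contDiff
    exact contDiff_const.mul (h.comp (contDiff_const.mul (contDiff_id.sub contDiff_const)))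
  hasCompactSupport' := by
    rcases eq_or_ne l 0 with rfl | hl
    · simpa using! (HasCompactSupport.zero : HasCompactSupport (0 : ℝ → ℝ))
    · have h := η.hasCompactSupport.comp_homeomorph
        ((Homeomorph.subRight x).trans (Homeomorph.mulLeft₀ l⁻¹ (inv_ne_zero hl)))
      exact h.mul_left
  tsupport_subset' := fun _ _ => trivial

/-- The product of a test function with a `C¹` function. -/
def mulTest (φ : ℝ → ℝ) (hφ : ContDiff ℝ 1 φ) (η : 𝓓^{1}((⊤ : Opens ℝ), ℝ)) :
    𝓓^{1}((⊤ : Opens ℝ), ℝ) where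
  toFun y := φ y * η y
  contDiff' := hφ.mul η.contDiff
  hasCompactSupport' := η.hasCompactSupport.mul_left
  tsupport_subset' := fun _ _ => trivial

/-! ### Hölder spaces of negative exponent -/

/-- The data `(x, η, l)` in the definition of a negative Hölder norm: a point `x`, a `C¹` function
`η` supported in `[-1, 1]` with `‖η‖_{C¹} = max (sup |η|) (sup |η'|) ≤ 1`, and a scale
`l ∈ (0, 1]`. -/
structure HolderProbe where
  x : ℝ
  η : 𝓓^{1}((⊤ : Opens ℝ), ℝ)
  l : ℝ
  support_subset : tsupport η ⊆ Icc (-1) 1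
  abs_le : ∀ y, |η y| ≤ 1
  abs_deriv_le : ∀ y, |deriv η y| ≤ 1
  l_pos : 0 < l
  l_le : l ≤ 1

/-- The quantity `l ^ (-α) * |u (η_x^l)|`. -/
def probeValue (α : ℝ) (u : 𝓓'^{1}((⊤ : Opens ℝ), ℝ)) (i : HolderProbe) : ℝ :=
  i.l ^ (-α) * |u (rescale i.η i.x i.l)|

theorem probeValue_nonneg (α : ℝ) (u : 𝓓'^{1}((⊤ : Opens ℝ), ℝ)) (i : HolderProbe) :
    0 ≤ probeValue α u i :=
  mul_nonneg (Real.rpow_nonneg i.l_pos.le _) (abs_nonneg _)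

theorem probeValue_add_le (α : ℝ) (u v : 𝓓'^{1}((⊤ : Opens ℝ), ℝ)) (i : HolderProbe) :
    probeValue α (u + v) i ≤ probeValue α u i + probeValue α v i := by
  unfold probeValue
  rw [← mul_add]
  exact mul_le_mul_of_nonneg_left (abs_add_le _ _) (Real.rpow_nonneg i.l_pos.le _)

theorem probeValue_smul (α c : ℝ) (u : 𝓓'^{1}((⊤ : Opens ℝ), ℝ)) (i : HolderProbe) :
    probeValue α (c • u) i = |c| * probeValue α u i := by
  have h : (c • u) (rescale i.η i.x i.l) = c * u (rescale i.η i.x i.l) := rfl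
  unfold probeValue
  rw [h, abs_mul]
  ring

/-- The distributions whose `α`-Hölder norm is finite. -/
def negHolderSubmodule (α : ℝ) : Submodule ℝ 𝓓'^{1}((⊤ : Opens ℝ), ℝ) where
  carrier := {u | BddAbove (range (probeValue α u))}
  zero_mem' := ⟨0, by
    rintro _ ⟨i, rfl⟩
    have h : (0 : 𝓓'^{1}((⊤ : Opens ℝ), ℝ)) (rescale i.η i.x i.l) = 0 := rfl
    simp [probeValue, h]⟩
  add_mem' := fun {u v} hu hv => bddAbove_range_of_le_add hu hv (probeValue_add_le α u v)
  smul_mem' := fun c u hu =>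
    bddAbove_range_of_eq_mul (abs_nonneg c) hu (probeValue_smul α c u)

/-- A distribution that vanishes on all the rescaled probes is zero. -/
theorem eq_zero_of_probeValue_eq_zero {α : ℝ} {u : 𝓓'^{1}((⊤ : Opens ℝ), ℝ)}
    (h : ∀ i, probeValue α u i = 0) : u = 0 := by
  -- `u` vanishes on test functions supported in an interval of length two
  have h1 : ∀ (a : ℝ) (φ : 𝓓^{1}((⊤ : Opens ℝ), ℝ)), tsupport φ ⊆ Icc (a - 1) (a + 1) →
      u φ = 0 := by
    intro a φ hφ
    obtain ⟨A, hA⟩ := φ.hasCompactSupport.exists_bound_of_continuous φ.continuous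
    obtain ⟨B, hB⟩ := φ.hasCompactSupport.deriv.exists_bound_of_continuous
      (φ.contDiff.continuous_deriv le_rfl)
    have hA0 : 0 ≤ A := (norm_nonneg _).trans (hA 0)
    have hB0 : 0 ≤ B := (norm_nonneg _).trans (hB 0)
    set c : ℝ := (1 + A + B)⁻¹ with hc
    have hc0 : 0 < c := by positivity
    set η : 𝓓^{1}((⊤ : Opens ℝ), ℝ) := c • rescale φ (-a) 1 with hη
    have hηy : ∀ y, η y = c * φ (y + a) := by
      intro y
      change c * ((1 : ℝ)⁻¹ * φ ((1 : ℝ)⁻¹ * (y - -a))) = _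
      simp
    have hηf : (η : ℝ → ℝ) = fun y => c * φ (y + a) := funext hηy
    have hcA : c * A ≤ 1 := by
      rw [hc, inv_mul_le_iff₀ (by positivity)]; linarith
    have hcB : c * B ≤ 1 := by
      rw [hc, inv_mul_le_iff₀ (by positivity)]; linarith
    let i : HolderProbe :=
      { x := a
        η := η
        l := 1
        support_subset := by
          refine closure_minimal ?_ isClosed_Icc
          intro y hy
          have hy' : φ (y + a) ≠ 0 := by
            intro h0
            exact hy (by rw [hηy, h0, mul_zero])
          have := hφ (subset_tsupport _ hy')
          constructor <;> linarith [this.1, this.2]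
        abs_le := by
          intro y
          rw [hηy, abs_mul, abs_of_pos hc0]
          exact (mul_le_mul_of_nonneg_left (hA (y + a)) hc0.le).trans hcA
        abs_deriv_le := by
          intro y
          have hd : deriv η y = c * deriv φ (y + a) := by
            rw [hηf, deriv_const_mul_field, deriv_comp_add_const]
          rw [hd, abs_mul, abs_of_pos hc0]
          exact (mul_le_mul_of_nonneg_left (hB (y + a)) hc0.le).trans hcB
        l_pos := one_pos
        l_le := le_rfl }
    have hi : rescale i.η i.x i.l = c • φ := by
      ext y
      change (1 : ℝ)⁻¹ * η ((1 : ℝ)⁻¹ * (y - a)) = c * φ y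
      rw [hηy]
      simp
    have h2 := h i
    have h3 : u (rescale i.η i.x i.l) = 0 := by
      have : i.l ^ (-α) ≠ 0 := (Real.rpow_pos_of_pos i.l_pos _).ne'
      unfold probeValue at h2
      exact abs_eq_zero.1 ((mul_eq_zero.1 h2).resolve_left this)
    rw [hi, map_smul, smul_eq_mul] at h3
    exact (mul_eq_zero.1 h3).resolve_left hc0.ne'
  -- telescoping partition of unity
  have hst : ∀ a : ℝ, ContDiff ℝ 1 (fun y : ℝ => Real.smoothTransition (y - a)) := fun a =>
    Real.smoothTransition.contDiff.comp (contDiff_id.sub contDiff_const)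
  have h2 : ∀ (φ : 𝓓^{1}((⊤ : Opens ℝ), ℝ)) (a : ℝ),
      u (mulTest _ (hst a) φ) = u (mulTest _ (hst (a + 1)) φ) := by
    intro φ a
    have h3 := h1 (a + 1) (mulTest _ (hst a) φ - mulTest _ (hst (a + 1)) φ) (by
      refine closure_minimal ?_ isClosed_Icc
      intro y hy
      by_contra hy'
      apply hy
      change Real.smoothTransition (y - a) * φ y - Real.smoothTransition (y - (a + 1)) * φ y = 0
      rw [mem_Icc, not_and_or, not_le, not_le] at hy'
      rcases hy' with hy' | hy'
      · rw [Real.smoothTransition.zero_of_nonpos (by linarith),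
          Real.smoothTransition.zero_of_nonpos (by linarith)]
        ring
      · rw [Real.smoothTransition.one_of_one_le (by linarith),
          Real.smoothTransition.one_of_one_le (by linarith)]
        ring)
    rw [map_sub] at h3
    linarith
  ext φ
  obtain ⟨R, hR⟩ := φ.hasCompactSupport.isCompact.isBounded.subset_closedBall 0
  obtain ⟨N, hN⟩ := exists_nat_gt (R + 1)
  have hφ0 : ∀ y, (N : ℝ) - 1 < |y| → φ y = 0 := by
    intro y hy
    by_contra h0
    have := hR (subset_tsupport _ h0)
    rw [Metric.mem_closedBall, dist_zero_right, Real.norm_eq_abs] at this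
    linarith
  have hleft : mulTest _ (hst (-N)) φ = φ := by
    ext y
    change Real.smoothTransition (y - -N) * φ y = φ y
    by_cases hy : (N : ℝ) - 1 < |y|
    · rw [hφ0 y hy, mul_zero]
    · have := neg_abs_le y
      rw [Real.smoothTransition.one_of_one_le (by linarith), one_mul]
  have hright : mulTest _ (hst N) φ = 0 := by
    ext y
    change Real.smoothTransition (y - N) * φ y = 0
    by_cases hy : (N : ℝ) - 1 < |y|
    · rw [hφ0 y hy, mul_zero]
    · have := le_abs_self y
      rw [Real.smoothTransition.zero_of_nonpos (by linarith), zero_mul]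
  have htel : ∀ k : ℕ, u (mulTest _ (hst (-N)) φ) = u (mulTest _ (hst (-N + k)) φ) := by
    intro k
    induction k with
    | zero => simp
    | succ k ih => rw [ih, h2]; simp [add_assoc]
  have h3 := htel (2 * N)
  have h4 : (-(N : ℝ) + ((2 * N : ℕ) : ℝ)) = N := by push_cast; ring
  simp only [h4] at h3
  rw [hleft, hright, map_zero] at h3
  exact h3

/-- The Hölder space `𝒞^α` on `ℝ` for `α ∈ (-1, 0)`, i.e. the Besov space `B^α_{∞,∞}`. -/
def NegHolderSpace (α : ℝ) : Type := ↥(negHolderSubmodule α)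

namespace NegHolderSpace

variable {α : ℝ}

instance : AddCommGroup (NegHolderSpace α) :=
  inferInstanceAs (AddCommGroup ↥(negHolderSubmodule α))

instance : Module ℝ (NegHolderSpace α) := inferInstanceAs (Module ℝ ↥(negHolderSubmodule α))

/-- The underlying distribution. -/
def toDist (u : NegHolderSpace α) : 𝓓'^{1}((⊤ : Opens ℝ), ℝ) := u.1

/-- `‖u‖ = sup l ^ (-α) * |u (η_x^l)|` over all probes `(x, η, l)`. -/
instance : Norm (NegHolderSpace α) := ⟨fun u => ⨆ i, probeValue α u.toDist i⟩

theorem norm_def (u : NegHolderSpace α) : ‖u‖ = ⨆ i, probeValue α u.toDist i := rfl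

theorem normCore : NormedSpace.Core ℝ (NegHolderSpace α) where
  norm_nonneg u := Real.iSup_nonneg (probeValue_nonneg α u.toDist)
  norm_smul c u := iSup_eq_mul_of_eq_mul (abs_nonneg c) (probeValue_smul α c u.toDist)
  norm_triangle u v := iSup_le_add_of_le_add u.2 v.2 (probeValue_nonneg α u.toDist)
    (probeValue_nonneg α v.toDist) (probeValue_add_le α u.toDist v.toDist)
  norm_eq_zero_iff u := by
    constructor
    · intro h
      refine Subtype.ext (eq_zero_of_probeValue_eq_zero (α := α) fun i => ?_)
      refine le_antisymm ?_ (probeValue_nonneg α _ i)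
      exact (le_ciSup u.2 i).trans h.le
    · rintro rfl
      have h : ∀ i, probeValue α (0 : NegHolderSpace α).toDist i = 0 := by
        intro i
        have h0 : (0 : NegHolderSpace α).toDist (rescale i.η i.x i.l) = 0 := rfl
        simp [probeValue, h0]
      rw [norm_def]
      simp [h]

instance : NormedAddCommGroup (NegHolderSpace α) := NormedAddCommGroup.ofCore normCore

instance : NormedSpace ℝ (NegHolderSpace α) := NormedSpace.ofCore normCore

end NegHolderSpace

/-! ### The weighted space of functions of time -/

section XSpace

variable {Y : Type*} [NormedAddCommGroup Y]

/-- The quantity `t ^ (1 - κ) * ‖f t‖`. -/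
def weightedValue {T : ℝ} (κ : ℝ) (f : C(Ioc (0 : ℝ) T, Y)) (t : Ioc (0 : ℝ) T) : ℝ :=
  (t : ℝ) ^ (1 - κ) * ‖f t‖

theorem weightedValue_nonneg {T : ℝ} (κ : ℝ) (f : C(Ioc (0 : ℝ) T, Y)) (t : Ioc (0 : ℝ) T) :
    0 ≤ weightedValue κ f t :=
  mul_nonneg (Real.rpow_nonneg t.2.1.le _) (norm_nonneg _)

theorem weightedValue_add_le {T : ℝ} (κ : ℝ) (f g : C(Ioc (0 : ℝ) T, Y)) (t : Ioc (0 : ℝ) T) :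
    weightedValue κ (f + g) t ≤ weightedValue κ f t + weightedValue κ g t := by
  unfold weightedValue
  rw [← mul_add]
  exact mul_le_mul_of_nonneg_left (norm_add_le _ _) (Real.rpow_nonneg t.2.1.le _)

variable [NormedSpace ℝ Y]

theorem weightedValue_smul {T : ℝ} (κ c : ℝ) (f : C(Ioc (0 : ℝ) T, Y)) (t : Ioc (0 : ℝ) T) :
    weightedValue κ (c • f) t = |c| * weightedValue κ f t := by
  have h : ‖(c • f) t‖ = |c| * ‖f t‖ := norm_smul c (f t)
  unfold weightedValue
  rw [h]
  ring

variable (Y) in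
/-- The continuous functions `f : (0, T] → Y` with `sup_t t ^ (1 - κ) * ‖f t‖ < ∞`. -/
def xSubmodule (κ T : ℝ) : Submodule ℝ C(Ioc (0 : ℝ) T, Y) where
  carrier := {f | BddAbove (range (weightedValue κ f))}
  zero_mem' := ⟨0, by rintro _ ⟨t, rfl⟩; simp [weightedValue]⟩
  add_mem' := fun {f g} hf hg => bddAbove_range_of_le_add hf hg (weightedValue_add_le κ f g)
  smul_mem' := fun c f hf =>
    bddAbove_range_of_eq_mul (abs_nonneg c) hf (weightedValue_smul κ c f)

variable (Y) in
/-- The space `𝒳^κ_T(Y)`. -/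
def XSpace (κ T : ℝ) : Type _ := ↥(xSubmodule Y κ T)

namespace XSpace

variable {κ T : ℝ}

instance : AddCommGroup (XSpace Y κ T) := inferInstanceAs (AddCommGroup ↥(xSubmodule Y κ T))

instance : Module ℝ (XSpace Y κ T) := inferInstanceAs (Module ℝ ↥(xSubmodule Y κ T))

/-- The underlying continuous function on `(0, T]`. -/
def toCM (f : XSpace Y κ T) : C(Ioc (0 : ℝ) T, Y) := f.1

instance : CoeFun (XSpace Y κ T) (fun _ => Ioc (0 : ℝ) T → Y) := ⟨fun f => f.toCM⟩

/-- `‖f‖ = sup_{t ∈ (0, T]} t ^ (1 - κ) * ‖f t‖`. -/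
instance : Norm (XSpace Y κ T) := ⟨fun f => ⨆ t, weightedValue κ f.toCM t⟩

theorem norm_def (f : XSpace Y κ T) : ‖f‖ = ⨆ t, weightedValue κ f.toCM t := rfl

theorem normCore : NormedSpace.Core ℝ (XSpace Y κ T) where
  norm_nonneg f := Real.iSup_nonneg (weightedValue_nonneg κ f.toCM)
  norm_smul c f := iSup_eq_mul_of_eq_mul (abs_nonneg c) (weightedValue_smul κ c f.toCM)
  norm_triangle f g := iSup_le_add_of_le_add f.2 g.2 (weightedValue_nonneg κ f.toCM)
    (weightedValue_nonneg κ g.toCM) (weightedValue_add_le κ f.toCM g.toCM)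
  norm_eq_zero_iff f := by
    constructor
    · intro h
      refine Subtype.ext (ContinuousMap.ext fun t => ?_)
      have h1 : weightedValue κ f.toCM t ≤ 0 := (le_ciSup f.2 t).trans h.le
      have h2 : 0 < (t : ℝ) ^ (1 - κ) := Real.rpow_pos_of_pos t.2.1 _
      have h3 : ‖f.toCM t‖ ≤ 0 := by
        unfold weightedValue at h1
        exact nonpos_of_mul_nonpos_right h1 h2
      exact norm_le_zero_iff.1 h3
    · rintro rfl
      have h : ∀ t, weightedValue κ (0 : XSpace Y κ T).toCM t = 0 := by
        intro t
        have h0 : (0 : XSpace Y κ T).toCM t = 0 := rfl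
        simp [weightedValue, h0]
      rw [norm_def]
      simp [h]

instance : NormedAddCommGroup (XSpace Y κ T) := NormedAddCommGroup.ofCore normCore

instance : NormedSpace ℝ (XSpace Y κ T) := NormedSpace.ofCore normCore

end XSpace

end XSpace

/-! ### Convolution with the Cauchy kernel -/

/-- The Cauchy kernel `P_t(x) = t / (π (t² + x²))`. -/
def cauchyKernel (t x : ℝ) : ℝ := t / (Real.pi * (t ^ 2 + x ^ 2))

theorem contDiff_cauchyKernel (t x : ℝ) : ContDiff ℝ 1 (fun y => cauchyKernel t (x - y)) := by
  unfold cauchyKernel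
  rcases eq_or_ne t 0 with rfl | ht
  · simpa using (contDiff_const : ContDiff ℝ 1 (fun _ : ℝ => (0 : ℝ)))
  · refine contDiff_const.div (contDiff_const.mul (contDiff_const.add
      ((contDiff_const.sub contDiff_id).pow 2))) fun y => ?_
    have := Real.pi_pos
    positivity

/-- `(P_t * f)(x) = c` for a distribution `f`. Since `P_t` is not compactly supported, the pairing
of `f` with `y ↦ P_t(x - y)` is understood as the limit, as `R → ∞`, of the pairings of `f` with
the truncations `y ↦ P_t(x - y) χ(y / R)`, for every cutoff `χ` equal to `1` near `0`. Note that
`R • rescale χ 0 R` is the function `y ↦ χ(y / R)`. -/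
def HasCauchyConv (t : ℝ) (f : 𝓓'^{1}((⊤ : Opens ℝ), ℝ)) (x c : ℝ) : Prop :=
  ∀ χ : 𝓓^{1}((⊤ : Opens ℝ), ℝ), (∀ᶠ y in 𝓝 (0 : ℝ), χ y = 1) →
    Tendsto (fun R : ℝ =>
        f (mulTest (fun y => cauchyKernel t (x - y)) (contDiff_cauchyKernel t x)
          (R • rescale χ 0 R)))
      atTop (𝓝 c)

/-! ### Multiplication of a Hölder function and a distribution -/

/-- The mollification `(ρ_ε * v)(x) = ∫ ε⁻¹ ρ(ε⁻¹ (x - y)) v(y) dy`. -/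
def mollify (ρ : 𝓓^{1}((⊤ : Opens ℝ), ℝ)) (ε : ℝ) (v : BoundedContinuousFunction ℝ ℝ) (x : ℝ) :
    ℝ :=
  ∫ y, rescale ρ 0 ε (x - y) * v y

theorem contDiff_mollify (ρ : 𝓓^{1}((⊤ : Opens ℝ), ℝ)) (ε : ℝ)
    (v : BoundedContinuousFunction ℝ ℝ) : ContDiff ℝ 1 (mollify ρ ε v) := by
  have h := (rescale ρ 0 ε).hasCompactSupport.contDiff_convolution_left (n := 1)
    (ContinuousLinearMap.mul ℝ ℝ) (rescale ρ 0 ε).contDiff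
    (v.continuous.locallyIntegrable (μ := volume))
  have h2 : MeasureTheory.convolution (rescale ρ 0 ε) v (ContinuousLinearMap.mul ℝ ℝ) volume
      = mollify ρ ε v := by
    ext x
    rw [MeasureTheory.convolution_eq_swap]
    rfl
  rwa [h2] at h

/-- `h` is the product `v · g` of a function `v` and a distribution `g`:
`h = lim_{ε → 0} (ρ_ε * v) · g` as distributions, for every mollifier `ρ` with `∫ ρ = 1`. -/
def IsProduct (v : BoundedContinuousFunction ℝ ℝ) (g h : 𝓓'^{1}((⊤ : Opens ℝ), ℝ)) : Prop :=
  ∀ ρ : 𝓓^{1}((⊤ : Opens ℝ), ℝ), (∫ y, ρ y) = 1 → ∀ η : 𝓓^{1}((⊤ : Opens ℝ), ℝ),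
    Tendsto (fun ε : ℝ => g (mulTest (mollify ρ ε v) (contDiff_mollify ρ ε v) η))
      (𝓝[>] 0) (𝓝 (h η))

/-! ### The mild formulation -/

/-- `u = ℳ_{g, Ψ, v₀} v`, that is, for all `t ∈ (0, T]` and `x ∈ ℝ`,
`u(t, x) = ∫_0^t (P_{t-s} * (v(s) · g + Ψ v(s)))(x) ds + (P_t * v₀)(x)`.
Here `h s` is the product `v(s) · g`, `F s` is the integrand, and `p` is the last term; that the
products and convolutions exist and that the integrand is integrable is part of the definition. -/
def IsMildImage {κ T : ℝ} (g : NegHolderSpace (-κ))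
    (Ψ : HolderSpace (1 / 2 + κ) →L[ℝ] NegHolderSpace (-κ))
    (v₀ : NegHolderSpace (-(1 / 2) + 2 * κ))
    (v u : XSpace (HolderSpace (1 / 2 + κ)) κ T) : Prop :=
  ∃ h : Ioc (0 : ℝ) T → NegHolderSpace (-κ),
    (∀ s, IsProduct (v s).toBCF g.toDist (h s).toDist) ∧
    ∀ (t : Ioc (0 : ℝ) T) (x : ℝ), ∃ (F : ℝ → ℝ) (p : ℝ),
      (∀ s : Ioc (0 : ℝ) T, (s : ℝ) < t →
        HasCauchyConv ((t : ℝ) - s) (h s + Ψ (v s)).toDist x (F s)) ∧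
      HasCauchyConv t v₀.toDist x p ∧
      IntervalIntegrable F volume 0 t ∧
      u t x = (∫ s in (0 : ℝ)..t, F s) + p

end

/-! The equation is linear in `v`, so it reads `(1 - K) v = W v₀` with `K v = S ((m g + Ψ) v)`. Here
`m` is the product map, `S` is the Volterra operator with kernel `P_t`, and `W` sends the initial
datum to its Cauchy evolution. The solution is `(1 - K)⁻¹ W v₀`. It depends continuously on the data
because inversion is continuous at units and `K` depends continuously on `m g + Ψ`.

Three estimates carry this.

Smoothing: `P_t` maps `𝒞^α` to `𝒞^β` with norm of order `t ^ (-(β - α))` for `t ≤ T`, continuously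
in operator norm (`isSingularKernel_of_isCauchyOperator`). For `α = -κ`, `β = 1/2 + κ` the exponent
is `1/2 + 2κ`, which is below `1` exactly because `κ < 1/4`; hence `S` is bounded. For `α = -1/2 +
2κ` it is `1 - κ`, the weight of the solution space; hence `W` is bounded. The kernel is cut into
pieces of width `min t 1`, each controlled by the negative Hölder norm, and its quadratic decay
makes the pieces summable.

Product: mollifications of `v` at scales `2⁻ⁿ` give products with `g` whose successive differences
are of order `2 ^ (-n (α + β))`. Here `α + β = 1/2 > 0`, so they converge geometrically
(`exists_isProduct`).

Invertibility: measured with the weight `exp (l t)`, the operator `K` has norm at most `1/2` for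
large `l`. In the original norm this makes some power `K ^ n` a strict contraction, so `1 - K ^ n`,
and with it its factor `1 - K`, is a unit (`isUnit_one_sub_volterra`). No smallness of `T` or of the
data is needed.

Finally `isMildImage_iff` identifies the pointwise formulation with the operator equation, using
that the limits defining products and convolutions are unique. -/

noncomputable section

/-! ### Basic facts on the positive Hölder spaces -/

namespace HolderSpace

variable {β : ℝ}

theorem ext_apply {f g : HolderSpace β} (h : ∀ x, f x = g x) : f = g :=
  Subtype.ext (BoundedContinuousFunction.ext h)

@[simp] theorem add_apply (f g : HolderSpace β) (x : ℝ) : (f + g) x = f x + g x := rfl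

@[simp] theorem sub_apply (f g : HolderSpace β) (x : ℝ) : (f - g) x = f x - g x := rfl

theorem norm_toBCF_le (f : HolderSpace β) : ‖f.toBCF‖ ≤ ‖f‖ := by
  rw [norm_def]
  exact le_add_of_nonneg_right (Real.iSup_nonneg (holderQuotient_nonneg β f))

theorem abs_apply_le (f : HolderSpace β) (x : ℝ) : |f x| ≤ ‖f‖ :=
  (f.toBCF.norm_coe_le_norm x).trans f.norm_toBCF_le

theorem abs_sub_le_of_abs_sub_le_one (hβ : 0 < β) (f : HolderSpace β) {x y : ℝ}
    (h : |x - y| ≤ 1) : |f x - f y| ≤ ‖f‖ * |x - y| ^ β := by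
  rcases eq_or_ne x y with rfl | hxy
  · simp [Real.zero_rpow hβ.ne']
  · have h0 : 0 < |x - y| ^ β := Real.rpow_pos_of_pos (abs_pos.2 (sub_ne_zero.2 hxy)) _
    have h1 : holderQuotient β f ⟨(x, y), h⟩ ≤ ‖f‖ := by
      rw [norm_def]
      exact (le_ciSup f.2 ⟨(x, y), h⟩).trans (le_add_of_nonneg_left (norm_nonneg _))
    unfold holderQuotient at h1
    rwa [div_le_iff₀ h0] at h1

/-- The seminorm sees only pairs at distance at most `1`. Beyond that the sup norm gives `2 ‖f‖`,
which is where the factor `2` comes from. -/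
theorem abs_sub_le (hβ : 0 < β) (f : HolderSpace β) (x y : ℝ) :
    |f x - f y| ≤ 2 * ‖f‖ * |x - y| ^ β := by
  have h0 := norm_nonneg f
  rcases le_or_gt |x - y| 1 with h | h
  · have h1 := abs_sub_le_of_abs_sub_le_one hβ f h
    have h2 : 0 ≤ ‖f‖ * |x - y| ^ β := by positivity
    linarith
  · have h1 : 1 ≤ |x - y| ^ β := Real.one_le_rpow h.le hβ.le
    have h2 := abs_sub (f x) (f y)
    have h3 := abs_apply_le f x
    have h4 := abs_apply_le f y
    nlinarith

theorem norm_le_add {S K : ℝ} (f : HolderSpace β) (hS : ∀ x, |f x| ≤ S) (hK : 0 ≤ K)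
    (h : ∀ x y, |x - y| ≤ 1 → |f x - f y| ≤ K * |x - y| ^ β) : ‖f‖ ≤ S + K := by
  rw [norm_def]
  refine add_le_add ((BoundedContinuousFunction.norm_le ((abs_nonneg _).trans (hS 0))).2 hS)
    (Real.iSup_le (fun p => ?_) hK)
  exact div_le_of_le_mul₀ (by positivity) hK (h _ _ p.2)

theorem exists_of_bounds (hβ : 0 < β) {u : ℝ → ℝ} {S K : ℝ} (hS : ∀ x, |u x| ≤ S)
    (h : ∀ x y, |u x - u y| ≤ K * |x - y| ^ β) : ∃ f : HolderSpace β, ∀ x, f x = u x := by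
  have hK : 0 ≤ K := by
    have := (abs_nonneg _).trans (h 1 0)
    simpa using this
  have hc : Continuous u := by
    refine continuous_iff_continuousAt.2 fun x => ?_
    rw [ContinuousAt, tendsto_iff_dist_tendsto_zero]
    have h1 : Tendsto (fun y => K * |y - x| ^ β) (𝓝 x) (𝓝 0) := by
      have h2 : Continuous fun y => K * |y - x| ^ β :=
        continuous_const.mul ((continuous_id.sub continuous_const).abs.rpow_const
          fun _ => Or.inr hβ.le)
      have h3 := h2.tendsto x
      simpa [Real.zero_rpow hβ.ne'] using h3
    exact squeeze_zero (fun _ => dist_nonneg) (fun y => h y x) h1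
  refine ⟨⟨BoundedContinuousFunction.ofNormedAddCommGroup u hc S hS, K, ?_⟩, fun x => rfl⟩
  rintro _ ⟨p, rfl⟩
  exact div_le_of_le_mul₀ (by positivity) hK (h _ _)

/-- Evaluation at a point. -/
def evalCLM (β x : ℝ) : HolderSpace β →L[ℝ] ℝ :=
  LinearMap.mkContinuous
    { toFun := fun f => f x
      map_add' := fun _ _ => rfl
      map_smul' := fun _ _ => rfl } 1
    fun f => (abs_apply_le f x).trans (one_mul _).ge

theorem evalCLM_apply (x : ℝ) (f : HolderSpace β) : evalCLM β x f = f x := rfl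

/-- A Cauchy sequence converges uniformly, and Hölder bounds are closed under pointwise limits.
Letting `m → ∞` in the bounds for `u n - u m` gives convergence in the Hölder norm. -/
theorem completeSpace (hβ : 0 < β) : CompleteSpace (HolderSpace β) := by
  refine Metric.complete_of_cauchySeq_tendsto fun u hu => ?_
  have hlin : ∀ f g : HolderSpace β, dist f.toBCF g.toBCF ≤ dist f g := fun f g => by
    rw [dist_eq_norm, dist_eq_norm]
    exact norm_toBCF_le (f - g)
  have hu' : CauchySeq fun n => (u n).toBCF := by
    rw [Metric.cauchySeq_iff] at hu ⊢
    intro ε hε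
    obtain ⟨N, hN⟩ := hu ε hε
    exact ⟨N, fun m hm n hn => (hlin _ _).trans_lt (hN m hm n hn)⟩
  obtain ⟨F, hF⟩ := cauchySeq_tendsto_of_complete hu'
  have hFx : ∀ x, Tendsto (fun n => u n x) atTop (𝓝 (F x)) := fun x =>
    ((BoundedContinuousFunction.evalCLM ℝ x).continuous.tendsto F).comp hF
  obtain ⟨B, hB⟩ := hu.norm_bddAbove
  have hB' : ∀ n, ‖u n‖ ≤ B := fun n => hB ⟨n, rfl⟩
  obtain ⟨f, hf⟩ : ∃ f : HolderSpace β, ∀ x, f x = F x := by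
    refine exists_of_bounds hβ (S := B) (K := 2 * B) (fun x => ?_) fun x y => ?_
    · exact le_of_tendsto (hFx x).abs (Eventually.of_forall fun n =>
        (abs_apply_le _ _).trans (hB' n))
    · refine le_of_tendsto ((hFx x).sub (hFx y)).abs (Eventually.of_forall fun n => ?_)
      refine (abs_sub_le hβ (u n) x y).trans ?_
      have := hB' n
      gcongr
  refine ⟨f, ?_⟩
  rw [Metric.tendsto_atTop]
  intro ε hε
  obtain ⟨N, hN⟩ := (Metric.cauchySeq_iff.1 hu) (ε / 3) (by positivity)
  refine ⟨N, fun n hn => ?_⟩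
  have h1 : ∀ m ≥ N, ‖u n - u m‖ ≤ ε / 3 := fun m hm => by
    rw [← dist_eq_norm]; exact (hN n hn m hm).le
  -- One third for the sup norm and one for the Hölder quotients; the remaining third makes the
  -- inequality strict.
  have h2 : ‖u n - f‖ ≤ ε / 3 + ε / 3 := by
    refine norm_le_add _ (fun x => ?_) (by positivity) fun x y hxy => ?_
    · rw [sub_apply, hf]
      exact le_of_tendsto ((tendsto_const_nhds.sub (hFx x)).abs)
        (eventually_atTop.2 ⟨N, fun m hm => (abs_apply_le (u n - u m) x).trans (h1 m hm)⟩)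
    · rw [sub_apply, sub_apply, hf, hf]
      refine le_of_tendsto (((tendsto_const_nhds.sub (hFx x)).sub
        (tendsto_const_nhds.sub (hFx y))).abs) (eventually_atTop.2 ⟨N, fun m hm => ?_⟩)
      refine (abs_sub_le_of_abs_sub_le_one hβ (u n - u m) hxy).trans ?_
      have := h1 m hm
      gcongr
  rw [dist_eq_norm]
  linarith

end HolderSpace

/-! ### Basic facts on the weighted spaces of functions of time -/

namespace XSpace

variable {Y : Type*} [NormedAddCommGroup Y] [NormedSpace ℝ Y] {κ T : ℝ}

theorem ext_apply {f g : XSpace Y κ T} (h : ∀ t, f t = g t) : f = g :=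
  Subtype.ext (ContinuousMap.ext h)

@[simp] theorem add_apply (f g : XSpace Y κ T) (t : Ioc (0 : ℝ) T) : (f + g) t = f t + g t := rfl

@[simp] theorem smul_apply (c : ℝ) (f : XSpace Y κ T) (t : Ioc (0 : ℝ) T) :
    (c • f) t = c • f t := rfl

theorem weight_mul_norm_le (f : XSpace Y κ T) (t : Ioc (0 : ℝ) T) :
    (t : ℝ) ^ (1 - κ) * ‖f t‖ ≤ ‖f‖ :=
  le_ciSup f.2 t

theorem norm_apply_le (f : XSpace Y κ T) (t : Ioc (0 : ℝ) T) :
    ‖f t‖ ≤ ‖f‖ * (t : ℝ) ^ (κ - 1) := by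
  have h0 : 0 < (t : ℝ) ^ (1 - κ) := Real.rpow_pos_of_pos t.2.1 _
  rw [← neg_sub 1 κ, Real.rpow_neg t.2.1.le, ← div_eq_mul_inv, le_div_iff₀ h0, mul_comm]
  exact weight_mul_norm_le f t

theorem weight_mul_le_of_le {t B C : ℝ} (ht : 0 < t) (h : B ≤ C * t ^ (κ - 1)) :
    t ^ (1 - κ) * B ≤ C := by
  have h0 : 0 < t ^ (1 - κ) := Real.rpow_pos_of_pos ht _
  rw [← neg_sub 1 κ, Real.rpow_neg ht.le, ← div_eq_mul_inv, le_div_iff₀ h0] at h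
  linarith

theorem norm_le_of_forall {f : XSpace Y κ T} {C : ℝ} (hC : 0 ≤ C)
    (h : ∀ t, ‖f t‖ ≤ C * (t : ℝ) ^ (κ - 1)) : ‖f‖ ≤ C :=
  Real.iSup_le (fun t => weight_mul_le_of_le t.2.1 (h t)) hC

theorem exists_of_bound {u : Ioc (0 : ℝ) T → Y} (hu : Continuous u) {C : ℝ}
    (h : ∀ t, ‖u t‖ ≤ C * (t : ℝ) ^ (κ - 1)) : ∃ f : XSpace Y κ T, ∀ t, f t = u t :=
  ⟨⟨⟨u, hu⟩, C, by rintro _ ⟨t, rfl⟩; exact weight_mul_le_of_le t.2.1 (h t)⟩, fun _ => rfl⟩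

/-- Multiplication by `t ^ (1 - κ)` carries the space into the bounded continuous functions on `(0,
T]`, where the limit is taken; dividing by the weight brings it back. -/
theorem completeSpace [CompleteSpace Y] : CompleteSpace (XSpace Y κ T) := by
  refine Metric.complete_of_cauchySeq_tendsto fun u hu => ?_
  have hw : ∀ c : ℝ, Continuous fun t : Ioc (0 : ℝ) T => (t : ℝ) ^ c := fun c =>
    continuous_subtype_val.rpow_const fun t => Or.inl t.2.1.ne'
  let b : XSpace Y κ T → BoundedContinuousFunction (Ioc (0 : ℝ) T) Y := fun f =>
    BoundedContinuousFunction.ofNormedAddCommGroup (fun t => (t : ℝ) ^ (1 - κ) • f t)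
      ((hw _).smul f.toCM.continuous) ‖f‖ fun t => by
        rw [norm_smul, Real.norm_of_nonneg (Real.rpow_nonneg t.2.1.le _)]
        exact weight_mul_norm_le f t
  have hb : ∀ f g, dist (b f) (b g) ≤ dist f g := fun f g => by
    rw [BoundedContinuousFunction.dist_le dist_nonneg]
    intro t
    rw [dist_eq_norm, dist_eq_norm]
    change ‖(t : ℝ) ^ (1 - κ) • f t - (t : ℝ) ^ (1 - κ) • g t‖ ≤ _
    rw [← smul_sub, norm_smul, Real.norm_of_nonneg (Real.rpow_nonneg t.2.1.le _)]
    exact weight_mul_norm_le (f - g) t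
  have hu' : CauchySeq fun n => b (u n) := by
    rw [Metric.cauchySeq_iff] at hu ⊢
    intro ε hε
    obtain ⟨N, hN⟩ := hu ε hε
    exact ⟨N, fun m hm n hn => (hb _ _).trans_lt (hN m hm n hn)⟩
  obtain ⟨F, hF⟩ := cauchySeq_tendsto_of_complete hu'
  have hinv : ∀ t : Ioc (0 : ℝ) T, (t : ℝ) ^ (κ - 1) * (t : ℝ) ^ (1 - κ) = 1 := fun t => by
    rw [← Real.rpow_add t.2.1]; simp
  obtain ⟨f, hf⟩ : ∃ f : XSpace Y κ T, ∀ t, f t = (t : ℝ) ^ (κ - 1) • F t := by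
    refine exists_of_bound ((hw _).smul F.continuous) (C := ‖F‖) fun t => ?_
    rw [norm_smul, Real.norm_of_nonneg (Real.rpow_nonneg t.2.1.le _), mul_comm]
    exact mul_le_mul_of_nonneg_right (F.norm_coe_le_norm t) (Real.rpow_nonneg t.2.1.le _)
  refine ⟨f, ?_⟩
  rw [tendsto_iff_dist_tendsto_zero] at hF ⊢
  refine squeeze_zero (fun _ => dist_nonneg) (fun n => ?_) hF
  rw [dist_eq_norm]
  refine norm_le_of_forall dist_nonneg fun t => ?_
  have h1 : (u n - f) t = (t : ℝ) ^ (κ - 1) • (b (u n) t - F t) := by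
    change u n t - f t = (t : ℝ) ^ (κ - 1) • ((t : ℝ) ^ (1 - κ) • u n t - F t)
    rw [hf, smul_sub, smul_smul, hinv, one_smul]
  rw [h1, norm_smul, Real.norm_of_nonneg (Real.rpow_nonneg t.2.1.le _), mul_comm, ← dist_eq_norm]
  exact mul_le_mul_of_nonneg_right (BoundedContinuousFunction.dist_coe_le_dist t)
    (Real.rpow_nonneg t.2.1.le _)

variable {Z : Type*} [NormedAddCommGroup Z] [NormedSpace ℝ Z]

theorem exists_comp (A : Y →L[ℝ] Z) (f : XSpace Y κ T) :
    ∃ h : XSpace Z κ T, ∀ t, h t = A (f t) :=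
  exists_of_bound (A.continuous.comp f.toCM.continuous) (C := ‖A‖ * ‖f‖) fun t => by
    rw [mul_assoc]
    exact (A.le_opNorm _).trans
      (mul_le_mul_of_nonneg_left (norm_apply_le f t) (norm_nonneg _))

/-- Pointwise application of a bounded operator. -/
def comp (A : Y →L[ℝ] Z) (f : XSpace Y κ T) : XSpace Z κ T := (exists_comp A f).choose

@[simp] theorem comp_apply (A : Y →L[ℝ] Z) (f : XSpace Y κ T) (t : Ioc (0 : ℝ) T) :
    comp A f t = A (f t) :=
  (exists_comp A f).choose_spec t

variable (Y Z κ T) in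
/-- Pointwise application of a bounded operator, as a bounded bilinear map. -/
def compCLM : (Y →L[ℝ] Z) →L[ℝ] XSpace Y κ T →L[ℝ] XSpace Z κ T :=
  LinearMap.mkContinuous₂
    (LinearMap.mk₂ ℝ comp
      (fun A B f => ext_apply fun t => by simp)
      (fun c A f => ext_apply fun t => by simp)
      (fun A f g => ext_apply fun t => by simp)
      (fun c A f => ext_apply fun t => by simp)) 1
    fun A f => by
      refine norm_le_of_forall (by positivity) fun t => ?_
      rw [LinearMap.mk₂_apply, comp_apply, one_mul, mul_assoc]
      exact (A.le_opNorm _).trans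
        (mul_le_mul_of_nonneg_left (norm_apply_le f t) (norm_nonneg _))

theorem compCLM_apply (A : Y →L[ℝ] Z) (f : XSpace Y κ T) (t : Ioc (0 : ℝ) T) :
    compCLM Y κ T Z A f t = A (f t) :=
  comp_apply A f t

end XSpace

/-! ### Volterra operators with an integrable singularity -/

/-- This is `x ^ θ ≤ max 1 x ≤ 1 + x ≤ exp x`. Applied at `x = l (t - s)`, it buys a negative power
of `l` at the price of a stronger singularity at `s = t`. -/
theorem Real.exp_neg_le_rpow_neg {x θ : ℝ} (hx : 0 < x) (h0 : 0 ≤ θ) (h1 : θ ≤ 1) :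
    Real.exp (-x) ≤ x ^ (-θ) := by
  rw [Real.exp_neg, Real.rpow_neg hx.le]
  refine inv_anti₀ (Real.rpow_pos_of_pos hx _) ?_
  have h2 := Real.add_one_le_exp x
  rcases le_total x 1 with h | h
  · exact (Real.rpow_le_one hx.le h h0).trans (by linarith)
  · refine (Real.rpow_le_rpow_of_exponent_le h h1).trans ?_
    rw [Real.rpow_one]
    linarith

/-- The integrand of the Beta integral. -/
def betaWeight (b κ r : ℝ) : ℝ := (1 - r) ^ (-b) * r ^ (κ - 1)

theorem betaWeight_nonneg {b κ r : ℝ} (hr : r ∈ Ioo (0 : ℝ) 1) : 0 ≤ betaWeight b κ r :=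
  mul_nonneg (Real.rpow_nonneg (by linarith [hr.2]) _) (Real.rpow_nonneg hr.1.le _)

theorem integrableOn_betaWeight {b κ : ℝ} (hb : b < 1) (hκ : 0 < κ) :
    IntegrableOn (betaWeight b κ) (Ioo 0 1) := by
  have h := (Complex.betaIntegral_convergent (u := (κ : ℂ)) (v := ((1 - b : ℝ) : ℂ))
    (by simpa using hκ) (by simpa using hb)).norm
  rw [intervalIntegrable_iff_integrableOn_Ioo_of_le zero_le_one] at h
  refine h.congr_fun (fun r hr => ?_) measurableSet_Ioo
  have h1 : 0 < 1 - r := by linarith [hr.2]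
  have e1 : (κ : ℂ) - 1 = ((κ - 1 : ℝ) : ℂ) := by push_cast; ring
  have e2 : ((1 - b : ℝ) : ℂ) - 1 = ((-b : ℝ) : ℂ) := by push_cast; ring
  have e3 : (1 : ℂ) - (r : ℂ) = ((1 - r : ℝ) : ℂ) := by push_cast; ring
  simp only [norm_mul]
  rw [e1, e2, e3, Complex.norm_cpow_eq_rpow_re_of_pos hr.1,
    Complex.norm_cpow_eq_rpow_re_of_pos h1, Complex.ofReal_re, Complex.ofReal_re, mul_comm]
  rfl

section Volterra

variable {Y Z : Type*} [NormedAddCommGroup Y] [NormedSpace ℝ Y]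
  [NormedAddCommGroup Z] [NormedSpace ℝ Z] {κ T : ℝ}

/-- Extension by zero of a function on `(0, T]` to all times. -/
def timeExt (w : XSpace Z κ T) (s : ℝ) : Z :=
  open Classical in if h : s ∈ Ioc (0 : ℝ) T then w ⟨s, h⟩ else 0

theorem timeExt_of_mem (w : XSpace Z κ T) {s : ℝ} (h : s ∈ Ioc (0 : ℝ) T) :
    timeExt w s = w ⟨s, h⟩ := dif_pos h

theorem timeExt_add (w w' : XSpace Z κ T) (s : ℝ) :
    timeExt (w + w') s = timeExt w s + timeExt w' s := by
  unfold timeExt; split_ifs <;> simp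

theorem timeExt_smul (c : ℝ) (w : XSpace Z κ T) (s : ℝ) :
    timeExt (c • w) s = c • timeExt w s := by
  unfold timeExt; split_ifs <;> simp

theorem continuousOn_timeExt (w : XSpace Z κ T) : ContinuousOn (timeExt w) (Ioc 0 T) := by
  rw [continuousOn_iff_continuous_domRestrict]
  exact w.toCM.continuous.congr fun s => (timeExt_of_mem w s.2).symm

/-- An operator-valued function on `(0, T]` that is continuous and has a singularity of order
`t ^ (-a)` at zero. -/
structure IsSingularKernel (P : ℝ → Z →L[ℝ] Y) (a C T : ℝ) : Prop where
  nonneg : 0 ≤ C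
  continuousOn : ContinuousOn P (Ioc 0 T)
  bound : ∀ t ∈ Ioc 0 T, ‖P t‖ ≤ C * t ^ (-a)

/-- The Volterra integral `∫_0^t P (t - s) w(s) ds`, in the variable `r = s / t`. -/
def volterra (P : ℝ → Z →L[ℝ] Y) (w : XSpace Z κ T) (t : ℝ) : Y :=
  t • ∫ r in Ioo (0 : ℝ) 1, P (t - t * r) (timeExt w (t * r))

theorem mul_mem_Ioc {t r : ℝ} (ht : t ∈ Ioc 0 T) (hr : r ∈ Ioo (0 : ℝ) 1) : t * r ∈ Ioc 0 T :=
  ⟨mul_pos ht.1 hr.1, (mul_le_of_le_one_right ht.1.le hr.2.le).trans ht.2⟩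

theorem sub_mul_mem_Ioc {t r : ℝ} (ht : t ∈ Ioc 0 T) (hr : r ∈ Ioo (0 : ℝ) 1) :
    t - t * r ∈ Ioc 0 T := by
  have h := mul_mem_Ioc ht (r := 1 - r) ⟨by linarith [hr.2], by linarith [hr.1]⟩
  rwa [mul_sub, mul_one] at h

/-! ### Bounds, continuity and invertibility for Volterra operators -/

namespace IsSingularKernel

variable {P : ℝ → Z →L[ℝ] Y} {a C : ℝ}

/-- Write `exp (l t r) = exp (l t) exp (-l t (1 - r))` and bound the last factor by `(l t (1 - r)) ^
(-θ)`. The singularity worsens from `a` to `a + θ`, with a gain of `l ^ (-θ)`. -/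
theorem norm_integrand_le (hP : IsSingularKernel P a C T) {θ l B : ℝ} (hθ0 : 0 ≤ θ)
    (hθ1 : θ ≤ 1) (hl : 0 < l) (hB : 0 ≤ B) {w : XSpace Z κ T}
    (hw : ∀ s : Ioc (0 : ℝ) T, ‖w s‖ ≤ B * Real.exp (l * s) * (s : ℝ) ^ (κ - 1))
    {t r : ℝ} (ht : t ∈ Ioc 0 T) (hr : r ∈ Ioo (0 : ℝ) 1) :
    ‖P (t - t * r) (timeExt w (t * r))‖ ≤
      C * l ^ (-θ) * B * Real.exp (l * t) * t ^ (κ - 1 - (a + θ)) * betaWeight (a + θ) κ r := by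
  have hC := hP.nonneg
  have h1r : 0 < 1 - r := by linarith [hr.2]
  have htr := mul_mem_Ioc ht hr
  have h1 := hP.bound _ (sub_mul_mem_Ioc ht hr)
  have h2 := hw ⟨t * r, htr⟩
  have h3 : Real.exp (l * (t * r)) ≤
      Real.exp (l * t) * (l ^ (-θ) * t ^ (-θ) * (1 - r) ^ (-θ)) := by
    have e : l * (t * r) = l * t + -(l * t * (1 - r)) := by ring
    rw [e, Real.exp_add, ← Real.mul_rpow hl.le ht.1.le,
      ← Real.mul_rpow (mul_pos hl ht.1).le h1r.le]
    exact mul_le_mul_of_nonneg_left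
      (Real.exp_neg_le_rpow_neg (mul_pos (mul_pos hl ht.1) h1r) hθ0 hθ1) (Real.exp_pos _).le
  rw [timeExt_of_mem w htr]
  calc ‖P (t - t * r) (w ⟨t * r, htr⟩)‖
      ≤ ‖P (t - t * r)‖ * ‖w ⟨t * r, htr⟩‖ := (P _).le_opNorm _
    _ ≤ (C * (t - t * r) ^ (-a)) *
        (B * (Real.exp (l * t) * (l ^ (-θ) * t ^ (-θ) * (1 - r) ^ (-θ))) *
          (t * r) ^ (κ - 1)) := by
        refine mul_le_mul h1 (h2.trans ?_) (norm_nonneg _) ((norm_nonneg _).trans h1)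
        have := Real.rpow_nonneg htr.1.le (κ - 1)
        gcongr
    _ = _ := by
        have e1 : t - t * r = t * (1 - r) := by ring
        have e2 : κ - 1 - (a + θ) = -a + -θ + (κ - 1) := by ring
        have e3 : -(a + θ) = -a + -θ := by ring
        rw [betaWeight, e1, e2, e3, Real.mul_rpow ht.1.le h1r.le, Real.mul_rpow ht.1.le hr.1.le,
          Real.rpow_add ht.1, Real.rpow_add ht.1, Real.rpow_add h1r]
        ring

theorem continuousOn_integrand (hP : IsSingularKernel P a C T) (w : XSpace Z κ T) {t : ℝ}
    (ht : t ∈ Ioc 0 T) :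
    ContinuousOn (fun r => P (t - t * r) (timeExt w (t * r))) (Ioo 0 1) :=
  (hP.continuousOn.comp (by fun_prop) fun _ hr => sub_mul_mem_Ioc ht hr).clm_apply
    ((continuousOn_timeExt w).comp (by fun_prop) fun _ hr => mul_mem_Ioc ht hr)

theorem integrableOn_integrand (hP : IsSingularKernel P a C T) (ha : a < 1) (hκ : 0 < κ)
    (w : XSpace Z κ T) {t : ℝ} (ht : t ∈ Ioc 0 T) :
    IntegrableOn (fun r => P (t - t * r) (timeExt w (t * r))) (Ioo 0 1) := by
  refine Integrable.mono' ((integrableOn_betaWeight (b := a + 0) (by simpa using ha) hκ).const_mul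
    (C * 1 ^ (-0 : ℝ) * ‖w‖ * Real.exp (1 * t) * t ^ (κ - 1 - (a + 0))))
    ((hP.continuousOn_integrand w ht).aestronglyMeasurable measurableSet_Ioo)
    (ae_restrict_of_forall_mem measurableSet_Ioo fun r hr => ?_)
  refine hP.norm_integrand_le le_rfl zero_le_one one_pos (norm_nonneg w) (fun s => ?_) ht hr
  refine (XSpace.norm_apply_le w s).trans ?_
  refine mul_le_mul_of_nonneg_right ?_ (Real.rpow_nonneg s.2.1.le _)
  exact le_mul_of_one_le_right (norm_nonneg _) (Real.one_le_exp (by linarith [s.2.1]))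

/-- Integration in `r` leaves a Beta integral and the spare power `t ^ (1 - (a + θ))`, at most the
same power of `T`. For `θ > 0` the factor `l ^ (-θ)` makes the operator small in the exponentially
weighted norm; for `θ = 0` the bound gives plain boundedness. -/
theorem norm_volterra_le (hP : IsSingularKernel P a C T) {θ l B : ℝ} (hθ0 : 0 ≤ θ)
    (hθ1 : a + θ < 1) (ha : 0 ≤ a) (hκ : 0 < κ) (hl : 0 < l) (hB : 0 ≤ B) {w : XSpace Z κ T}
    (hw : ∀ s : Ioc (0 : ℝ) T, ‖w s‖ ≤ B * Real.exp (l * s) * (s : ℝ) ^ (κ - 1))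
    {t : ℝ} (ht : t ∈ Ioc 0 T) :
    ‖volterra P w t‖ ≤ C * T ^ (1 - (a + θ)) * (∫ r in Ioo (0 : ℝ) 1, betaWeight (a + θ) κ r) *
      l ^ (-θ) * B * Real.exp (l * t) * t ^ (κ - 1) := by
  have hC := hP.nonneg
  have h1 := norm_integral_le_of_norm_le ((integrableOn_betaWeight hθ1 hκ).const_mul
    (C * l ^ (-θ) * B * Real.exp (l * t) * t ^ (κ - 1 - (a + θ))))
    (ae_restrict_of_forall_mem measurableSet_Ioo fun r hr =>
      hP.norm_integrand_le hθ0 (by linarith) hl hB hw ht hr)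
  rw [integral_const_mul] at h1
  have hJ : 0 ≤ ∫ r in Ioo (0 : ℝ) 1, betaWeight (a + θ) κ r :=
    setIntegral_nonneg measurableSet_Ioo fun r hr => betaWeight_nonneg hr
  set J := ∫ r in Ioo (0 : ℝ) 1, betaWeight (a + θ) κ r
  have ht1 : t * t ^ (κ - 1 - (a + θ)) ≤ T ^ (1 - (a + θ)) * t ^ (κ - 1) := by
    have e : t * t ^ (κ - 1 - (a + θ)) = t ^ (1 - (a + θ)) * t ^ (κ - 1) := by
      nth_rewrite 1 [← Real.rpow_one t]
      rw [← Real.rpow_add ht.1, ← Real.rpow_add ht.1]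
      congr 1; ring
    rw [e]
    exact mul_le_mul_of_nonneg_right (Real.rpow_le_rpow ht.1.le ht.2 (by linarith))
      (Real.rpow_nonneg ht.1.le _)
  rw [volterra, norm_smul, Real.norm_of_nonneg ht.1.le]
  calc t * ‖∫ r in Ioo (0 : ℝ) 1, P (t - t * r) (timeExt w (t * r))‖
      ≤ t * (C * l ^ (-θ) * B * Real.exp (l * t) * t ^ (κ - 1 - (a + θ)) * J) :=
        mul_le_mul_of_nonneg_left h1 ht.1.le
    _ = (C * l ^ (-θ) * B * Real.exp (l * t) * J) * (t * t ^ (κ - 1 - (a + θ))) := by ring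
    _ ≤ (C * l ^ (-θ) * B * Real.exp (l * t) * J) * (T ^ (1 - (a + θ)) * t ^ (κ - 1)) := by
        have := Real.rpow_nonneg hl.le (-θ)
        gcongr
    _ = _ := by ring

/-- In the variable `r = s / t` the domain of integration no longer depends on `t`, so dominated
convergence applies. -/
theorem continuous_volterra (hP : IsSingularKernel P a C T) (ha : a < 1)
    (hκ : 0 < κ) (w : XSpace Z κ T) :
    Continuous fun t : Ioc (0 : ℝ) T => volterra P w (t : ℝ) := by
  have hpow : ∀ c : ℝ, Continuous fun t : Ioc (0 : ℝ) T => (t : ℝ) ^ c := fun c =>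
    continuous_subtype_val.rpow_const fun t => Or.inl t.2.1.ne'
  set c := κ - 1 - (a + 0) with hc
  have hw : ∀ s : Ioc (0 : ℝ) T, ‖w s‖ ≤ ‖w‖ * Real.exp (1 * s) * (s : ℝ) ^ (κ - 1) := fun s => by
    refine (XSpace.norm_apply_le w s).trans ?_
    refine mul_le_mul_of_nonneg_right ?_ (Real.rpow_nonneg s.2.1.le _)
    exact le_mul_of_one_le_right (norm_nonneg _) (Real.one_le_exp (by linarith [s.2.1]))
  have hC := hP.nonneg
  -- The factor `t ^ (-c)` cancels the power of `t` in the bound on the integrand, so that one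
  -- dominating function serves all `t ∈ (0, T]`; it is removed again at the end.
  have h1 : Continuous fun t : Ioc (0 : ℝ) T => ∫ r in Ioo (0 : ℝ) 1,
      (t : ℝ) ^ (-c) • P (t - t * r) (timeExt w (t * r)) := by
    refine continuous_of_dominated (bound := fun r => C * 1 ^ (-0 : ℝ) * ‖w‖ * Real.exp (1 * T) *
      betaWeight (a + 0) κ r) (fun t => ?_) (fun t => ?_)
      ((integrableOn_betaWeight (by simpa using ha) hκ).const_mul _) ?_
    · exact ((hP.continuousOn_integrand w t.2).const_smul _).aestronglyMeasurable measurableSet_Ioo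
    · refine ae_restrict_of_forall_mem measurableSet_Ioo fun r hr => ?_
      rw [norm_smul, Real.norm_of_nonneg (Real.rpow_nonneg t.2.1.le _)]
      have h2 := hP.norm_integrand_le le_rfl zero_le_one one_pos (norm_nonneg w) hw t.2 hr
      have h3 : (t : ℝ) ^ (-c) * (t : ℝ) ^ c = 1 := by rw [← Real.rpow_add t.2.1]; simp
      have h4 := Real.exp_le_exp.2 (mul_le_mul_of_nonneg_left t.2.2 zero_le_one)
      have h5 := betaWeight_nonneg (b := a + 0) (κ := κ) hr
      have h6 : 0 < (t : ℝ) ^ (-c) := Real.rpow_pos_of_pos t.2.1 _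
      calc _ ≤ (t : ℝ) ^ (-c) * (C * 1 ^ (-0 : ℝ) * ‖w‖ * Real.exp (1 * t) * (t : ℝ) ^ c *
            betaWeight (a + 0) κ r) := mul_le_mul_of_nonneg_left h2 h6.le
        _ = C * 1 ^ (-0 : ℝ) * ‖w‖ * Real.exp (1 * t) * betaWeight (a + 0) κ r *
            ((t : ℝ) ^ (-c) * (t : ℝ) ^ c) := by ring
        _ ≤ _ := by
            rw [h3, mul_one]
            gcongr
    · refine ae_restrict_of_forall_mem measurableSet_Ioo fun r hr => ?_
      refine (hpow _).smul (Continuous.clm_apply ?_ ?_)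
      · exact hP.continuousOn.comp_continuous (by fun_prop) fun t => sub_mul_mem_Ioc t.2 hr
      · exact (continuousOn_timeExt w).comp_continuous (by fun_prop) fun t => mul_mem_Ioc t.2 hr
  refine (continuous_subtype_val.smul ((hpow c).smul h1)).congr fun t => ?_
  change (t : ℝ) • (t : ℝ) ^ c • (∫ r in Ioo (0 : ℝ) 1,
    (t : ℝ) ^ (-c) • P (t - t * r) (timeExt w (t * r))) = _
  rw [integral_smul, smul_smul ((t : ℝ) ^ c), ← Real.rpow_add t.2.1, add_neg_cancel,
    Real.rpow_zero, one_smul, volterra]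

theorem exists_volterraCLM (hP : IsSingularKernel P a C T) (ha0 : 0 ≤ a) (ha : a < 1)
    (hκ : 0 < κ) :
    ∃ S : XSpace Z κ T →L[ℝ] XSpace Y κ T, ∀ w (t : Ioc (0 : ℝ) T), S w t = volterra P w t := by
  have hw : ∀ (w : XSpace Z κ T) (s : Ioc (0 : ℝ) T),
      ‖w s‖ ≤ ‖w‖ * Real.exp (1 * s) * (s : ℝ) ^ (κ - 1) := fun w s => by
    refine (XSpace.norm_apply_le w s).trans ?_
    refine mul_le_mul_of_nonneg_right ?_ (Real.rpow_nonneg s.2.1.le _)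
    exact le_mul_of_one_le_right (norm_nonneg _) (Real.one_le_exp (by linarith [s.2.1]))
  have hC := hP.nonneg
  set J := ∫ r in Ioo (0 : ℝ) 1, betaWeight (a + 0) κ r with hJdef
  have hJ : 0 ≤ J := setIntegral_nonneg measurableSet_Ioo fun r hr => betaWeight_nonneg hr
  set D := C * T ^ (1 - (a + 0)) * J * Real.exp (1 * T) with hD
  have hb : ∀ (w : XSpace Z κ T) (t : Ioc (0 : ℝ) T),
      ‖volterra P w t‖ ≤ D * ‖w‖ * (t : ℝ) ^ (κ - 1) := fun w t => by
    refine (hP.norm_volterra_le le_rfl (by simpa using ha) ha0 hκ one_pos (norm_nonneg w)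
      (hw w) t.2).trans ?_
    have h4 := Real.exp_le_exp.2 (mul_le_mul_of_nonneg_left t.2.2 zero_le_one)
    have h5 := Real.rpow_nonneg t.2.1.le (κ - 1)
    have h6 : 0 ≤ T ^ (1 - (a + 0)) := Real.rpow_nonneg (t.2.1.le.trans t.2.2) _
    rw [Real.one_rpow, mul_one, hD, ← hJdef]
    calc _ = C * T ^ (1 - (a + 0)) * J * Real.exp (1 * t) * ‖w‖ * (t : ℝ) ^ (κ - 1) := by ring
      _ ≤ _ := by gcongr
  choose S hS using fun w => XSpace.exists_of_bound (hP.continuous_volterra ha hκ w) (hb w)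
  -- For `T < 0` the time interval is empty, and real powers of `T` need not be nonnegative, so `0 ≤
  -- D` could fail.
  by_cases hT : T < 0
  · exact ⟨0, fun w t => absurd (t.2.1.trans_le t.2.2) hT.not_gt⟩
  have hD0 : 0 ≤ D := by
    have : 0 ≤ T ^ (1 - (a + 0)) := Real.rpow_nonneg (not_lt.1 hT) _
    positivity
  refine ⟨LinearMap.mkContinuous
    { toFun := S
      map_add' := fun w w' => XSpace.ext_apply fun t => ?_
      map_smul' := fun c w => XSpace.ext_apply fun t => ?_ } D fun w => ?_, fun w t => hS w t⟩
  · rw [XSpace.add_apply, hS, hS, hS, volterra, volterra, volterra, ← smul_add, ← integral_add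
      (hP.integrableOn_integrand ha hκ w t.2) (hP.integrableOn_integrand ha hκ w' t.2)]
    simp_rw [timeExt_add, map_add]
  · rw [RingHom.id_apply, XSpace.smul_apply, hS, hS, volterra, volterra, smul_comm c,
      ← integral_smul c]
    simp_rw [timeExt_smul, map_smul]
  · refine XSpace.norm_le_of_forall (mul_nonneg hD0 (norm_nonneg w)) fun t => ?_
    exact (congrArg norm (hS w t)).trans_le (hb w t)

/-- Integrability and evaluation of the Volterra integral in the original time variable. -/
theorem intervalIntegrable_and_volterra_eq (hP : IsSingularKernel P a C T) (ha : a < 1)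
    (hκ : 0 < κ) (w : XSpace Z κ T) {t : ℝ} (ht : t ∈ Ioc 0 T) :
    IntervalIntegrable (fun s => P (t - s) (timeExt w s)) volume 0 t ∧
      volterra P w t = ∫ s in (0 : ℝ)..t, P (t - s) (timeExt w s) := by
  have h1 := hP.integrableOn_integrand ha hκ w ht
  constructor
  · have h2 := (intervalIntegrable_iff_integrableOn_Ioo_of_le zero_le_one).2 h1
    have h3 := IntervalIntegrable.comp_mul_left_iff (f := fun s => P (t - s) (timeExt w s))
      (a := 0) (b := t) (c := t) ht.1.ne'
    rw [zero_div, div_self ht.1.ne'] at h3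
    exact h3.1 h2
  · have h2 := intervalIntegral.smul_integral_comp_mul_left (a := 0) (b := 1)
      (fun s => P (t - s) (timeExt w s)) t
    rw [mul_zero, mul_one] at h2
    rw [← h2, intervalIntegral.integral_of_le zero_le_one, integral_Ioc_eq_integral_Ioo, volterra]

/-- For every bounded `A`, the operator `1 - ∫_0^t P (t - s) A` is invertible. -/
theorem isUnit_one_sub_volterra [CompleteSpace Y] (hP : IsSingularKernel P a C T) (ha0 : 0 ≤ a)
    (ha : a < 1) (hκ : 0 < κ) {S : XSpace Z κ T →L[ℝ] XSpace Y κ T}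
    (hS : ∀ w (t : Ioc (0 : ℝ) T), S w t = volterra P w t) (A : Y →L[ℝ] Z) :
    IsUnit (1 - S ∘L XSpace.compCLM Y κ T Z A) := by
  have : CompleteSpace (XSpace Y κ T) := XSpace.completeSpace
  set K := S ∘L XSpace.compCLM Y κ T Z A with hK
  -- Positive, so that large `l` helps, and still `a + θ < 1`, so that the Beta integral converges.
  set θ := (1 - a) / 2 with hθ
  set D := C * T ^ (1 - (a + θ)) * (∫ r in Ioo (0 : ℝ) 1, betaWeight (a + θ) κ r) * ‖A‖ with hD
  obtain ⟨l, hl0, hl⟩ : ∃ l : ℝ, 0 < l ∧ D * l ^ (-θ) ≤ 1 / 2 := by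
    have h1 : Tendsto (fun l : ℝ => D * l ^ (-θ)) atTop (𝓝 (D * 0)) :=
      (tendsto_rpow_neg_atTop (by linarith)).const_mul D
    rw [mul_zero] at h1
    obtain ⟨l, h2, h3⟩ := ((h1.eventually (gt_mem_nhds (by norm_num : (0 : ℝ) < 1 / 2))).and
      (eventually_gt_atTop 0)).exists
    exact ⟨l, h3, h2.le⟩
  have hstep : ∀ (v : XSpace Y κ T) (B : ℝ), 0 ≤ B →
      (∀ s : Ioc (0 : ℝ) T, ‖v s‖ ≤ B * Real.exp (l * s) * (s : ℝ) ^ (κ - 1)) →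
      ∀ t : Ioc (0 : ℝ) T, ‖K v t‖ ≤ 1 / 2 * B * Real.exp (l * t) * (t : ℝ) ^ (κ - 1) := by
    intro v B hB hv t
    have h1 := hP.norm_volterra_le (θ := θ) (by linarith) (by linarith) ha0 hκ hl0
      (mul_nonneg (norm_nonneg A) hB) (w := XSpace.compCLM Y κ T Z A v) (fun s => by
        rw [XSpace.compCLM_apply, mul_assoc, mul_assoc, ← mul_assoc B]
        exact (A.le_opNorm _).trans (mul_le_mul_of_nonneg_left (hv s) (norm_nonneg A))) t.2
    have h2 : K v t = volterra P (XSpace.compCLM Y κ T Z A v) t := hS _ _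
    rw [h2]
    refine h1.trans ?_
    have h5 := Real.rpow_nonneg t.2.1.le (κ - 1)
    calc _ = (D * l ^ (-θ)) * B * Real.exp (l * t) * (t : ℝ) ^ (κ - 1) := by rw [hD]; ring
      _ ≤ _ := by gcongr
  have hiter : ∀ (n : ℕ) (v : XSpace Y κ T) (t : Ioc (0 : ℝ) T),
      ‖(K ^ n) v t‖ ≤ (1 / 2) ^ n * ‖v‖ * Real.exp (l * t) * (t : ℝ) ^ (κ - 1) := by
    intro n v
    induction n with
    | zero =>
      intro t
      rw [pow_zero, pow_zero, one_mul]
      refine (XSpace.norm_apply_le v t).trans ?_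
      refine mul_le_mul_of_nonneg_right ?_ (Real.rpow_nonneg t.2.1.le _)
      exact le_mul_of_one_le_right (norm_nonneg _)
        (Real.one_le_exp (mul_pos hl0 t.2.1).le)
    | succ n ih =>
      intro t
      have h1 := hstep ((K ^ n) v) _ (by positivity) ih t
      rw [pow_succ' K, pow_succ', mul_assoc (1 / 2 : ℝ)]
      exact h1
  -- Passing from the exponentially weighted bound to the original norm costs the factor `exp (l T)`
  -- only once, not once per iteration.
  have hnorm : ∀ n : ℕ, ‖K ^ n‖ ≤ (1 / 2) ^ n * Real.exp (l * T) := fun n => by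
    refine ContinuousLinearMap.opNorm_le_bound _ (by positivity) fun v => ?_
    refine XSpace.norm_le_of_forall (by positivity) fun t => (hiter n v t).trans ?_
    have h5 := Real.rpow_nonneg t.2.1.le (κ - 1)
    have h4 := Real.exp_le_exp.2 (mul_le_mul_of_nonneg_left t.2.2 hl0.le)
    calc _ = (1 / 2) ^ n * Real.exp (l * t) * ‖v‖ * (t : ℝ) ^ (κ - 1) := by ring
      _ ≤ _ := by gcongr
  obtain ⟨n, hn⟩ : ∃ n : ℕ, (1 / 2 : ℝ) ^ n * Real.exp (l * T) < 1 := by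
    have h1 := (tendsto_pow_atTop_nhds_zero_of_lt_one (by norm_num : (0 : ℝ) ≤ 1 / 2)
      (by norm_num)).mul_const (Real.exp (l * T))
    rw [zero_mul] at h1
    exact (h1.eventually (gt_mem_nhds one_pos)).exists
  have h1 : IsUnit (1 - K ^ n) := isUnit_one_sub_of_norm_lt_one ((hnorm n).trans_lt hn)
  -- `1 - K ^ n` is the product of `1 - K` with the geometric sum, and the two commute; a factor of
  -- a unit in a commuting product is a unit.
  rw [← mul_neg_geom_sum] at h1
  refine (Commute.isUnit_mul_iff ?_).1 h1 |>.1
  exact (mul_neg_geom_sum K n).trans (geom_sum_mul_neg K n).symm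

end IsSingularKernel

end Volterra

/-! ### Pairing a distribution of negative regularity with decaying `C¹` functions -/

/-- Compactly supported `C¹` functions on the line. -/
abbrev C1Test := 𝓓^{1}((⊤ : Opens ℝ), ℝ)

/-- Distributions of order at most one on the line. -/
abbrev Dist1 := 𝓓'^{1}((⊤ : Opens ℝ), ℝ)

theorem rescale_apply (η : C1Test) (x l y : ℝ) : rescale η x l y = l⁻¹ * η (l⁻¹ * (y - x)) := rfl

theorem mulTest_apply (φ : ℝ → ℝ) (hφ : ContDiff ℝ 1 φ) (η : C1Test) (y : ℝ) :
    mulTest φ hφ η y = φ y * η y := rfl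

theorem C1Test.smul_apply (c : ℝ) (η : C1Test) (y : ℝ) : (c • η) y = c * η y := rfl

theorem C1Test.hasDerivAt (η : C1Test) (y : ℝ) : HasDerivAt η (deriv η y) y :=
  (η.contDiff.differentiable one_ne_zero y).hasDerivAt

theorem deriv_rescale (η : C1Test) (x l y : ℝ) :
    deriv (rescale η x l) y = l⁻¹ * (l⁻¹ * deriv η (l⁻¹ * (y - x))) := by
  have h1 : HasDerivAt (fun y : ℝ => l⁻¹ * (y - x)) (l⁻¹ * 1) y :=
    ((hasDerivAt_id y).sub_const x).const_mul _
  have h2 := ((η.hasDerivAt (l⁻¹ * (y - x))).comp y h1).const_mul l⁻¹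
  refine (HasDerivAt.deriv (f := rescale η x l) h2).trans ?_
  ring

theorem deriv_smul_test (c : ℝ) (η : C1Test) (y : ℝ) : deriv (c • η) y = c * deriv η y :=
  ((η.hasDerivAt y).const_mul c).deriv

theorem deriv_mulTest (φ : ℝ → ℝ) (hφ : ContDiff ℝ 1 φ) (η : C1Test) (y : ℝ) :
    deriv (mulTest φ hφ η) y = deriv φ y * η y + φ y * deriv η y :=
  (((hφ.differentiable one_ne_zero y).hasDerivAt).mul (η.hasDerivAt y)).deriv

theorem C1Test.exists_bounds (η : C1Test) :
    ∃ A, 0 ≤ A ∧ (∀ y, |η y| ≤ A) ∧ ∀ y, |deriv η y| ≤ A := by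
  obtain ⟨A, hA⟩ := η.hasCompactSupport.exists_bound_of_continuous η.continuous
  obtain ⟨B, hB⟩ := η.hasCompactSupport.deriv.exists_bound_of_continuous
    (η.contDiff.continuous_deriv le_rfl)
  exact ⟨max A B, (norm_nonneg _).trans ((hA 0).trans (le_max_left _ _)),
    fun y => (hA y).trans (le_max_left _ _), fun y => (hB y).trans (le_max_right _ _)⟩

theorem C1Test.exists_radius (η : C1Test) : ∃ R, 1 ≤ R ∧ ∀ y, R < |y| → η y = 0 := by
  obtain ⟨R, hR⟩ := η.hasCompactSupport.isCompact.isBounded.subset_closedBall 0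
  refine ⟨max R 1, le_max_right _ _, fun y hy => ?_⟩
  by_contra h0
  have := hR (subset_tsupport _ h0)
  rw [Metric.mem_closedBall, dist_zero_right, Real.norm_eq_abs] at this
  exact absurd hy (not_lt.2 (this.trans (le_max_left _ _)))

theorem deriv_eq_zero_of_forall_lt {φ : ℝ → ℝ} {x l y : ℝ} (h : ∀ y, l < |y - x| → φ y = 0)
    (hy : l < |y - x|) : deriv φ y = 0 := by
  have h1 : φ =ᶠ[𝓝 y] fun _ => 0 := by
    filter_upwards [(isOpen_lt continuous_const
      (continuous_id.sub continuous_const).abs).mem_nhds hy] with z hz using h z hz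
  rw [h1.deriv_eq, deriv_const]

namespace NegHolderSpace

variable {α : ℝ}

/-- The norm controls the action on test functions localized at scale `l`. -/
theorem abs_apply_le (f : NegHolderSpace α) {x l M : ℝ} (hl0 : 0 < l) (hl1 : l ≤ 1) (φ : C1Test)
    (hsupp : ∀ y, l < |y - x| → φ y = 0) (h0 : ∀ y, |φ y| ≤ M) (h1 : ∀ y, |deriv φ y| ≤ M / l) :
    |f.toDist φ| ≤ ‖f‖ * M * l ^ (1 + α) := by
  rcases ((abs_nonneg _).trans (h0 0)).eq_or_lt with rfl | hM
  · have : φ = 0 := by ext y; exact abs_nonpos_iff.1 (h0 y)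
    rw [this, map_zero]
    simp
  -- Rescaling by `l⁻¹` multiplies by `l`, so this is `y ↦ M⁻¹ φ (l y + x)`: the profile of `φ`
  -- blown up to unit scale and normalized to be a probe.
  set η : C1Test := (M * l)⁻¹ • rescale φ (-x / l) l⁻¹ with hη
  have hη1 : ∀ y, η y = M⁻¹ * φ (l * y + x) := fun y => by
    rw [hη, C1Test.smul_apply, rescale_apply]
    have : l⁻¹⁻¹ * (y - -x / l) = l * y + x := by field_simp; ring
    rw [this]
    field_simp
  have hη2 : ∀ y, deriv η y = M⁻¹ * l * deriv φ (l * y + x) := fun y => by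
    rw [hη, deriv_smul_test, deriv_rescale]
    have : l⁻¹⁻¹ * (y - -x / l) = l * y + x := by field_simp; ring
    rw [this]
    field_simp
  let i : HolderProbe :=
    { x := x
      η := η
      l := l
      support_subset := by
        refine closure_minimal (fun y hy => ?_) isClosed_Icc
        rw [mem_Icc, ← abs_le]
        by_contra hy'
        refine hy ?_
        rw [hη1, hsupp, mul_zero]
        rw [add_sub_cancel_right, abs_mul, abs_of_pos hl0]
        nlinarith
      abs_le := fun y => by
        rw [hη1, abs_mul, abs_of_pos (inv_pos.2 hM), inv_mul_le_iff₀ hM, mul_one]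
        exact h0 _
      abs_deriv_le := fun y => by
        rw [hη2, abs_mul, abs_of_pos (by positivity)]
        have := h1 (l * y + x)
        rw [le_div_iff₀ hl0] at this
        rw [mul_assoc, inv_mul_le_iff₀ hM]
        linarith
      l_pos := hl0
      l_le := hl1 }
  have hi : rescale i.η i.x i.l = (M * l)⁻¹ • φ := by
    ext y
    change l⁻¹ * η (l⁻¹ * (y - x)) = (M * l)⁻¹ * φ y
    rw [hη1, mul_inv_cancel_left₀ hl0.ne', sub_add_cancel]
    field_simp
  have h2 : probeValue α f.toDist i ≤ ‖f‖ := le_ciSup f.2 i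
  unfold probeValue at h2
  rw [hi, map_smul, smul_eq_mul, abs_mul, abs_of_pos (by positivity)] at h2
  change l ^ (-α) * _ ≤ _ at h2
  have h3 : l ^ (-α) * l ^ α = 1 := by rw [← Real.rpow_add hl0]; simp
  have h4 : 0 < l ^ α := Real.rpow_pos_of_pos hl0 _
  rw [Real.rpow_add hl0, Real.rpow_one]
  calc |f.toDist φ| = (l ^ (-α) * ((M * l)⁻¹ * |f.toDist φ|)) * (M * (l * l ^ α)) := by
        have : (l ^ (-α) * ((M * l)⁻¹ * |f.toDist φ|)) * (M * (l * l ^ α)) =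
          (l ^ (-α) * l ^ α) * ((M * l)⁻¹ * (M * l)) * |f.toDist φ| := by ring
        rw [this, h3, inv_mul_cancel₀ (by positivity), one_mul, one_mul]
    _ ≤ ‖f‖ * (M * (l * l ^ α)) := mul_le_mul_of_nonneg_right h2 (by positivity)
    _ = _ := by ring

end NegHolderSpace

/-- A function that is `1` on `[-m, m]` and is supported in `[-(m + 1), m + 1]`. -/
def plateau (m : ℕ) : C1Test where
  toFun z := Real.smoothTransition (z + 1 + m) - Real.smoothTransition (z - m)
  contDiff' := (Real.smoothTransition.contDiff.comp
      ((contDiff_id.add contDiff_const).add contDiff_const)).sub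
    (Real.smoothTransition.contDiff.comp (contDiff_id.sub contDiff_const))
  hasCompactSupport' := by
    refine HasCompactSupport.intro (isCompact_Icc (a := -(m + 1 : ℝ)) (b := m + 1)) fun z hz => ?_
    have hm : (0 : ℝ) ≤ m := Nat.cast_nonneg m
    rw [mem_Icc, not_and_or, not_le, not_le] at hz
    rcases hz with hz | hz
    · rw [Real.smoothTransition.zero_of_nonpos (by linarith),
        Real.smoothTransition.zero_of_nonpos (by linarith), sub_zero]
    · rw [Real.smoothTransition.one_of_one_le (by linarith),
        Real.smoothTransition.one_of_one_le (by linarith), sub_self]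
  tsupport_subset' := fun _ _ => trivial

theorem plateau_apply (m : ℕ) (z : ℝ) :
    plateau m z = Real.smoothTransition (z + 1 + m) - Real.smoothTransition (z - m) := rfl

theorem plateau_eq_zero {m : ℕ} {z : ℝ} (hz : m + 1 < |z|) : plateau m z = 0 := by
  have hm : (0 : ℝ) ≤ m := Nat.cast_nonneg m
  rw [plateau_apply]
  rcases lt_abs.1 hz with hz | hz
  · rw [Real.smoothTransition.one_of_one_le (by linarith),
        Real.smoothTransition.one_of_one_le (by linarith), sub_self]
  · rw [Real.smoothTransition.zero_of_nonpos (by linarith),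
        Real.smoothTransition.zero_of_nonpos (by linarith), sub_zero]

theorem plateau_eq_one {m : ℕ} {z : ℝ} (hz : |z| ≤ m) : plateau m z = 1 := by
  obtain ⟨h1, h2⟩ := abs_le.1 hz
  rw [plateau_apply, Real.smoothTransition.one_of_one_le (by linarith),
    Real.smoothTransition.zero_of_nonpos (by linarith), sub_zero]

theorem abs_plateau_le (m : ℕ) (z : ℝ) : |plateau m z| ≤ 1 := by
  rw [plateau_apply, abs_le]
  have h1 := Real.smoothTransition.nonneg (z + 1 + m)
  have h2 := Real.smoothTransition.nonneg (z - m)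
  have h3 := Real.smoothTransition.le_one (z + 1 + m)
  have h4 := Real.smoothTransition.le_one (z - m)
  constructor <;> linarith

theorem exists_bump_bound : ∃ D, 0 ≤ D ∧ ∀ z, |deriv (plateau 0) z| ≤ D := by
  obtain ⟨A, hA0, -, hA⟩ := (plateau 0).exists_bounds
  exact ⟨A, hA0, hA⟩

/-- The constant in the localized estimates: one plus a bound on the derivative of the bump. -/
def bumpConst : ℝ := 1 + exists_bump_bound.choose

theorem bumpConst_nonneg : 0 ≤ bumpConst := by
  have := exists_bump_bound.choose_spec.1
  unfold bumpConst
  linarith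

/-- The partition of unity at scale `l`, centered at the points `x + k l`. -/
def bump (x l : ℝ) (k : ℤ) : C1Test := l • rescale (plateau 0) (x + k * l) l

/-! ### Partition of unity at scale `l` -/

section Bump

variable {x l : ℝ}

theorem bump_apply (hl : 0 < l) (k : ℤ) (y : ℝ) :
    bump x l k y = plateau 0 (l⁻¹ * (y - (x + k * l))) := by
  rw [bump, C1Test.smul_apply, rescale_apply, mul_inv_cancel_left₀ hl.ne']

theorem abs_bump_le (hl : 0 < l) (k : ℤ) (y : ℝ) : |bump x l k y| ≤ 1 := by
  rw [bump_apply hl]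
  exact abs_plateau_le _ _

theorem bump_eq_zero (hl : 0 < l) {k : ℤ} {y : ℝ} (hy : l < |y - (x + k * l)|) :
    bump x l k y = 0 := by
  rw [bump_apply hl, plateau_eq_zero]
  rw [abs_mul, abs_of_pos (inv_pos.2 hl), lt_inv_mul_iff₀ hl]
  simpa using hy

theorem abs_deriv_bump_le (hl : 0 < l) (k : ℤ) (y : ℝ) :
    |deriv (bump x l k) y| ≤ (bumpConst - 1) / l := by
  rw [bump, deriv_smul_test, deriv_rescale, mul_inv_cancel_left₀ hl.ne', abs_mul,
    abs_of_pos (inv_pos.2 hl), div_eq_inv_mul]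
  refine mul_le_mul_of_nonneg_left ?_ (inv_pos.2 hl).le
  rw [bumpConst, add_sub_cancel_left]
  exact exists_bump_bound.choose_spec.2 _

/-- Any test function is a finite sum of localized pieces. -/
theorem hasSum_apply_mul_bump (f : Dist1) (φ : C1Test) (x : ℝ) (hl : 0 < l) :
    HasSum (fun k : ℤ => f (mulTest φ φ.contDiff (bump x l k))) (f φ) := by
  obtain ⟨R, -, hR⟩ := φ.exists_radius
  obtain ⟨N, hN⟩ := exists_nat_gt ((R + |x|) / l)
  rw [div_lt_iff₀ hl] at hN
  have hφ0 : ∀ y, N * l < |y - x| → φ y = 0 := fun y hy => hR y (by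
    have := abs_sub y x
    linarith)
  -- The indices `|k| ≤ N + 1`, listed from `-(N + 1)` upwards so that the sum telescopes; they
  -- cover the ball of radius `N l` about `x`, which contains the support of `φ`.
  let e : ℕ ↪ ℤ := ⟨fun i => -(N + 1 : ℤ) + i, fun i j h => by simpa using h⟩
  have hsum : f φ = ∑ k ∈ (Finset.range (2 * N + 3)).map e,
      f (mulTest φ φ.contDiff (bump x l k)) := by
    rw [← map_sum]
    congr 1
    ext y
    have h1 : (∑ k ∈ (Finset.range (2 * N + 3)).map e, mulTest φ φ.contDiff (bump x l k)) y =
        ∑ k ∈ (Finset.range (2 * N + 3)).map e, φ y * bump x l k y :=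
      map_sum (Distribution.delta (n := 1) (Ω := (⊤ : Opens ℝ)) y) _ _
    rw [h1, ← Finset.mul_sum]
    rcases lt_or_ge (N * l) |y - x| with hy | hy
    · rw [hφ0 y hy, zero_mul]
    · rw [Finset.sum_map]
      set g : ℕ → ℝ := fun i => Real.smoothTransition (l⁻¹ * (y - x) + N + 2 - i) with hg
      have h2 : ∀ i : ℕ, bump x l (e i) y = g i - g (i + 1) := fun i => by
        have e1 : l⁻¹ * (y - (x + ((e i : ℤ) : ℝ) * l)) = l⁻¹ * (y - x) + N + 1 - i := by
          change l⁻¹ * (y - (x + ((-(N + 1 : ℤ) + i : ℤ) : ℝ) * l)) = _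
          push_cast
          field_simp
          ring
        rw [bump_apply hl, plateau_apply, e1, hg]
        simp only [Nat.cast_zero, add_zero, sub_zero]
        push_cast
        congr 2 <;> ring
      simp_rw [h2]
      have h3 : |l⁻¹ * (y - x)| ≤ N := by
        rw [abs_mul, abs_of_pos (inv_pos.2 hl), inv_mul_le_iff₀ hl]
        linarith
      obtain ⟨h4, h5⟩ := abs_le.1 h3
      rw [Finset.sum_range_sub', hg]
      simp only
      push_cast
      rw [Real.smoothTransition.one_of_one_le (by linarith),
        Real.smoothTransition.zero_of_nonpos (by linarith), sub_zero, mul_one]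
  rw [hsum]
  refine hasSum_sum_of_ne_finset_zero fun k hk => ?_
  have : mulTest φ φ.contDiff (bump x l k) = 0 := by
    ext y
    change φ y * bump x l k y = 0
    rcases lt_or_ge (N * l) |y - x| with hy | hy
    · rw [hφ0 y hy, zero_mul]
    · rw [bump_eq_zero hl, mul_zero]
      -- The center `x + k l` is then at distance at least `2 l` from every point within `N l` of
      -- `x`, outside the reach of the bump.
      have hk' : (N : ℤ) + 2 ≤ |k| := by
        by_contra hcon
        refine hk (Finset.mem_map.2 ⟨(k + (N + 1)).toNat, ?_, ?_⟩)
        · rw [Finset.mem_range]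
          have := abs_lt.1 (not_le.1 hcon)
          omega
        · change -(N + 1 : ℤ) + ((k + (N + 1)).toNat : ℤ) = k
          have := abs_lt.1 (not_le.1 hcon)
          omega
      have hk2 : (N : ℝ) + 2 ≤ |(k : ℝ)| := by exact_mod_cast hk'
      have h6 : |(k : ℝ) * l| ≤ |y - x| + |y - (x + k * l)| := by
        have := abs_sub (y - x) (y - (x + k * l))
        have e1 : y - x - (y - (x + k * l)) = k * l := by ring
        rwa [e1] at this
      rw [abs_mul, abs_of_pos hl] at h6
      nlinarith
  rw [this, map_zero]

end Bump

/-- `a k` bounds `|φ|` and `l |φ'|` on the interval of radius `l` about `x + k l`. -/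
def LocallyBounded (φ : ℝ → ℝ) (x l : ℝ) (a : ℤ → ℝ) : Prop :=
  ∀ (k : ℤ) (y : ℝ), |y - (x + k * l)| ≤ l → |φ y| ≤ a k ∧ |deriv φ y| ≤ a k / l

theorem LocallyBounded.nonneg {φ : ℝ → ℝ} {x l : ℝ} {a : ℤ → ℝ} (h : LocallyBounded φ x l a)
    (hl : 0 < l) (k : ℤ) : 0 ≤ a k :=
  (abs_nonneg _).trans (h k (x + k * l) (by simpa using hl.le)).1

theorem LocallyBounded.mulTest {φ : ℝ → ℝ} {x l : ℝ} {a : ℤ → ℝ} (h : LocallyBounded φ x l a)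
    (hl : 0 < l) (hφ : ContDiff ℝ 1 φ) {η : C1Test} {A B : ℝ} (hA : ∀ y, |η y| ≤ A)
    (hB : ∀ y, |deriv η y| ≤ B / l) :
    LocallyBounded (mulTest φ hφ η) x l fun k => (A + B) * a k := by
  intro k y hy
  obtain ⟨h1, h2⟩ := h k y hy
  have h3 := h.nonneg hl k
  have hA0 := (abs_nonneg _).trans (hA y)
  have hB0 : 0 ≤ B := by
    have := (abs_nonneg _).trans (hB y)
    rwa [le_div_iff₀ hl, zero_mul] at this
  constructor
  · rw [mulTest_apply, abs_mul]
    calc |φ y| * |η y| ≤ a k * A := mul_le_mul h1 (hA y) (abs_nonneg _) h3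
      _ ≤ (A + B) * a k := by nlinarith
  · rw [deriv_mulTest]
    calc |deriv φ y * η y + φ y * deriv η y| ≤ |deriv φ y| * |η y| + |φ y| * |deriv η y| := by
          rw [← abs_mul, ← abs_mul]; exact abs_add_le _ _
      _ ≤ a k / l * A + a k * (B / l) :=
          add_le_add (mul_le_mul h2 (hA y) (abs_nonneg _) (by positivity))
            (mul_le_mul h1 (hB y) (abs_nonneg _) h3)
      _ = (A + B) * a k / l := by ring

namespace NegHolderSpace

variable {α : ℝ}

/-- After multiplication by a bump, only the bound `a k` on one interval matters, and the piece is a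
multiple of a probe at scale `l`. By the Leibniz rule `bumpConst` collects `1` for the bump and the
bound on its derivative. -/
theorem abs_apply_mul_bump_le (f : NegHolderSpace α) {x l : ℝ} (hl0 : 0 < l) (hl1 : l ≤ 1)
    {φ : ℝ → ℝ} (hφ : ContDiff ℝ 1 φ) {a : ℤ → ℝ} (h : LocallyBounded φ x l a) (k : ℤ) :
    |f.toDist (mulTest φ hφ (bump x l k))| ≤ ‖f‖ * bumpConst * l ^ (1 + α) * a k := by
  have h1 := h.mulTest hl0 hφ (abs_bump_le hl0 k) (abs_deriv_bump_le (x := x) hl0 k)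
  have h0 : ∀ y, l < |y - (x + k * l)| → mulTest φ hφ (bump x l k) y = 0 := fun y hy => by
    rw [mulTest_apply, bump_eq_zero hl0 hy, mul_zero]
  have ha := h.nonneg hl0 k
  have hc := bumpConst_nonneg
  have h2 := f.abs_apply_le hl0 hl1 (M := bumpConst * a k) (x := x + k * l)
    (mulTest φ hφ (bump x l k)) h0
    (fun y => by
      rcases lt_or_ge l |y - (x + k * l)| with hy | hy
      · rw [h0 y hy, abs_zero]; positivity
      · simpa using (h1 k y hy).1)
    (fun y => by
      rcases lt_or_ge l |y - (x + k * l)| with hy | hy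
      · rw [deriv_eq_zero_of_forall_lt h0 hy, abs_zero]; positivity
      · simpa using (h1 k y hy).2)
  exact h2.trans_eq (by ring)

theorem abs_apply_le_tsum (f : NegHolderSpace α) {x l : ℝ} (hl0 : 0 < l) (hl1 : l ≤ 1)
    (φ : C1Test) {a : ℤ → ℝ} (h : LocallyBounded φ x l a) (ha : Summable a) :
    |f.toDist φ| ≤ ‖f‖ * bumpConst * l ^ (1 + α) * ∑' k, a k := by
  rw [← (hasSum_apply_mul_bump f.toDist φ x hl0).tsum_eq, ← Real.norm_eq_abs]
  exact tsum_of_norm_bounded (ha.hasSum.mul_left _)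
    fun k => f.abs_apply_mul_bump_le hl0 hl1 φ.contDiff h k

end NegHolderSpace

/-- The pairing of a distribution with a `C¹` function that need not be compactly supported, as
the limit of the pairings with its truncations. -/
def HasPairing (f : Dist1) (φ : ℝ → ℝ) (hφ : ContDiff ℝ 1 φ) (c : ℝ) : Prop :=
  ∀ χ : C1Test, (∀ᶠ y in 𝓝 (0 : ℝ), χ y = 1) →
    Tendsto (fun R : ℝ => f (mulTest φ hφ (R • rescale χ 0 R))) atTop (𝓝 c)

namespace HasPairing

variable {f g : Dist1} {φ ψ : ℝ → ℝ} {hφ : ContDiff ℝ 1 φ} {hψ : ContDiff ℝ 1 ψ} {c d : ℝ}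

theorem unique (h : HasPairing f φ hφ c) (h' : HasPairing f φ hφ d) : c = d := by
  have h1 : ∀ᶠ y in 𝓝 (0 : ℝ), plateau 1 y = 1 := by
    filter_upwards [Metric.closedBall_mem_nhds (0 : ℝ) one_pos] with y hy
    refine plateau_eq_one ?_
    simpa using hy
  exact tendsto_nhds_unique (h _ h1) (h' _ h1)

theorem add (h : HasPairing f φ hφ c) (h' : HasPairing g φ hφ d) :
    HasPairing (f + g) φ hφ (c + d) := fun χ hχ => (h χ hχ).add (h' χ hχ)

theorem const_smul (r : ℝ) (h : HasPairing f φ hφ c) : HasPairing (r • f) φ hφ (r * c) :=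
  fun χ hχ => (h χ hχ).const_mul r

theorem sub_right (h : HasPairing f φ hφ c) (h' : HasPairing f ψ hψ d) :
    HasPairing f (fun y => φ y - ψ y) (hφ.sub hψ) (c - d) := fun χ hχ => by
  refine ((h χ hχ).sub (h' χ hχ)).congr fun R => ?_
  rw [← map_sub]
  congr 1
  ext y
  exact (sub_mul (φ y) (ψ y) _).symm

end HasPairing

/-- The value is the sum of the pairings with the pieces of `φ`. Truncations converge to it by
dominated convergence for series. -/
theorem NegHolderSpace.exists_hasPairing {α : ℝ} (f : NegHolderSpace α) {x l : ℝ} (hl0 : 0 < l)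
    (hl1 : l ≤ 1) {φ : ℝ → ℝ} (hφ : ContDiff ℝ 1 φ) {a : ℤ → ℝ} (h : LocallyBounded φ x l a)
    (ha : Summable a) :
    ∃ c, HasPairing f.toDist φ hφ c ∧ |c| ≤ ‖f‖ * bumpConst * l ^ (1 + α) * ∑' k, a k := by
  refine ⟨∑' k, f.toDist (mulTest φ hφ (bump x l k)), fun χ hχ => ?_, ?_⟩
  swap
  · rw [← Real.norm_eq_abs]
    exact tsum_of_norm_bounded (ha.hasSum.mul_left _)
      fun k => f.abs_apply_mul_bump_le hl0 hl1 hφ h k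
  obtain ⟨A, hA0, hA, hA'⟩ := χ.exists_bounds
  have hχR : ∀ R : ℝ, 0 < R → ∀ y, (R • rescale χ 0 R) y = χ (R⁻¹ * y) := fun R hR y => by
    rw [C1Test.smul_apply, rescale_apply, mul_inv_cancel_left₀ hR.ne', sub_zero]
  have hsum : ∀ R : ℝ, f.toDist (mulTest φ hφ (R • rescale χ 0 R)) = ∑' k : ℤ,
      f.toDist (mulTest (mulTest φ hφ (R • rescale χ 0 R))
        (mulTest φ hφ (R • rescale χ 0 R)).contDiff (bump x l k)) := fun R =>
    (hasSum_apply_mul_bump f.toDist _ x hl0).tsum_eq.symm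
  simp_rw [hsum]
  refine tendsto_tsum_of_dominated_convergence
    (bound := fun k => ‖f‖ * bumpConst * l ^ (1 + α) * ((A + A) * a k))
    ((ha.mul_left _).mul_left _) (fun k => ?_) ?_
  -- Each term is eventually constant in `R`: once `R δ` exceeds the distance from `0` to the far
  -- end of the `k`-th interval, the cutoff equals `1` there.
  · obtain ⟨δ, hδ, hball⟩ := Metric.eventually_nhds_iff.1 hχ
    refine tendsto_const_nhds.congr' ?_
    filter_upwards [eventually_gt_atTop (max 0 ((|x + k * l| + l) / δ))] with R hR
    have hR0 : 0 < R := (le_max_left _ _).trans_lt hR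
    have hR1 := (le_max_right _ _).trans_lt hR
    rw [div_lt_iff₀ hδ] at hR1
    congr 1
    ext y
    change φ y * bump x l k y = (φ y * (R • rescale χ 0 R) y) * bump x l k y
    rcases lt_or_ge l |y - (x + k * l)| with hy | hy
    · rw [bump_eq_zero hl0 hy, mul_zero, mul_zero]
    · rw [hχR R hR0, hball, mul_one]
      rw [Real.dist_eq, sub_zero, abs_mul, abs_of_pos (inv_pos.2 hR0), inv_mul_lt_iff₀ hR0]
      have := abs_add_le (y - (x + k * l)) (x + k * l)
      rw [sub_add_cancel] at this
      linarith
  -- For `R ≥ 1 ≥ l` the derivative of the cutoff is at most `A / R ≤ A / l`, so truncation keeps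
  -- the local bounds up to the factor `A + A`, uniformly in `R`.
  · filter_upwards [eventually_ge_atTop 1] with R hR k
    have hR0 : 0 < R := by linarith
    refine f.abs_apply_mul_bump_le hl0 hl1 _ (h.mulTest hl0 hφ (fun y => ?_) fun y => ?_) k
    · rw [hχR R hR0]; exact hA _
    · rw [deriv_smul_test, deriv_rescale, mul_inv_cancel_left₀ hR0.ne', abs_mul,
        abs_of_pos (inv_pos.2 hR0), inv_mul_le_iff₀ hR0, mul_div_assoc', le_div_iff₀ hl0]
      have := hA' (R⁻¹ * (y - 0))
      calc _ ≤ A * 1 := mul_le_mul this hl1 hl0.le hA0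
        _ ≤ R * A := by nlinarith

/-! ### The Cauchy semigroup -/

theorem summable_decay : Summable fun k : ℤ => 3 / (1 + (k : ℝ) ^ 2) := by
  have h1 : Summable fun k : ℤ => 3 * (1 / (k : ℝ) ^ 2) :=
    (Real.summable_one_div_int_pow.2 one_lt_two).mul_left 3
  have h2 : Summable fun k : ℤ => if k = 0 then (3 : ℝ) else 0 := (hasSum_ite_eq 0 3).summable
  refine Summable.of_nonneg_of_le (fun k => by positivity) (fun k => ?_) (h1.add h2)
  by_cases hk : k = 0
  · simp [hk]
  · have hk' : (0 : ℝ) < (k : ℝ) ^ 2 := by positivity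
    rw [if_neg hk, add_zero, mul_one_div]
    exact div_le_div_of_nonneg_left (by norm_num) hk' (by linarith)

/-- The constant in the pairing estimate for quadratically decaying functions. -/
def decayConst : ℝ := bumpConst * ∑' k : ℤ, 3 / (1 + (k : ℝ) ^ 2)

theorem decayConst_nonneg : 0 ≤ decayConst :=
  mul_nonneg bumpConst_nonneg (tsum_nonneg fun k => by positivity)

/-- On the `k`-th interval `(k l)² ≤ 2 (x - y)² + 2 l²`, hence `l² (1 + k²) ≤ 3 (l² + (x - y)²)`;
this is the source of the constant `3`. -/
theorem locallyBounded_of_decay {φ : ℝ → ℝ} {x l M : ℝ} (hl : 0 < l) (hM : 0 ≤ M)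
    (h0 : ∀ y, |φ y| ≤ M / (l ^ 2 + (x - y) ^ 2))
    (h1 : ∀ y, |deriv φ y| ≤ M / l / (l ^ 2 + (x - y) ^ 2)) :
    LocallyBounded φ x l fun k => M / l ^ 2 * (3 / (1 + (k : ℝ) ^ 2)) := by
  intro k y hy
  have h2 : 1 / (l ^ 2 + (x - y) ^ 2) ≤ 1 / l ^ 2 * (3 / (1 + (k : ℝ) ^ 2)) := by
    have h3 : (k * l) ^ 2 ≤ 2 * (x - y) ^ 2 + 2 * l ^ 2 := by
      have h4 : (y - (x + k * l)) ^ 2 ≤ l ^ 2 := sq_le_sq' (abs_le.1 hy).1 (abs_le.1 hy).2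
      nlinarith [sq_nonneg ((x - y) + (y - (x + k * l)) + 2 * (y - x)),
        sq_nonneg ((x - y) - (y - (x + k * l)))]
    rw [div_mul_div_comm, one_mul, div_le_div_iff₀ (by positivity) (by positivity)]
    nlinarith [sq_nonneg (x - y)]
  constructor
  · calc |φ y| ≤ M * (1 / (l ^ 2 + (x - y) ^ 2)) := by rw [mul_one_div]; exact h0 y
      _ ≤ M * (1 / l ^ 2 * (3 / (1 + (k : ℝ) ^ 2))) := mul_le_mul_of_nonneg_left h2 hM
      _ = _ := by ring
  · calc |deriv φ y| ≤ M / l * (1 / (l ^ 2 + (x - y) ^ 2)) := by rw [mul_one_div]; exact h1 y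
      _ ≤ M / l * (1 / l ^ 2 * (3 / (1 + (k : ℝ) ^ 2))) :=
          mul_le_mul_of_nonneg_left h2 (by positivity)
      _ = _ := by ring

theorem NegHolderSpace.exists_hasPairing_of_decay {α : ℝ} (f : NegHolderSpace α) {x l M : ℝ}
    (hl0 : 0 < l) (hl1 : l ≤ 1) (hM : 0 ≤ M) {φ : ℝ → ℝ} (hφ : ContDiff ℝ 1 φ)
    (h0 : ∀ y, |φ y| ≤ M / (l ^ 2 + (x - y) ^ 2))
    (h1 : ∀ y, |deriv φ y| ≤ M / l / (l ^ 2 + (x - y) ^ 2)) :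
    ∃ c, HasPairing f.toDist φ hφ c ∧ |c| ≤ decayConst * ‖f‖ * M * l ^ (α - 1) := by
  obtain ⟨c, hc, hc'⟩ := f.exists_hasPairing hl0 hl1 hφ (locallyBounded_of_decay hl0 hM h0 h1)
    (summable_decay.mul_left _)
  refine ⟨c, hc, hc'.trans_eq ?_⟩
  have e : l ^ (1 + α) = l ^ 2 * l ^ (α - 1) := by
    rw [← Real.rpow_natCast, ← Real.rpow_add hl0]
    congr 1
    push_cast
    ring
  rw [tsum_mul_left, decayConst, e]
  field_simp

/-! ### Pointwise bounds on the Cauchy kernel -/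

section Kernel

/-- As the real part of `1 / (π z)` with `z = t + i u`, the kernel and its derivative are estimated
through `z⁻¹` and `z⁻²`, jointly in time and space. -/
theorem cauchyKernel_eq_re (t u : ℝ) : cauchyKernel t u = Real.pi⁻¹ * ((⟨t, u⟩ : ℂ)⁻¹).re := by
  rw [Complex.inv_re, Complex.normSq_mk, cauchyKernel]
  simp only [div_eq_mul_inv, mul_inv, sq]
  ring

theorem deriv_cauchyKernel_eq_re {t : ℝ} (ht : 0 < t) (x y : ℝ) :
    deriv (fun y => cauchyKernel t (x - y)) y =
      Real.pi⁻¹ * (Complex.I * ((⟨t, x - y⟩ : ℂ)⁻¹) ^ 2).re := by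
  have hne : (⟨t, x - y⟩ : ℂ) ≠ 0 := fun h => ht.ne' (congrArg Complex.re h)
  have e : ∀ y : ℝ, (⟨t, x - y⟩ : ℂ) = t + Complex.I * (x - y) := fun y => by
    apply Complex.ext <;> simp
  have h1 : HasDerivAt (fun y : ℝ => ((⟨t, x - y⟩ : ℂ))) (-Complex.I) y := by
    simp_rw [e]
    have h2 : HasDerivAt (fun y : ℝ => (y : ℂ)) 1 y := Complex.ofRealCLM.hasDerivAt
    have h3 := ((h2.const_sub (x : ℂ)).const_mul Complex.I).const_add (t : ℂ)
    simpa using h3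
  have h2 := h1.fun_inv hne
  have h3 := (Complex.reCLM.hasFDerivAt.comp_hasDerivAt y h2).const_mul Real.pi⁻¹
  have h4 : (fun y => cauchyKernel t (x - y)) =
      fun y => Real.pi⁻¹ * (Complex.reCLM ∘ fun y : ℝ => ((⟨t, x - y⟩ : ℂ))⁻¹) y :=
    funext fun y => cauchyKernel_eq_re t (x - y)
  rw [h4, h3.deriv]
  congr 1
  rw [Complex.reCLM_apply, neg_neg, inv_pow, div_eq_mul_inv]

theorem abs_pi_inv_mul_re_le (z : ℂ) : |Real.pi⁻¹ * z.re| ≤ ‖z‖ := by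
  rw [abs_mul, abs_of_pos (inv_pos.2 Real.pi_pos)]
  have h1 : Real.pi⁻¹ ≤ 1 := inv_le_one_of_one_le₀ (by linarith [Real.pi_gt_three])
  exact (mul_le_mul h1 (Complex.abs_re_le_norm z) (abs_nonneg _) zero_le_one).trans_eq (one_mul _)

theorem sq_norm_mk (t u : ℝ) : ‖(⟨t, u⟩ : ℂ)‖ ^ 2 = t ^ 2 + u ^ 2 := by
  rw [Complex.sq_norm, Complex.normSq_mk]; ring

theorem le_norm_mk {t : ℝ} (u : ℝ) : t ≤ ‖(⟨t, u⟩ : ℂ)‖ :=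
  (le_abs_self t).trans (Complex.abs_re_le_norm (⟨t, u⟩ : ℂ))

theorem inv_sq_norm_mk_le {t l : ℝ} (hl : 0 < l) (hlt : l ≤ t) (u : ℝ) :
    (‖(⟨t, u⟩ : ℂ)‖ ^ 2)⁻¹ ≤ (l ^ 2 + u ^ 2)⁻¹ := by
  rw [sq_norm_mk]
  refine inv_anti₀ (by positivity) ?_
  gcongr

theorem abs_cauchyKernel_le {t l : ℝ} (hl : 0 < l) (hlt : l ≤ t) (u : ℝ) :
    |cauchyKernel t u| ≤ t / (l ^ 2 + u ^ 2) := by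
  have ht : 0 < t := hl.trans_le hlt
  have hpi : 1 ≤ Real.pi := by linarith [Real.pi_gt_three]
  rw [cauchyKernel, abs_of_nonneg (by positivity)]
  refine div_le_div_of_nonneg_left ht.le (by positivity) ?_
  have : l ^ 2 ≤ t ^ 2 := by gcongr
  nlinarith [sq_nonneg u, sq_nonneg t]

theorem abs_deriv_cauchyKernel_le {t l : ℝ} (hl : 0 < l) (hlt : l ≤ t) (x y : ℝ) :
    |deriv (fun y => cauchyKernel t (x - y)) y| ≤ t / l / (l ^ 2 + (x - y) ^ 2) := by
  have ht : 0 < t := hl.trans_le hlt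
  rw [deriv_cauchyKernel_eq_re ht]
  refine (abs_pi_inv_mul_re_le _).trans ?_
  rw [norm_mul, Complex.norm_I, one_mul, norm_pow, norm_inv, inv_pow]
  refine (inv_sq_norm_mk_le hl hlt _).trans ?_
  rw [div_eq_mul_inv (t / l)]
  exact le_mul_of_one_le_left (by positivity) ((one_le_div hl).2 hlt)

/-- The elementary estimates behind the Lipschitz bounds of the kernel and of its derivative. -/
theorem norm_inv_sub_inv_le {z w : ℂ} {d : ℝ} (hz : z ≠ 0) (hd : ‖z - w‖ ≤ d)
    (hdz : d ≤ ‖z‖ / 2) :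
    ‖z⁻¹ - w⁻¹‖ ≤ 2 * d * (‖z‖ ^ 2)⁻¹ ∧
      ‖z⁻¹ ^ 2 - w⁻¹ ^ 2‖ ≤ 10 * d / ‖z‖ * (‖z‖ ^ 2)⁻¹ := by
  have hz0 : 0 < ‖z‖ := norm_pos_iff.2 hz
  have hw1 : ‖z‖ / 2 ≤ ‖w‖ := by
    have := norm_sub_norm_le z w
    linarith
  have hw2 : ‖w‖ ≤ 3 / 2 * ‖z‖ := by
    have := norm_sub_norm_le w z
    rw [norm_sub_rev] at this
    linarith
  have hw0 : 0 < ‖w‖ := by linarith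
  have hw : w ≠ 0 := norm_pos_iff.1 hw0
  have hd0 : 0 ≤ d := (norm_nonneg _).trans hd
  have hwi : ‖w‖⁻¹ ≤ 2 * ‖z‖⁻¹ := by
    have := inv_anti₀ (by positivity) hw1
    rwa [inv_div, div_eq_mul_inv] at this
  have h1 : ‖z⁻¹ - w⁻¹‖ ≤ 2 * d * (‖z‖ ^ 2)⁻¹ := by
    rw [inv_sub_inv hz hw, norm_div, norm_mul, norm_sub_rev, div_eq_mul_inv, mul_inv]
    calc ‖z - w‖ * (‖z‖⁻¹ * ‖w‖⁻¹) ≤ d * (‖z‖⁻¹ * (2 * ‖z‖⁻¹)) := by gcongr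
      _ = _ := by rw [sq, mul_inv]; ring
  refine ⟨h1, ?_⟩
  have e : z⁻¹ ^ 2 - w⁻¹ ^ 2 = (z⁻¹ - w⁻¹) * (z⁻¹ + w⁻¹) := by ring
  rw [e, norm_mul]
  have h2 : ‖z⁻¹ + w⁻¹‖ ≤ 3 * ‖z‖⁻¹ := by
    refine (norm_add_le _ _).trans ?_
    rw [norm_inv, norm_inv]
    linarith
  -- This gives the constant `6`. It is enlarged to `10`, used below for the kernel and its
  -- derivative alike, since the decay estimate takes one `M` for both.
  calc ‖z⁻¹ - w⁻¹‖ * ‖z⁻¹ + w⁻¹‖ ≤ 2 * d * (‖z‖ ^ 2)⁻¹ * (3 * ‖z‖⁻¹) :=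
        mul_le_mul h1 h2 (norm_nonneg _) (by positivity)
    _ = 6 * d / ‖z‖ * (‖z‖ ^ 2)⁻¹ := by ring
    _ ≤ _ := by gcongr; norm_num

theorem norm_mk_sub_mk_le (t s u v : ℝ) : ‖(⟨t, u⟩ : ℂ) - ⟨s, v⟩‖ ≤ |t - s| + |u - v| :=
  Complex.norm_le_abs_re_add_abs_im _

theorem abs_cauchyKernel_sub_le {t s l : ℝ} (hl : 0 < l) (hlt : l ≤ t) {x x' : ℝ}
    (hd : |t - s| + |x - x'| ≤ t / 2) (y : ℝ) :
    |cauchyKernel t (x - y) - cauchyKernel s (x' - y)| ≤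
      10 * (|t - s| + |x - x'|) / (l ^ 2 + (x - y) ^ 2) := by
  have hz : (⟨t, x - y⟩ : ℂ) ≠ 0 := fun h => (hl.trans_le hlt).ne' (congrArg Complex.re h)
  have h1 := norm_mk_sub_mk_le t s (x - y) (x' - y)
  rw [sub_sub_sub_cancel_right] at h1
  have h2 := (norm_inv_sub_inv_le hz h1 (hd.trans (by linarith [le_norm_mk (t := t) (x - y)]))).1
  rw [cauchyKernel_eq_re, cauchyKernel_eq_re, ← mul_sub, ← Complex.sub_re]
  refine (abs_pi_inv_mul_re_le _).trans (h2.trans ?_)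
  rw [div_eq_mul_inv]
  have := inv_sq_norm_mk_le hl hlt (x - y)
  gcongr
  norm_num

theorem abs_deriv_cauchyKernel_sub_le {t s l : ℝ} (hl : 0 < l) (hlt : l ≤ t) (hs : 0 < s)
    {x x' : ℝ} (hd : |t - s| + |x - x'| ≤ t / 2) (y : ℝ) :
    |deriv (fun y => cauchyKernel t (x - y) - cauchyKernel s (x' - y)) y| ≤
      10 * (|t - s| + |x - x'|) / l / (l ^ 2 + (x - y) ^ 2) := by
  have ht := hl.trans_le hlt
  have hz : (⟨t, x - y⟩ : ℂ) ≠ 0 := fun h => ht.ne' (congrArg Complex.re h)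
  have h1 := norm_mk_sub_mk_le t s (x - y) (x' - y)
  rw [sub_sub_sub_cancel_right] at h1
  have h2 := (norm_inv_sub_inv_le hz h1 (hd.trans (by linarith [le_norm_mk (t := t) (x - y)]))).2
  rw [deriv_fun_sub ((contDiff_cauchyKernel t x).differentiable one_ne_zero y)
    ((contDiff_cauchyKernel s x').differentiable one_ne_zero y), deriv_cauchyKernel_eq_re ht,
    deriv_cauchyKernel_eq_re hs, ← mul_sub, ← Complex.sub_re, ← mul_sub]
  refine (abs_pi_inv_mul_re_le _).trans ?_
  rw [norm_mul, Complex.norm_I, one_mul]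
  refine h2.trans ?_
  rw [div_eq_mul_inv _ (l ^ 2 + (x - y) ^ 2)]
  have h3 := inv_sq_norm_mk_le hl hlt (x - y)
  have h4 := hlt.trans (le_norm_mk (t := t) (x - y))
  gcongr

end Kernel

/-! ### Smoothing by the Cauchy semigroup -/

section Convolution

variable {α : ℝ}

theorem NegHolderSpace.exists_hasCauchyConv (f : NegHolderSpace α) {t : ℝ} (ht : 0 < t) (x : ℝ) :
    ∃ c, HasCauchyConv t f.toDist x c ∧
      |c| ≤ decayConst * ‖f‖ * t * (min t 1) ^ (α - 1) :=
  f.exists_hasPairing_of_decay (lt_min ht one_pos) (min_le_right _ _) ht.le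
    (contDiff_cauchyKernel t x)
    (fun y => abs_cauchyKernel_le (lt_min ht one_pos) (min_le_left _ _) (x - y))
    (fun y => abs_deriv_cauchyKernel_le (lt_min ht one_pos) (min_le_left _ _) x y)

theorem HasCauchyConv.unique {t x c d : ℝ} {f : Dist1} (h : HasCauchyConv t f x c)
    (h' : HasCauchyConv t f x d) : c = d :=
  HasPairing.unique (hφ := contDiff_cauchyKernel t x) h h'

theorem HasCauchyConv.abs_le {f : NegHolderSpace α} {t x c : ℝ} (ht : 0 < t)
    (h : HasCauchyConv t f.toDist x c) :
    |c| ≤ decayConst * ‖f‖ * t * (min t 1) ^ (α - 1) := by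
  obtain ⟨d, hd, hd'⟩ := f.exists_hasCauchyConv ht x
  rwa [h.unique hd]

theorem HasCauchyConv.abs_sub_le {f : NegHolderSpace α} {t s x x' c c' : ℝ} (ht : 0 < t)
    (hs : 0 < s) (h : HasCauchyConv t f.toDist x c) (h' : HasCauchyConv s f.toDist x' c')
    (hd : |t - s| + |x - x'| ≤ t / 2) :
    |c - c'| ≤ 10 * decayConst * ‖f‖ * (min t 1) ^ (α - 1) * (|t - s| + |x - x'|) := by
  have hl : 0 < min t 1 := lt_min ht one_pos
  have h1 := HasPairing.sub_right (hφ := contDiff_cauchyKernel t x)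
    (hψ := contDiff_cauchyKernel s x') h h'
  obtain ⟨d, hd1, hd2⟩ := f.exists_hasPairing_of_decay hl (min_le_right t 1)
    (M := 10 * (|t - s| + |x - x'|)) (by positivity)
    ((contDiff_cauchyKernel t x).sub (contDiff_cauchyKernel s x'))
    (abs_cauchyKernel_sub_le hl (min_le_left t 1) hd)
    (abs_deriv_cauchyKernel_sub_le hl (min_le_left t 1) hs hd)
  rw [h1.unique hd1]
  exact hd2.trans_eq (by ring)

/-- For `|x - x'| > t / 2` the kernel difference estimate is not available, but there the sup bound,
proportional to `t`, is itself a Lipschitz bound. -/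
theorem HasCauchyConv.abs_sub_le_mul_abs_sub {f : NegHolderSpace α} {t x x' c c' : ℝ} (ht : 0 < t)
    (h : HasCauchyConv t f.toDist x c) (h' : HasCauchyConv t f.toDist x' c') :
    |c - c'| ≤ 10 * decayConst * ‖f‖ * (min t 1) ^ (α - 1) * |x - x'| := by
  rcases le_or_gt |x - x'| (t / 2) with hd | hd
  · simpa using h.abs_sub_le ht ht h' (by simpa using hd)
  · have h1 := abs_sub c c'
    have h2 := h.abs_le ht
    have h3 := h'.abs_le ht
    have h4 : 0 ≤ decayConst * ‖f‖ * (min t 1) ^ (α - 1) :=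
      mul_nonneg (mul_nonneg decayConst_nonneg (norm_nonneg f))
        (Real.rpow_nonneg (le_min ht.le zero_le_one) _)
    calc |c - c'| ≤ 2 * (decayConst * ‖f‖ * (min t 1) ^ (α - 1)) * t := by linarith
      _ ≤ 10 * (decayConst * ‖f‖ * (min t 1) ^ (α - 1)) * |x - x'| := by
          nlinarith [abs_nonneg (x - x')]
      _ = _ := by ring

/-- The increment is the product of its powers `1 - β` and `β`; the sup bound goes into the first
and the Lipschitz bound into the second. -/
theorem abs_sub_le_interpolate {β : ℝ} (hβ0 : 0 < β) (hβ1 : β < 1) {u : ℝ → ℝ} {q τ : ℝ}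
    (hq : 0 ≤ q) (hτ : 0 ≤ τ) (hS : ∀ x, |u x| ≤ q * τ / 2)
    (hL : ∀ x y, |u x - u y| ≤ q * |x - y|) (x y : ℝ) :
    |u x - u y| ≤ q * τ ^ (1 - β) * |x - y| ^ β := by
  have h1 : |u x - u y| ≤ q * τ := by
    have := abs_sub (u x) (u y)
    linarith [hS x, hS y]
  have e : ∀ a : ℝ, 0 ≤ a → a = a ^ (1 - β) * a ^ β := fun a ha => by
    rw [← Real.rpow_add' ha (by norm_num)]
    simp
  rw [e _ (abs_nonneg (u x - u y)), e q hq]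
  calc |u x - u y| ^ (1 - β) * |u x - u y| ^ β
      ≤ (q * τ) ^ (1 - β) * (q * |x - y|) ^ β := by
        refine mul_le_mul (Real.rpow_le_rpow (abs_nonneg _) h1 (by linarith))
          (Real.rpow_le_rpow (abs_nonneg _) (hL x y) hβ0.le) (by positivity) (by positivity)
    _ = _ := by
        rw [Real.mul_rpow hq hτ, Real.mul_rpow hq (abs_nonneg _)]
        ring

theorem HolderSpace.norm_le_of_lipschitz {β : ℝ} (hβ0 : 0 < β) (hβ1 : β < 1) {F : HolderSpace β}
    {q τ : ℝ} (hq : 0 ≤ q) (hτ : 0 ≤ τ) (hS : ∀ x, |F x| ≤ q * τ / 2)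
    (hL : ∀ x y, |F x - F y| ≤ q * |x - y|) : ‖F‖ ≤ q * (τ + τ ^ (1 - β)) := by
  refine (F.norm_le_add hS (by positivity) fun x y _ =>
    abs_sub_le_interpolate hβ0 hβ1 hq hτ hS hL x y).trans ?_
  have := mul_nonneg hq hτ
  linarith

/-- `P` is convolution with the Cauchy kernel at time `t`. -/
def IsCauchyOperator {β : ℝ} (t : ℝ) (P : NegHolderSpace α →L[ℝ] HolderSpace β) : Prop :=
  ∀ f x, HasCauchyConv t f.toDist x (P f x)

theorem norm_le_of_hasCauchyConv {β : ℝ} (hβ0 : 0 < β) (hβ1 : β < 1) {t : ℝ} (ht : 0 < t)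
    {f : NegHolderSpace α} {F : HolderSpace β} (h : ∀ x, HasCauchyConv t f.toDist x (F x)) :
    ‖F‖ ≤ 10 * decayConst * (min t 1) ^ (α - 1) * (t + t ^ (1 - β)) * ‖f‖ := by
  have h4 : 0 ≤ decayConst * ‖f‖ * (min t 1) ^ (α - 1) :=
    mul_nonneg (mul_nonneg decayConst_nonneg (norm_nonneg f))
      (Real.rpow_nonneg (le_min ht.le zero_le_one) _)
  refine (HolderSpace.norm_le_of_lipschitz hβ0 hβ1
    (q := 10 * decayConst * ‖f‖ * (min t 1) ^ (α - 1)) (τ := t) (by linarith) ht.le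
    (fun x => ((h x).abs_le ht).trans ?_)
    fun x y => (h x).abs_sub_le_mul_abs_sub ht (h y)).trans_eq (by ring)
  nlinarith

theorem exists_isCauchyOperator {β : ℝ} (hβ0 : 0 < β) (hβ1 : β < 1) {t : ℝ} (ht : 0 < t) :
    ∃ P : NegHolderSpace α →L[ℝ] HolderSpace β, IsCauchyOperator t P := by
  choose c hc hc' using fun f : NegHolderSpace α => f.exists_hasCauchyConv ht
  have h4 : ∀ f : NegHolderSpace α, 0 ≤ decayConst * ‖f‖ * (min t 1) ^ (α - 1) := fun f =>
    mul_nonneg (mul_nonneg decayConst_nonneg (norm_nonneg f))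
      (Real.rpow_nonneg (le_min ht.le zero_le_one) _)
  have hF : ∀ f, ∃ F : HolderSpace β, ∀ x, F x = c f x := fun f => by
    refine HolderSpace.exists_of_bounds hβ0 (hc' f) (abs_sub_le_interpolate hβ0 hβ1
      (q := 10 * decayConst * ‖f‖ * (min t 1) ^ (α - 1)) (τ := t) (by linarith [h4 f]) ht.le
      (fun x => (hc' f x).trans ?_) fun x y => (hc f x).abs_sub_le_mul_abs_sub ht (hc f y))
    nlinarith [h4 f]
  choose F hF using hF
  have hFc : ∀ f x, HasCauchyConv t f.toDist x (F f x) := fun f x => by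
    rw [hF]; exact hc f x
  refine ⟨LinearMap.mkContinuous
    { toFun := F
      map_add' := fun f g => HolderSpace.ext_apply fun x => ?_
      map_smul' := fun r f => HolderSpace.ext_apply fun x => ?_ }
    (10 * decayConst * (min t 1) ^ (α - 1) * (t + t ^ (1 - β))) fun f =>
      norm_le_of_hasCauchyConv hβ0 hβ1 ht (hFc f), hFc⟩
  · exact (hFc (f + g) x).unique
      (HasPairing.add (hφ := contDiff_cauchyKernel t x) (hFc f x) (hFc g x))
  · exact (hFc (r • f) x).unique
      (HasPairing.const_smul (hφ := contDiff_cauchyKernel t x) r (hFc f x))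

theorem IsCauchyOperator.norm_le {β : ℝ} (hβ0 : 0 < β) (hβ1 : β < 1) {t : ℝ} (ht : 0 < t)
    {P : NegHolderSpace α →L[ℝ] HolderSpace β} (hP : IsCauchyOperator t P) :
    ‖P‖ ≤ 10 * decayConst * (min t 1) ^ (α - 1) * (t + t ^ (1 - β)) := by
  have := decayConst_nonneg
  have := Real.rpow_nonneg (le_min ht.le zero_le_one) (α - 1)
  exact ContinuousLinearMap.opNorm_le_bound _ (by positivity) fun f =>
    norm_le_of_hasCauchyConv hβ0 hβ1 ht (hP f)

/-- The sup norm of the difference is of order `|t - s|`, while its Lipschitz constant need only be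
bounded, by the sum of the two. Interpolation leaves the power `1 - β > 0` of `|t - s|`, whence
continuity in operator norm. -/
theorem IsCauchyOperator.norm_sub_le {β : ℝ} (hβ0 : 0 < β) (hβ1 : β < 1) {t s : ℝ} (ht : 0 < t)
    (hs : 0 < s) (hts : |t - s| ≤ t / 2) {P Q : NegHolderSpace α →L[ℝ] HolderSpace β}
    (hP : IsCauchyOperator t P) (hQ : IsCauchyOperator s Q) :
    ‖P - Q‖ ≤ 10 * decayConst * ((min t 1) ^ (α - 1) + (min s 1) ^ (α - 1)) *
      (2 * |t - s| + (2 * |t - s|) ^ (1 - β)) := by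
  have h1 := decayConst_nonneg
  have h2 := Real.rpow_nonneg (le_min ht.le zero_le_one) (α - 1)
  have h3 := Real.rpow_nonneg (le_min hs.le zero_le_one) (α - 1)
  refine ContinuousLinearMap.opNorm_le_bound _ (by positivity) fun f => ?_
  have h4 : 0 ≤ 10 * decayConst * ‖f‖ := by positivity
  refine (HolderSpace.norm_le_of_lipschitz hβ0 hβ1 (F := P f - Q f)
    (q := 10 * decayConst * ‖f‖ * ((min t 1) ^ (α - 1) + (min s 1) ^ (α - 1)))
    (τ := 2 * |t - s|) (by positivity) (by positivity) (fun x => ?_) fun x y => ?_).trans_eq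
    (by ring)
  · have h5 := (hP f x).abs_sub_le ht hs (hQ f x) (by simpa using hts)
    rw [sub_self, abs_zero, add_zero] at h5
    refine h5.trans ?_
    have h6 := mul_nonneg (mul_nonneg h4 h3) (abs_nonneg (t - s))
    linarith
  · have h5 := (hP f x).abs_sub_le_mul_abs_sub ht (hP f y)
    have h6 := (hQ f x).abs_sub_le_mul_abs_sub hs (hQ f y)
    have h7 : (P f - Q f) x - (P f - Q f) y = (P f x - P f y) - (Q f x - Q f y) := by
      rw [HolderSpace.sub_apply, HolderSpace.sub_apply]; ring
    rw [h7]
    refine (abs_sub _ _).trans ((add_le_add h5 h6).trans_eq (by ring))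

/-- On `(0, T]` one has `min t 1 ≥ t / N` with `N = max T 1`, so the operator norm is of order `t ^
(α - 1) * t ^ (1 - β) = t ^ (-(β - α))`. -/
theorem isSingularKernel_of_isCauchyOperator {β T : ℝ} (hα : α < 1) (hβ0 : 0 < β) (hβ1 : β < 1)
    {P : ℝ → NegHolderSpace α →L[ℝ] HolderSpace β}
    (hP : ∀ t, 0 < t → IsCauchyOperator t (P t)) :
    ∃ C, IsSingularKernel P (β - α) C T := by
  have h1 := decayConst_nonneg
  set N := max T 1 with hN
  have hN1 : 1 ≤ N := le_max_right _ _
  have hN0 : 0 < N := by linarith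
  refine ⟨10 * decayConst * N ^ (1 - α) * (N ^ β + 1), by positivity, fun t ht => ?_,
    fun t ht => ?_⟩
  · refine ContinuousAt.continuousWithinAt ?_
    have ht0 := ht.1
    rw [ContinuousAt, tendsto_iff_norm_sub_tendsto_zero]
    have h2 : ContinuousAt (fun s : ℝ => (min s 1) ^ (α - 1)) t :=
      (continuous_id.min continuous_const).continuousAt.rpow_const
        (Or.inl (lt_min ht0 one_pos).ne')
    have h3 : ContinuousAt (fun s : ℝ => 2 * |t - s| + (2 * |t - s|) ^ (1 - β)) t := by
      have h4 : Continuous fun s : ℝ => 2 * |t - s| := by fun_prop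
      exact (h4.add (h4.rpow_const fun _ => Or.inr (by linarith))).continuousAt
    have h5 := ((h2.const_add ((min t 1) ^ (α - 1))).const_mul (10 * decayConst)).mul h3
    have h6 : Tendsto (fun s : ℝ => 10 * decayConst * ((min t 1) ^ (α - 1) + (min s 1) ^ (α - 1)) *
        (2 * |t - s| + (2 * |t - s|) ^ (1 - β))) (𝓝 t) (𝓝 0) := by
      have h7 : Tendsto _ (𝓝 t) (𝓝 (10 * decayConst * ((min t 1) ^ (α - 1) +
        (min t 1) ^ (α - 1)) * (2 * |t - t| + (2 * |t - t|) ^ (1 - β)))) := h5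
      have h8 : (2 * |t - t| + (2 * |t - t|) ^ (1 - β)) = 0 := by
        rw [sub_self, abs_zero, mul_zero, Real.zero_rpow (by linarith), add_zero]
      rw [h8, mul_zero] at h7
      exact h7
    refine squeeze_zero' (Eventually.of_forall fun _ => norm_nonneg _) ?_ h6
    filter_upwards [Metric.ball_mem_nhds t (half_pos ht0)] with s hs
    rw [Metric.mem_ball, dist_comm, Real.dist_eq] at hs
    have hs0 : 0 < s := by linarith [(abs_lt.1 hs).2]
    rw [norm_sub_rev]
    exact (hP t ht0).norm_sub_le hβ0 hβ1 ht0 hs0 hs.le (hP s hs0)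
  · have ht0 := ht.1
    have htN : t ≤ N := ht.2.trans (le_max_left _ _)
    refine ((hP t ht0).norm_le hβ0 hβ1 ht0).trans ?_
    have h2 : (min t 1) ^ (α - 1) ≤ N ^ (1 - α) * t ^ (α - 1) := by
      have h3 : t / N ≤ min t 1 :=
        le_min (div_le_self ht0.le hN1) ((div_le_one hN0).2 htN)
      refine (Real.rpow_le_rpow_of_nonpos (by positivity) h3 (by linarith)).trans_eq ?_
      rw [Real.div_rpow ht0.le hN0.le, ← neg_sub 1 α, Real.rpow_neg hN0.le, div_inv_eq_mul,
        mul_comm]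
    have h3 : t + t ^ (1 - β) ≤ t ^ (1 - β) * (N ^ β + 1) := by
      have h4 : t = t ^ (1 - β) * t ^ β := by rw [← Real.rpow_add ht0]; simp
      have h5 : t ^ β ≤ N ^ β := Real.rpow_le_rpow ht0.le htN hβ0.le
      have h6 : 0 ≤ t ^ (1 - β) := by positivity
      nlinarith
    have h4 : t ^ (-(β - α)) = t ^ (α - 1) * t ^ (1 - β) := by
      rw [← Real.rpow_add ht0]; congr 1; ring
    rw [h4]
    calc _ ≤ 10 * decayConst * (N ^ (1 - α) * t ^ (α - 1)) * (t ^ (1 - β) * (N ^ β + 1)) := by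
          gcongr
      _ = _ := by ring

end Convolution

/-! ### Mollification of Hölder functions -/

/-- Averages of a Hölder function against a rescaled kernel. -/
theorem HolderSpace.abs_integral_rescaled_sub_le {β : ℝ} (hβ : 0 < β) {σ : ℝ → ℝ}
    (hσ : Continuous σ) {R : ℝ} (hR : ∀ y, R < |y| → σ y = 0) (hR0 : 0 ≤ R) (v : HolderSpace β)
    {ε : ℝ} (hε : 0 < ε) (x : ℝ) :
    |(∫ y, ε⁻¹ * σ (ε⁻¹ * (x - y)) * v y) - (∫ y, σ y) * v x| ≤
      2 * R ^ β * (∫ y, |σ y|) * ‖v‖ * ε ^ β := by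
  have hcs : HasCompactSupport σ :=
    HasCompactSupport.intro (isCompact_Icc (a := -R) (b := R)) fun y hy => hR y (by
      by_contra h
      exact hy (abs_le.1 (not_lt.1 h)))
  have hint : Integrable σ := hσ.integrable_of_hasCompactSupport hcs
  have hv : Continuous v := v.toBCF.continuous
  -- Substituting `y = x - ε z` leaves increments of `v` over distances at most `ε R`.
  have h1 : ∫ y, ε⁻¹ * σ (ε⁻¹ * (x - y)) * v y = ∫ z, σ z * v (x - ε * z) := by
    have h2 := integral_sub_left_eq_self (fun u => ε⁻¹ * σ (ε⁻¹ * u) * v (x - u)) volume x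
    simp only [sub_sub_cancel] at h2
    rw [h2]
    have h3 := Measure.integral_comp_mul_left (fun z => ε⁻¹ * (σ z * v (x - ε * z))) ε⁻¹
    simp only [mul_inv_cancel_left₀ hε.ne'] at h3
    simp_rw [mul_assoc]
    rw [h3, integral_const_mul, inv_inv, abs_of_pos hε, smul_eq_mul,
      mul_inv_cancel_left₀ hε.ne']
  have h2 : Integrable fun z => σ z * v (x - ε * z) :=
    (hσ.mul (hv.comp (by fun_prop))).integrable_of_hasCompactSupport hcs.mul_right
  rw [h1, ← integral_mul_const, ← integral_sub h2 (hint.mul_const _)]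
  have h3 : ∀ z, ‖σ z * v (x - ε * z) - σ z * v x‖ ≤ |σ z| * (2 * ‖v‖ * (ε * R) ^ β) := fun z => by
    rw [← mul_sub, Real.norm_eq_abs, abs_mul]
    rcases lt_or_ge R |z| with hz | hz
    · rw [hR z hz, abs_zero, zero_mul, zero_mul]
    · refine mul_le_mul_of_nonneg_left ((v.abs_sub_le hβ _ _).trans ?_) (abs_nonneg _)
      have h4 : |x - ε * z - x| ≤ ε * R := by
        rw [sub_sub_cancel_left, abs_neg, abs_mul, abs_of_pos hε]
        gcongr
      have := norm_nonneg v
      gcongr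
  have h4 := norm_integral_le_of_norm_le (hint.abs.mul_const _) (Eventually.of_forall h3)
  rw [Real.norm_eq_abs, integral_mul_const] at h4
  refine h4.trans_eq ?_
  rw [Real.mul_rpow hε.le hR0]
  ring

theorem hasDerivAt_mollify (ρ : C1Test) (ε : ℝ) (v : BoundedContinuousFunction ℝ ℝ) (x : ℝ) :
    HasDerivAt (mollify ρ ε v) (∫ y, deriv (rescale ρ 0 ε) (x - y) * v y) x := by
  have h := (rescale ρ 0 ε).hasCompactSupport.hasDerivAt_convolution_left
    (ContinuousLinearMap.mul ℝ ℝ) (rescale ρ 0 ε).contDiff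
    (v.continuous.locallyIntegrable (μ := volume)) x
  have h2 : MeasureTheory.convolution (rescale ρ 0 ε) v (ContinuousLinearMap.mul ℝ ℝ) volume
      = mollify ρ ε v := by
    ext x
    rw [MeasureTheory.convolution_eq_swap]
    rfl
  rw [h2, MeasureTheory.convolution_eq_swap] at h
  exact h

theorem C1Test.integral_deriv_eq_zero (ρ : C1Test) : ∫ y, deriv ρ y = 0 :=
  integral_eq_zero_of_hasDerivAt_of_integrable (f := ρ) ρ.hasDerivAt
    ((ρ.contDiff.continuous_deriv le_rfl).integrable_of_hasCompactSupport
      ρ.hasCompactSupport.deriv)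
    (ρ.continuous.integrable_of_hasCompactSupport ρ.hasCompactSupport)

/-- `u` approximates `v` as well as a mollification of a `β`-Hölder function at scale `ε`. -/
structure IsApprox (β : ℝ) (v : ℝ → ℝ) (A ε : ℝ) (u : ℝ → ℝ) : Prop where
  abs_sub_le : ∀ x, |u x - v x| ≤ A * ε ^ β
  abs_deriv_le : ∀ x, |deriv u x| ≤ A * ε ^ (β - 1)

/-- One averaging estimate serves twice: for `ρ`, of mean `1`, it compares with `v`; for `ρ'`, of
mean `0`, nothing is subtracted and the derivative brings the extra `ε⁻¹`. -/
theorem exists_isApprox_mollify {β : ℝ} (hβ : 0 < β) (ρ : C1Test) (hρ : ∫ y, ρ y = 1) :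
    ∃ A, 0 ≤ A ∧ ∀ (v : HolderSpace β) (ε : ℝ), 0 < ε →
      IsApprox β v (A * ‖v‖) ε (mollify ρ ε v.toBCF) := by
  obtain ⟨R, hR1, hR⟩ := ρ.exists_radius
  have hR0 : 0 ≤ R := by linarith
  have hR' : ∀ y, R < |y| → deriv ρ y = 0 := fun y hy =>
    deriv_eq_zero_of_forall_lt (x := 0) (fun z hz => hR z (by simpa using hz)) (by simpa using hy)
  have hI1 : 0 ≤ ∫ y, |ρ y| := integral_nonneg fun y => abs_nonneg _
  have hI2 : 0 ≤ ∫ y, |deriv ρ y| := integral_nonneg fun y => abs_nonneg _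
  refine ⟨2 * R ^ β * ((∫ y, |ρ y|) + ∫ y, |deriv ρ y|), by positivity, fun v ε hε => ?_⟩
  have hv := norm_nonneg v
  constructor
  · intro x
    have h1 := v.abs_integral_rescaled_sub_le hβ ρ.continuous hR hR0 hε x
    have h2 : mollify ρ ε v.toBCF x = ∫ y, ε⁻¹ * ρ (ε⁻¹ * (x - y)) * v y := by
      simp only [mollify, rescale_apply, sub_zero]
    rw [h2]
    rw [hρ, one_mul] at h1
    refine h1.trans ?_
    gcongr
    linarith
  · intro x
    have h1 := v.abs_integral_rescaled_sub_le hβ (ρ.contDiff.continuous_deriv le_rfl) hR' hR0 hε x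
    rw [ρ.integral_deriv_eq_zero, zero_mul, sub_zero] at h1
    rw [(hasDerivAt_mollify ρ ε v.toBCF x).deriv]
    have h2 : ∫ y, deriv (rescale ρ 0 ε) (x - y) * v.toBCF y =
        ε⁻¹ * ∫ y, ε⁻¹ * deriv ρ (ε⁻¹ * (x - y)) * v y := by
      rw [← integral_const_mul]
      simp only [deriv_rescale, sub_zero]
      congr 1
      ext y
      ring
    rw [h2, abs_mul, abs_of_pos (inv_pos.2 hε), Real.rpow_sub_one hε.ne']
    calc _ ≤ ε⁻¹ * (2 * R ^ β * (∫ y, |deriv ρ y|) * ‖v‖ * ε ^ β) :=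
          mul_le_mul_of_nonneg_left h1 (inv_pos.2 hε).le
      _ = 2 * R ^ β * (∫ y, |deriv ρ y|) * ‖v‖ * (ε ^ β / ε) := by ring
      _ ≤ _ := by
          gcongr
          linarith

theorem integrable_mollify_integrand (ρ : C1Test) (ε : ℝ) (v : BoundedContinuousFunction ℝ ℝ)
    (x : ℝ) : Integrable fun y => rescale ρ 0 ε (x - y) * v y := by
  have h1 : HasCompactSupport fun y => rescale ρ 0 ε (x - y) :=
    (rescale ρ 0 ε).hasCompactSupport.comp_homeomorph (Homeomorph.subLeft x)
  exact (((rescale ρ 0 ε).continuous.comp (by fun_prop)).mul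
    v.continuous).integrable_of_hasCompactSupport h1.mul_right

theorem mollify_add (ρ : C1Test) (ε : ℝ) (v w : BoundedContinuousFunction ℝ ℝ) (x : ℝ) :
    mollify ρ ε (v + w) x = mollify ρ ε v x + mollify ρ ε w x := by
  unfold mollify
  rw [← integral_add (integrable_mollify_integrand ρ ε v x)
    (integrable_mollify_integrand ρ ε w x)]
  congr 1
  ext y
  rw [BoundedContinuousFunction.add_apply, mul_add]

theorem mollify_smul (ρ : C1Test) (ε c : ℝ) (v : BoundedContinuousFunction ℝ ℝ) (x : ℝ) :
    mollify ρ ε (c • v) x = c * mollify ρ ε v x := by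
  unfold mollify
  rw [← integral_const_mul]
  congr 1
  ext y
  rw [BoundedContinuousFunction.smul_apply, smul_eq_mul]
  ring

theorem exists_integral_eq_one : ∃ ρ : C1Test, ∫ y, ρ y = 1 := by
  let b : ContDiffBump (0 : ℝ) := ⟨1, 2, one_pos, one_lt_two⟩
  exact ⟨⟨b.normed volume, b.contDiff_normed, b.hasCompactSupport_normed, fun _ _ => trivial⟩,
    b.integral_normed⟩

/-! ### Uniqueness and linearity of products -/

namespace IsProduct

variable {v w : BoundedContinuousFunction ℝ ℝ} {f g h k : Dist1}

theorem unique (hh : IsProduct v g h) (hk : IsProduct v g k) : h = k := by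
  obtain ⟨ρ, hρ⟩ := exists_integral_eq_one
  ext η
  exact tendsto_nhds_unique (hh ρ hρ η) (hk ρ hρ η)

theorem add_left (hh : IsProduct v g h) (hk : IsProduct w g k) :
    IsProduct (v + w) g (h + k) := fun ρ hρ η => by
  refine ((hh ρ hρ η).add (hk ρ hρ η)).congr fun ε => ?_
  rw [← map_add]
  congr 1
  ext y
  change mollify ρ ε v y * η y + mollify ρ ε w y * η y = mollify ρ ε (v + w) y * η y
  rw [mollify_add, add_mul]

theorem smul_left (c : ℝ) (hh : IsProduct v g h) : IsProduct (c • v) g (c • h) :=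
    fun ρ hρ η => by
  refine ((hh ρ hρ η).const_mul c).congr fun ε => ?_
  rw [← smul_eq_mul, ← map_smul]
  congr 1
  ext y
  change c * (mollify ρ ε v y * η y) = mollify ρ ε (c • v) y * η y
  rw [mollify_smul, mul_assoc]

theorem add_right (hh : IsProduct v f h) (hk : IsProduct v g k) :
    IsProduct v (f + g) (h + k) := fun ρ hρ η => (hh ρ hρ η).add (hk ρ hρ η)

theorem smul_right (c : ℝ) (hh : IsProduct v g h) : IsProduct v (c • g) (c • h) :=
    fun ρ hρ η => (hh ρ hρ η).const_mul c

end IsProduct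

/-! ### The product estimate -/

/-- `η` is supported in the ball of radius `r` about `x` and oscillates at scale at least `l`. -/
structure TestBound (η : C1Test) (x r B l : ℝ) : Prop where
  pos : 0 < l
  le_one : l ≤ 1
  le_radius : l ≤ r
  eq_zero : ∀ y, r < |y - x| → η y = 0
  abs_le : ∀ y, |η y| ≤ B
  abs_deriv_le : ∀ y, |deriv η y| ≤ B / l

theorem TestBound.nonneg {η : C1Test} {x r B l : ℝ} (h : TestBound η x r B l) : 0 ≤ B :=
  (abs_nonneg _).trans (h.abs_le 0)

theorem TestBound.mono {η : C1Test} {x r B l l' : ℝ} (h : TestBound η x r B l) (h0 : 0 < l')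
    (hl : l' ≤ l) : TestBound η x r B l' :=
  ⟨h0, hl.trans h.le_one, hl.trans h.le_radius, h.eq_zero, h.abs_le, fun y =>
    (h.abs_deriv_le y).trans (div_le_div_of_nonneg_left h.nonneg h0 hl)⟩

namespace NegHolderSpace

variable {α : ℝ}

/-- A ball of radius `r` meets about `r / l` pieces at scale `l`, each contributing `M l ^ (1 + α)`.
Precisely `2 m + 1` pieces are counted, and `(2 m + 1) l ≤ 2 r + 5 l ≤ 7 r`. -/
theorem abs_apply_le_of_radius (f : NegHolderSpace α) {x l r M : ℝ} (hl0 : 0 < l) (hl1 : l ≤ 1)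
    (hlr : l ≤ r) (φ : C1Test) (hsupp : ∀ y, r < |y - x| → φ y = 0) (h0 : ∀ y, |φ y| ≤ M)
    (h1 : ∀ y, |deriv φ y| ≤ M / l) :
    |f.toDist φ| ≤ 7 * bumpConst * ‖f‖ * M * r * l ^ α := by
  have hM : 0 ≤ M := (abs_nonneg _).trans (h0 0)
  have hr : 0 < r := hl0.trans_le hlr
  set m : ℕ := ⌈r / l⌉₊ + 1 with hm
  have hm1 : r + l ≤ m * l := by
    have := Nat.le_ceil (r / l)
    rw [div_le_iff₀ hl0] at this
    rw [hm]
    push_cast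
    linarith
  have hm2 : (m : ℝ) * l ≤ r + 2 * l := by
    have := (Nat.ceil_lt_add_one (div_nonneg hr.le hl0.le)).le
    have h3 : ((m : ℝ)) ≤ r / l + 2 := by rw [hm]; push_cast; linarith
    calc (m : ℝ) * l ≤ (r / l + 2) * l := by gcongr
      _ = _ := by field_simp
  let s : Finset ℤ := Finset.Icc (-(m : ℤ)) m
  have hb : LocallyBounded φ x l fun k => if k ∈ s then M else 0 := by
    intro k y hy
    by_cases hk : k ∈ s
    · simp only [hk, if_true]
      exact ⟨h0 y, h1 y⟩
    · simp only [hk, if_false]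
      have hk' : (m : ℤ) + 1 ≤ |k| := by
        by_contra hcon
        refine hk (Finset.mem_Icc.2 ?_)
        have := abs_lt.1 (not_le.1 hcon)
        omega
      have hk2 : (m : ℝ) + 1 ≤ |(k : ℝ)| := by exact_mod_cast hk'
      have h6 : |(k : ℝ) * l| ≤ |y - x| + |y - (x + k * l)| := by
        have := abs_sub (y - x) (y - (x + k * l))
        have e1 : y - x - (y - (x + k * l)) = k * l := by ring
        rwa [e1] at this
      rw [abs_mul, abs_of_pos hl0] at h6
      have h7 : r < |y - x| := by nlinarith
      rw [hsupp y h7, deriv_eq_zero_of_forall_lt hsupp h7]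
      simp
  have hsum : HasSum (fun k : ℤ => if k ∈ s then M else 0) ((2 * m + 1) * M) := by
    have h2 : HasSum (fun k : ℤ => if k ∈ s then M else 0) (∑ k ∈ s, if k ∈ s then M else 0) :=
      hasSum_sum_of_ne_finset_zero fun k hk => if_neg hk
    have h3 : ∑ k ∈ s, (if k ∈ s then M else 0) = (2 * m + 1) * M := by
      rw [Finset.sum_congr rfl fun k hk => if_pos hk, Finset.sum_const, Int.card_Icc,
        nsmul_eq_mul]
      congr 1
      have : ((m : ℤ) + 1 - -(m : ℤ)).toNat = 2 * m + 1 := by omega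
      rw [this]
      push_cast
      ring
    rwa [h3] at h2
  have h2 := f.abs_apply_le_tsum hl0 hl1 φ hb hsum.summable
  rw [hsum.tsum_eq] at h2
  have hc := bumpConst_nonneg
  have hla : 0 < l ^ α := Real.rpow_pos_of_pos hl0 _
  rw [Real.rpow_add hl0, Real.rpow_one] at h2
  refine h2.trans ?_
  calc _ = ‖f‖ * bumpConst * l ^ α * M * (2 * (m * l) + l) := by ring
    _ ≤ ‖f‖ * bumpConst * l ^ α * M * (7 * r) := by
        gcongr
        linarith
    _ = _ := by ring

theorem abs_apply_mulTest_le (f : NegHolderSpace α) {x l r B U : ℝ} {η : C1Test}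
    (hη : TestBound η x r B l) {u : ℝ → ℝ} (hu : ContDiff ℝ 1 u) (h0 : ∀ y, |u y| ≤ U)
    (h1 : ∀ y, |deriv u y| ≤ U / l) :
    |f.toDist (mulTest u hu η)| ≤ 14 * bumpConst * ‖f‖ * U * B * r * l ^ α := by
  have hU : 0 ≤ U := (abs_nonneg _).trans (h0 0)
  have hB := hη.nonneg
  have hl := hη.pos
  refine (f.abs_apply_le_of_radius hl hη.le_one hη.le_radius (M := 2 * U * B) (mulTest u hu η)
    (fun y hy => by rw [mulTest_apply, hη.eq_zero y hy, mul_zero]) (fun y => ?_)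
    fun y => ?_).trans_eq (by ring)
  · rw [mulTest_apply, abs_mul]
    have := mul_le_mul (h0 y) (hη.abs_le y) (abs_nonneg _) hU
    nlinarith [mul_nonneg hU hB]
  · rw [deriv_mulTest]
    calc |deriv u y * η y + u y * deriv η y| ≤ |deriv u y| * |η y| + |u y| * |deriv η y| := by
          rw [← abs_mul, ← abs_mul]; exact abs_add_le _ _
      _ ≤ U / l * B + U * (B / l) :=
          add_le_add (mul_le_mul (h1 y) (hη.abs_le y) (abs_nonneg _) (by positivity))
            (mul_le_mul (h0 y) (hη.abs_deriv_le y) (abs_nonneg _) hU)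
      _ = 2 * U * B / l := by ring

/-- Two approximations at comparable scales act almost in the same way. -/
theorem abs_apply_mulTest_sub_le (f : NegHolderSpace α) {β : ℝ} (hβ0 : 0 < β) (hβ1 : β < 1)
    {x l r B : ℝ} {η : C1Test} (hη : TestBound η x r B l) {v u u' : ℝ → ℝ} {A A' ε ε' : ℝ}
    (hA : 0 ≤ A) (hA' : 0 ≤ A') (hu : ContDiff ℝ 1 u) (hu' : ContDiff ℝ 1 u')
    (h : IsApprox β v A ε u) (h' : IsApprox β v A' ε' u') (hε : ε ∈ Icc l (2 * l))
    (hε' : ε' ∈ Icc l (2 * l)) :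
    |f.toDist (mulTest u hu η) - f.toDist (mulTest u' hu' η)| ≤
      28 * bumpConst * ‖f‖ * (A + A') * B * r * l ^ (α + β) := by
  have hl := hη.pos
  have hlb : 0 < l ^ β := Real.rpow_pos_of_pos hl _
  have e1 : ∀ ε ∈ Icc l (2 * l), ε ^ β ≤ 2 * l ^ β := fun ε hε => by
    have h2 : (2 : ℝ) ^ β ≤ 2 ^ (1 : ℝ) := Real.rpow_le_rpow_of_exponent_le one_le_two hβ1.le
    rw [Real.rpow_one] at h2
    calc ε ^ β ≤ (2 * l) ^ β := Real.rpow_le_rpow (hl.le.trans hε.1) hε.2 hβ0.le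
      _ = 2 ^ β * l ^ β := Real.mul_rpow zero_le_two hl.le
      _ ≤ 2 * l ^ β := by gcongr
  have e2 : ∀ ε ∈ Icc l (2 * l), ε ^ (β - 1) ≤ l ^ β / l := fun ε hε => by
    rw [← Real.rpow_sub_one hl.ne']
    exact Real.rpow_le_rpow_of_nonpos hl hε.1 (by linarith)
  rw [← map_sub]
  have e3 : mulTest u hu η - mulTest u' hu' η =
      mulTest (fun y => u y - u' y) (hu.sub hu') η := by
    ext y
    exact (sub_mul (u y) (u' y) (η y)).symm
  rw [e3]
  -- Both approximations differ from the same `v`, which cancels; `ε ^ β ≤ 2 l ^ β` at comparable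
  -- scales gives the `2` in `U`.
  refine (f.abs_apply_mulTest_le hη (U := 2 * (A + A') * l ^ β) (hu.sub hu') (fun y => ?_)
    fun y => ?_).trans_eq ?_
  · have e4 : u y - u' y = (u y - v y) - (u' y - v y) := by ring
    rw [e4]
    refine (abs_sub _ _).trans ((add_le_add (h.abs_sub_le y) (h'.abs_sub_le y)).trans ?_)
    have := mul_le_mul_of_nonneg_left (e1 ε hε) hA
    have := mul_le_mul_of_nonneg_left (e1 ε' hε') hA'
    linarith
  · rw [deriv_fun_sub (hu.differentiable one_ne_zero y) (hu'.differentiable one_ne_zero y)]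
    refine (abs_sub _ _).trans ((add_le_add (h.abs_deriv_le y) (h'.abs_deriv_le y)).trans ?_)
    have h3 := mul_le_mul_of_nonneg_left (e2 ε hε) hA
    have h4 := mul_le_mul_of_nonneg_left (e2 ε' hε') hA'
    have h5 : 0 ≤ (A + A') * (l ^ β / l) := by positivity
    calc _ ≤ A * (l ^ β / l) + A' * (l ^ β / l) := add_le_add h3 h4
      _ ≤ 2 * ((A + A') * (l ^ β / l)) := by linarith
      _ = _ := by ring
  · rw [Real.rpow_add hl]
    ring

end NegHolderSpace

theorem C1Test.exists_testBound (η : C1Test) : ∃ r B, TestBound η 0 r B 1 := by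
  obtain ⟨R, hR1, hR⟩ := η.exists_radius
  obtain ⟨B, -, hB, hB'⟩ := η.exists_bounds
  exact ⟨R, B, one_pos, le_rfl, hR1, fun y hy => hR y (by simpa using hy), hB, by simpa using hB'⟩

/-! ### Construction of the product -/

section Product

variable {α β : ℝ}

theorem half_pow_rpow (n : ℕ) (γ : ℝ) : ((1 / 2 : ℝ) ^ n) ^ γ = ((1 / 2 : ℝ) ^ γ) ^ n := by
  rw [← Real.rpow_natCast, ← Real.rpow_natCast, ← Real.rpow_mul (by norm_num),
    ← Real.rpow_mul (by norm_num), mul_comm]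

/-- Approximations `u n` of `v` at the scales `2⁻ⁿ`. -/
structure IsApproxSeq (β : ℝ) (v : ℝ → ℝ) (A : ℝ) (u : ℕ → ℝ → ℝ) : Prop where
  nonneg : 0 ≤ A
  contDiff : ∀ n, ContDiff ℝ 1 (u n)
  isApprox : ∀ n, IsApprox β v A ((1 / 2) ^ n) (u n)

/-! ### Limits of products along dyadic approximations -/

namespace IsApproxSeq

variable {v : ℝ → ℝ} {A : ℝ} {u : ℕ → ℝ → ℝ}

/-- Consecutive approximations are compared at the finer scale `2 ^ (-(n + k + 1))`, to which the
test function bound may be lowered. Since `α + β > 0` the result is geometric in `k`. -/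
theorem dist_succ_le (hu : IsApproxSeq β v A u) (hβ0 : 0 < β) (hβ1 : β < 1)
    (hγ : 0 < α + β) (g : NegHolderSpace α) {x r B : ℝ} {η : C1Test} {n : ℕ}
    (hη : TestBound η x r B ((1 / 2) ^ n)) (k : ℕ) :
    dist (g.toDist (mulTest (u (n + k)) (hu.contDiff _) η))
      (g.toDist (mulTest (u (n + (k + 1))) (hu.contDiff _) η)) ≤
      56 * bumpConst * ‖g‖ * A * B * r * ((1 / 2 : ℝ) ^ n) ^ (α + β) *
        ((1 / 2 : ℝ) ^ (α + β)) ^ k := by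
  have hc := bumpConst_nonneg
  have hA := hu.nonneg
  have hB := hη.nonneg
  have hr : 0 < r := hη.pos.trans_le hη.le_radius
  have h1 : (1 / 2 : ℝ) ^ (n + (k + 1)) ≤ (1 / 2) ^ n :=
    pow_le_pow_of_le_one (by norm_num) (by norm_num) (by omega)
  have h2 : (1 / 2 : ℝ) ^ (n + k) = 2 * (1 / 2) ^ (n + (k + 1)) := by
    rw [← add_assoc, pow_succ]; ring
  have h3 : (0 : ℝ) < (1 / 2) ^ (n + (k + 1)) := by positivity
  have h4 := g.abs_apply_mulTest_sub_le hβ0 hβ1 (hη.mono h3 h1) hA hA (hu.contDiff (n + k))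
    (hu.contDiff (n + (k + 1))) (hu.isApprox _) (hu.isApprox _)
    ⟨by rw [h2]; linarith, h2.le⟩ ⟨le_rfl, by linarith⟩
  rw [Real.dist_eq]
  refine h4.trans ?_
  have h5 : ((1 / 2 : ℝ) ^ (n + (k + 1))) ^ (α + β) ≤
      ((1 / 2 : ℝ) ^ n) ^ (α + β) * ((1 / 2 : ℝ) ^ (α + β)) ^ k := by
    rw [← half_pow_rpow k, ← Real.mul_rpow (by positivity) (by positivity), ← pow_add]
    exact Real.rpow_le_rpow h3.le
      (pow_le_pow_of_le_one (by norm_num) (by norm_num) (by omega)) hγ.le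
  calc _ = 56 * bumpConst * ‖g‖ * A * B * r * ((1 / 2 : ℝ) ^ (n + (k + 1))) ^ (α + β) := by ring
    _ ≤ 56 * bumpConst * ‖g‖ * A * B * r *
        (((1 / 2 : ℝ) ^ n) ^ (α + β) * ((1 / 2 : ℝ) ^ (α + β)) ^ k) := by gcongr
    _ = _ := by ring

theorem half_rpow_lt_one {γ : ℝ} (hγ : 0 < γ) : (1 / 2 : ℝ) ^ γ < 1 :=
  Real.rpow_lt_one (by norm_num) (by norm_num) hγ

theorem exists_tendsto (hu : IsApproxSeq β v A u) (hβ0 : 0 < β) (hβ1 : β < 1)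
    (hγ : 0 < α + β) (g : NegHolderSpace α) (η : C1Test) :
    ∃ c, Tendsto (fun n => g.toDist (mulTest (u n) (hu.contDiff n) η)) atTop (𝓝 c) := by
  obtain ⟨r, B, hη⟩ := C1Test.exists_testBound η
  rw [← pow_zero (1 / 2 : ℝ)] at hη
  obtain ⟨c, hc⟩ := cauchySeq_tendsto_of_complete
    (cauchySeq_of_le_geometric _ _ (half_rpow_lt_one hγ) (hu.dist_succ_le hβ0 hβ1 hγ g hη))
  refine ⟨c, hc.congr fun n => ?_⟩
  simp only [zero_add]

/-- The pointwise limit of the products with the approximations. -/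
def limitProduct (hu : IsApproxSeq β v A u) (hβ0 : 0 < β) (hβ1 : β < 1)
    (hγ : 0 < α + β) (g : NegHolderSpace α) (η : C1Test) : ℝ :=
  (hu.exists_tendsto hβ0 hβ1 hγ g η).choose

variable (hu : IsApproxSeq β v A u) (hβ0 : 0 < β) (hβ1 : β < 1) (hγ : 0 < α + β)
  (g : NegHolderSpace α)

theorem tendsto_limitProduct (η : C1Test) :
    Tendsto (fun n => g.toDist (mulTest (u n) (hu.contDiff n) η)) atTop
      (𝓝 (hu.limitProduct hβ0 hβ1 hγ g η)) :=
  (hu.exists_tendsto hβ0 hβ1 hγ g η).choose_spec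

theorem abs_sub_limitProduct_le {x r B : ℝ} {η : C1Test} {n : ℕ}
    (hη : TestBound η x r B ((1 / 2) ^ n)) :
    |g.toDist (mulTest (u n) (hu.contDiff n) η) - hu.limitProduct hβ0 hβ1 hγ g η| ≤
      56 * bumpConst * ‖g‖ * A * B * r * ((1 / 2 : ℝ) ^ n) ^ (α + β) /
        (1 - (1 / 2 : ℝ) ^ (α + β)) := by
  have h1 := (tendsto_add_atTop_iff_nat n).2 (hu.tendsto_limitProduct hβ0 hβ1 hγ g η)
  simp only [add_comm _ n] at h1
  exact dist_le_of_le_geometric_of_tendsto₀ _ _ (half_rpow_lt_one hγ)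
    (hu.dist_succ_le hβ0 hβ1 hγ g hη) h1

/-- The limit is `u n` times `g` plus the geometric tail. At the scale `l = 2⁻ⁿ` of `η`, `u n` is
bounded by `V + A` with derivative at most `(V + A) / l`, and the tail is smaller by `l ^ β ≤ 1`. -/
theorem abs_limitProduct_le {V : ℝ} (hV : ∀ y, |v y| ≤ V) {x r B : ℝ} {η : C1Test}
    {n : ℕ} (hη : TestBound η x r B ((1 / 2) ^ n)) :
    |hu.limitProduct hβ0 hβ1 hγ g η| ≤
      (14 * bumpConst * (V + A) + 56 * bumpConst * A / (1 - (1 / 2 : ℝ) ^ (α + β))) * ‖g‖ * B *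
        r * ((1 / 2 : ℝ) ^ n) ^ α := by
  have hc := bumpConst_nonneg
  have hA := hu.nonneg
  have hB := hη.nonneg
  have hr : 0 < r := hη.pos.trans_le hη.le_radius
  have hV0 : 0 ≤ V := (abs_nonneg _).trans (hV 0)
  have hq := sub_pos.2 (half_rpow_lt_one hγ)
  set l : ℝ := (1 / 2) ^ n with hl
  have hl0 : 0 < l := hη.pos
  have hl1 : l ≤ 1 := hη.le_one
  have hlb : l ^ β ≤ 1 := Real.rpow_le_one hl0.le hl1 hβ0.le
  have h1 := hu.abs_sub_limitProduct_le hβ0 hβ1 hγ g hη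
  have h2 := g.abs_apply_mulTest_le hη (U := V + A) (hu.contDiff n) (fun y => by
      have h3 := abs_add_le (u n y - v y) (v y)
      rw [sub_add_cancel] at h3
      have h4 := (hu.isApprox n).abs_sub_le y
      have h5 := mul_le_mul_of_nonneg_left hlb hA
      linarith [hV y])
    fun y => by
      refine ((hu.isApprox n).abs_deriv_le y).trans ?_
      rw [← hl, Real.rpow_sub_one hl0.ne', mul_div_assoc']
      refine div_le_div_of_nonneg_right ?_ hl0.le
      have h5 := mul_le_mul_of_nonneg_left hlb hA
      linarith
  have h3 : l ^ (α + β) ≤ l ^ α :=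
    Real.rpow_le_rpow_of_exponent_ge hl0 hl1 (by linarith)
  have h4 := abs_sub_abs_le_abs_sub (hu.limitProduct hβ0 hβ1 hγ g η)
    (g.toDist (mulTest (u n) (hu.contDiff n) η))
  rw [abs_sub_comm] at h4
  have h5 : 56 * bumpConst * ‖g‖ * A * B * r * l ^ (α + β) / (1 - (1 / 2 : ℝ) ^ (α + β)) ≤
      56 * bumpConst * ‖g‖ * A * B * r * l ^ α / (1 - (1 / 2 : ℝ) ^ (α + β)) := by
    gcongr
  calc _ ≤ 14 * bumpConst * ‖g‖ * (V + A) * B * r * l ^ α +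
        56 * bumpConst * ‖g‖ * A * B * r * l ^ α / (1 - (1 / 2 : ℝ) ^ (α + β)) := by linarith
    _ = _ := by ring

theorem limitProduct_add (η θ : C1Test) :
    hu.limitProduct hβ0 hβ1 hγ g (η + θ) =
      hu.limitProduct hβ0 hβ1 hγ g η + hu.limitProduct hβ0 hβ1 hγ g θ := by
  refine tendsto_nhds_unique (hu.tendsto_limitProduct hβ0 hβ1 hγ g (η + θ))
    (((hu.tendsto_limitProduct hβ0 hβ1 hγ g η).add
      (hu.tendsto_limitProduct hβ0 hβ1 hγ g θ)).congr fun n => ?_)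
  rw [← map_add]
  congr 1
  ext y
  exact (mul_add (u n y) (η y) (θ y)).symm

theorem limitProduct_smul (c : ℝ) (η : C1Test) :
    hu.limitProduct hβ0 hβ1 hγ g (c • η) = c • hu.limitProduct hβ0 hβ1 hγ g η := by
  refine tendsto_nhds_unique (hu.tendsto_limitProduct hβ0 hβ1 hγ g (c • η))
    (((hu.tendsto_limitProduct hβ0 hβ1 hγ g η).const_smul c).congr fun n => ?_)
  rw [← map_smul]
  congr 1
  ext y
  exact (mul_left_comm (u n y) c (η y)).symm

theorem norm_limitProduct_ofSupportedIn_le {V : ℝ} (hV : ∀ y, |v y| ≤ V)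
    {K : Compacts ℝ} (hK : (K : Set ℝ) ⊆ (⊤ : Opens ℝ)) {R : ℝ} (hR : ∀ y ∈ K, |y| ≤ R)
    (f : ContDiffMapSupportedIn ℝ ℝ 1 K) :
    ‖hu.limitProduct hβ0 hβ1 hγ g (TestFunction.ofSupportedIn hK f)‖ ≤
      ((14 * bumpConst * (V + A) + 56 * bumpConst * A / (1 - (1 / 2 : ℝ) ^ (α + β))) * ‖g‖ *
        max R 1) *
        (({0, 1} : Finset ℕ).sup fun i => ContDiffMapSupportedIn.seminorm ℝ ℝ ℝ 1 K i) f := by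
  set p := (({0, 1} : Finset ℕ).sup fun i => ContDiffMapSupportedIn.seminorm ℝ ℝ ℝ 1 K i) f
  have hp : ∀ i ∈ ({0, 1} : Finset ℕ), ContDiffMapSupportedIn.seminorm ℝ ℝ ℝ 1 K i f ≤ p :=
    fun i hi => Finset.le_sup (f := fun i => ContDiffMapSupportedIn.seminorm ℝ ℝ ℝ 1 K i) hi f
  have h0 : ∀ y, |f y| ≤ p := fun y => by
    have h1 := ContDiffMapSupportedIn.norm_iteratedFDeriv_apply_le_seminorm ℝ (n := 1) (i := 0)
      (by simp) (f := f) (x := y)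
    rw [norm_iteratedFDeriv_zero] at h1
    exact h1.trans (hp 0 (by simp))
  have h1 : ∀ y, |deriv f y| ≤ p := fun y => by
    have h1 := ContDiffMapSupportedIn.norm_iteratedFDeriv_apply_le_seminorm ℝ (n := 1) (i := 1)
      (by simp) (f := f) (x := y)
    rw [norm_iteratedFDeriv_one, ← norm_deriv_eq_norm_fderiv] at h1
    exact h1.trans (hp 1 (by simp))
  have hη : TestBound (TestFunction.ofSupportedIn hK f) 0 (max R 1) p ((1 / 2) ^ 0) := by
    refine ⟨by simp, by simp, by simp, fun y hy => ?_, h0, fun y => ?_⟩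
    · refine f.zero_on_compl (x := y) fun hyK => ?_
      rw [sub_zero] at hy
      exact absurd hy (not_lt.2 ((hR y hyK).trans (le_max_left _ _)))
    · rw [pow_zero, div_one]
      exact h1 y
  have h2 := hu.abs_limitProduct_le hβ0 hβ1 hγ g hV hη
  rw [pow_zero, Real.one_rpow, mul_one] at h2
  exact h2.trans_eq (by ring)

/-- A linear functional on test functions is continuous once it is so on those supported in each
fixed compact set; there the seminorms of order `0` and `1` suffice. -/
theorem continuous_limitProduct_comp {V : ℝ} (hV : ∀ y, |v y| ≤ V)
    (K : Compacts ℝ) (hK : (K : Set ℝ) ⊆ (⊤ : Opens ℝ)) :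
    Continuous (hu.limitProduct hβ0 hβ1 hγ g ∘
      (TestFunction.ofSupportedIn (n := 1) (F := ℝ) hK)) := by
  obtain ⟨R, hR⟩ := K.isCompact.isBounded.subset_closedBall 0
  have hR' : ∀ y ∈ K, |y| ≤ R := fun y hy => by
    have h2 := hR hy
    rwa [Metric.mem_closedBall, dist_zero_right, Real.norm_eq_abs] at h2
  have hc := bumpConst_nonneg
  have hA := hu.nonneg
  have hV0 : 0 ≤ V := (abs_nonneg _).trans (hV 0)
  have hq := sub_pos.2 (half_rpow_lt_one hγ)
  let Φ : ContDiffMapSupportedIn ℝ ℝ 1 K →L[ℝ] ℝ :=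
    ContDiffMapSupportedIn.mkCLMtoNormedSpace ℝ
      (fun f => hu.limitProduct hβ0 hβ1 hγ g (TestFunction.ofSupportedIn hK f))
      (fun f f' => hu.limitProduct_add hβ0 hβ1 hγ g (TestFunction.ofSupportedIn hK f)
        (TestFunction.ofSupportedIn hK f'))
      (fun c f => hu.limitProduct_smul hβ0 hβ1 hγ g c (TestFunction.ofSupportedIn hK f))
      ⟨{0, 1}, _, by positivity, hu.norm_limitProduct_ofSupportedIn_le hβ0 hβ1 hγ g hV hK hR'⟩
  exact Φ.continuous

/-- The limit product as a distribution. -/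
def limitDist {V : ℝ} (hV : ∀ y, |v y| ≤ V) : Dist1 :=
  let L := TestFunction.mkCLM ℝ (hu.limitProduct hβ0 hβ1 hγ g)
    (hu.limitProduct_add hβ0 hβ1 hγ g) (hu.limitProduct_smul hβ0 hβ1 hγ g)
    (hu.continuous_limitProduct_comp hβ0 hβ1 hγ g hV)
  { toFun := L
    map_add' := L.map_add
    map_smul' := L.map_smul
    cont := L.continuous }

theorem limitDist_apply {V : ℝ} (hV : ∀ y, |v y| ≤ V) (η : C1Test) :
    hu.limitDist hβ0 hβ1 hγ g hV η = hu.limitProduct hβ0 hβ1 hγ g η := rfl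

/-- A probe at scale `l` has radius `l` and height `l⁻¹`, which cancel, leaving `l ^ α`. The dyadic
scale used lies in `[l / 2, l)`, whence the factor `(1 / 2) ^ α`. -/
theorem probeValue_limitDist_le (hα : α ≤ 0) {V : ℝ} (hV : ∀ y, |v y| ≤ V) (i : HolderProbe) :
    probeValue α (hu.limitDist hβ0 hβ1 hγ g hV) i ≤
      (14 * bumpConst * (V + A) + 56 * bumpConst * A / (1 - (1 / 2 : ℝ) ^ (α + β))) * ‖g‖ *
        (1 / 2) ^ α := by
  have hi := i.l_pos
  obtain ⟨n, hn1, hn2⟩ := exists_nat_pow_near_of_lt_one hi i.l_le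
    (by norm_num : (0 : ℝ) < 1 / 2) (by norm_num)
  have hpos : (0 : ℝ) < (1 / 2) ^ (n + 1) := by positivity
  have hsupp : ∀ y, i.l < |y - i.x| → rescale i.η i.x i.l y = 0 := fun y hy => by
    rw [rescale_apply, mul_eq_zero]
    right
    by_contra h0
    have h1 := abs_le.2 (i.support_subset (subset_tsupport _ h0))
    rw [abs_mul, abs_of_pos (inv_pos.2 hi), inv_mul_le_iff₀ hi, mul_one] at h1
    exact absurd hy (not_lt.2 h1)
  have hη : TestBound (rescale i.η i.x i.l) i.x i.l (i.l)⁻¹ i.l := by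
    refine ⟨hi, i.l_le, le_rfl, hsupp, fun y => ?_, fun y => ?_⟩
    · rw [rescale_apply, abs_mul, abs_of_pos (inv_pos.2 hi)]
      exact mul_le_of_le_one_right (inv_pos.2 hi).le (i.abs_le _)
    · rw [deriv_rescale, abs_mul, abs_mul, abs_of_pos (inv_pos.2 hi), div_eq_mul_inv]
      exact mul_le_mul_of_nonneg_left
        (mul_le_of_le_one_right (inv_pos.2 hi).le (i.abs_deriv_le _)) (inv_pos.2 hi).le
  have h1 := hu.abs_limitProduct_le hβ0 hβ1 hγ g hV (hη.mono hpos hn1.le)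
  set D := 14 * bumpConst * (V + A) + 56 * bumpConst * A / (1 - (1 / 2 : ℝ) ^ (α + β)) with hD
  have hD0 : 0 ≤ D := by
    have hc := bumpConst_nonneg
    have hA := hu.nonneg
    have hV0 : 0 ≤ V := (abs_nonneg _).trans (hV 0)
    have hq := sub_pos.2 (half_rpow_lt_one hγ)
    positivity
  have h2 : ((1 / 2 : ℝ) ^ (n + 1)) ^ α ≤ (1 / 2) ^ α * i.l ^ α := by
    rw [← Real.mul_rpow (by norm_num) hi.le]
    refine Real.rpow_le_rpow_of_nonpos (by positivity) ?_ hα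
    rw [pow_succ]
    linarith
  unfold probeValue
  rw [limitDist_apply]
  have h3 : i.l ^ (-α) * i.l ^ α = 1 := by rw [← Real.rpow_add hi]; simp
  have h4 : 0 ≤ i.l ^ (-α) := Real.rpow_nonneg hi.le _
  rw [mul_assoc _ (i.l)⁻¹, inv_mul_cancel₀ hi.ne', mul_one] at h1
  calc _ ≤ i.l ^ (-α) * (D * ‖g‖ * ((1 / 2) ^ α * i.l ^ α)) := by
        refine mul_le_mul_of_nonneg_left (h1.trans ?_) h4
        gcongr
    _ = D * ‖g‖ * (1 / 2) ^ α * (i.l ^ (-α) * i.l ^ α) := by ring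
    _ = _ := by rw [h3, mul_one]

end IsApproxSeq

/-- The product is built from one fixed mollifier along dyadic scales. Any other mollifier yields
the same limit, because two approximations at comparable scales differ by `O(ε ^ (α + β))` when
tested. -/
theorem exists_isProduct (hα : α ≤ 0) (hβ0 : 0 < β) (hβ1 : β < 1) (hγ : 0 < α + β) :
    ∃ D, 0 ≤ D ∧ ∀ (g : NegHolderSpace α) (v : HolderSpace β), ∃ h : NegHolderSpace α,
      IsProduct v.toBCF g.toDist h.toDist ∧ ‖h‖ ≤ D * ‖g‖ * ‖v‖ := by
  obtain ⟨ρ₀, hρ₀⟩ := exists_integral_eq_one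
  obtain ⟨A, hA, happ⟩ := exists_isApprox_mollify hβ0 ρ₀ hρ₀
  have hc := bumpConst_nonneg
  have hq := sub_pos.2 (IsApproxSeq.half_rpow_lt_one hγ)
  refine ⟨(14 * bumpConst * (1 + A) + 56 * bumpConst * A / (1 - (1 / 2 : ℝ) ^ (α + β))) *
    (1 / 2) ^ α, by positivity, fun g v => ?_⟩
  have hu : IsApproxSeq β v (A * ‖v‖) fun n => mollify ρ₀ ((1 / 2) ^ n) v.toBCF :=
    ⟨mul_nonneg hA (norm_nonneg v), fun n => contDiff_mollify _ _ _,
      fun n => happ v _ (by positivity)⟩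
  have hpv := hu.probeValue_limitDist_le hβ0 hβ1 hγ g hα v.abs_apply_le
  refine ⟨⟨hu.limitDist hβ0 hβ1 hγ g v.abs_apply_le, _, by
    rintro _ ⟨i, rfl⟩; exact hpv i⟩, fun ρ hρ η => ?_, ?_⟩
  · obtain ⟨A', hA', happ'⟩ := exists_isApprox_mollify hβ0 ρ hρ
    obtain ⟨r, B, hη⟩ := C1Test.exists_testBound η
    have hB := hη.nonneg
    have hr : 0 < r := hη.pos.trans_le hη.le_radius
    set M := 28 * bumpConst * ‖g‖ * (A' * ‖v‖ + A * ‖v‖) * B * r +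
      56 * bumpConst * ‖g‖ * (A * ‖v‖) * B * r / (1 - (1 / 2 : ℝ) ^ (α + β)) with hM
    have hv := norm_nonneg v
    have hM0 : 0 ≤ M := by positivity
    have hlim : Tendsto (fun ε : ℝ => M * ε ^ (α + β)) (𝓝[>] 0) (𝓝 0) := by
      have h1 : ContinuousAt (fun ε : ℝ => M * ε ^ (α + β)) 0 :=
        (Real.continuousAt_rpow_const _ _ (Or.inr hγ.le)).const_mul M
      have h2 := h1.tendsto.mono_left (nhdsWithin_le_nhds (s := Ioi 0))
      simpa [Real.zero_rpow hγ.ne'] using h2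
    rw [tendsto_iff_dist_tendsto_zero]
    refine squeeze_zero' (Eventually.of_forall fun _ => dist_nonneg) ?_ hlim
    filter_upwards [Ioc_mem_nhdsGT one_pos] with ε hε
    -- With `l = 2 ^ (-(n + 1))` one has `l < ε ≤ 2 l`, so the mollification at scale `ε` is
    -- comparable with the dyadic one of index `n + 1`.
    obtain ⟨n, hn1, hn2⟩ := exists_nat_pow_near_of_lt_one hε.1 hε.2
      (by norm_num : (0 : ℝ) < 1 / 2) (by norm_num)
    have hpos : (0 : ℝ) < (1 / 2) ^ (n + 1) := by positivity
    have hη' := hη.mono hpos (pow_le_one₀ (by norm_num) (by norm_num))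
    have h1 := g.abs_apply_mulTest_sub_le hβ0 hβ1 hη' (mul_nonneg hA' hv) (mul_nonneg hA hv)
      (contDiff_mollify ρ ε v.toBCF) (hu.contDiff (n + 1)) (happ' v ε hε.1) (hu.isApprox (n + 1))
      ⟨hn1.le, by rw [pow_succ]; linarith⟩ ⟨le_rfl, by linarith⟩
    have h2 := hu.abs_sub_limitProduct_le hβ0 hβ1 hγ g hη'
    have h3 : ((1 / 2 : ℝ) ^ (n + 1)) ^ (α + β) ≤ ε ^ (α + β) :=
      Real.rpow_le_rpow hpos.le hn1.le hγ.le
    rw [Real.dist_eq]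
    refine (abs_sub_le _ _ _).trans ((add_le_add h1 h2).trans ?_)
    calc _ = M * ((1 / 2 : ℝ) ^ (n + 1)) ^ (α + β) := by rw [hM]; ring
      _ ≤ _ := mul_le_mul_of_nonneg_left h3 hM0
  · have hv := norm_nonneg v
    refine Real.iSup_le (fun i => (hpv i).trans_eq ?_) (by positivity)
    ring

/-- Bilinearity is inherited from the defining limits through uniqueness of the product. -/
theorem exists_mulCLM (hα : α ≤ 0) (hβ0 : 0 < β) (hβ1 : β < 1) (hγ : 0 < α + β) :
    ∃ m : NegHolderSpace α →L[ℝ] HolderSpace β →L[ℝ] NegHolderSpace α,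
      ∀ g v, IsProduct v.toBCF g.toDist (m g v).toDist := by
  obtain ⟨D, -, h⟩ := exists_isProduct hα hβ0 hβ1 hγ
  choose m hm hD using h
  exact ⟨LinearMap.mkContinuous₂
    (LinearMap.mk₂ ℝ m
      (fun g g' v => Subtype.ext ((hm (g + g') v).unique ((hm g v).add_right (hm g' v))))
      (fun c g v => Subtype.ext ((hm (c • g) v).unique ((hm g v).smul_right c)))
      (fun g v v' => Subtype.ext ((hm g (v + v')).unique ((hm g v).add_left (hm g v'))))
      (fun c g v => Subtype.ext ((hm g (c • v)).unique ((hm g v).smul_left c)))) D hD, hm⟩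

end Product

/-! ### The mild equation -/

/-- When `β - α = 1 - κ` the smoothing singularity is exactly the weight at time zero, so no
integration is needed. -/
theorem exists_heatCLM {α β κ T : ℝ} (hα : α < 1) (hβ0 : 0 < β) (hβ1 : β < 1)
    (he : β - α = 1 - κ) {P : ℝ → NegHolderSpace α →L[ℝ] HolderSpace β}
    (hP : ∀ t, 0 < t → IsCauchyOperator t (P t)) :
    ∃ W : NegHolderSpace α →L[ℝ] XSpace (HolderSpace β) κ T,
      ∀ f (t : Ioc (0 : ℝ) T), W f t = P t f := by
  obtain ⟨C, hC⟩ := isSingularKernel_of_isCauchyOperator (T := T) hα hβ0 hβ1 hP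
  have hb : ∀ f (t : Ioc (0 : ℝ) T), ‖P t f‖ ≤ C * ‖f‖ * (t : ℝ) ^ (κ - 1) := fun f t => by
    have h1 := hC.bound t t.2
    rw [he, neg_sub] at h1
    exact ((P t).le_of_opNorm_le h1 f).trans_eq (by ring)
  have hc : ∀ f, Continuous fun t : Ioc (0 : ℝ) T => P t f := fun f =>
    (hC.continuousOn.comp_continuous continuous_subtype_val fun t => t.2).clm_apply
      continuous_const
  choose W hW using fun f => XSpace.exists_of_bound (hc f) (hb f)
  refine ⟨LinearMap.mkContinuous
    { toFun := W
      map_add' := fun f g => XSpace.ext_apply fun t => by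
        rw [XSpace.add_apply, hW, hW, hW, map_add]
      map_smul' := fun c f => XSpace.ext_apply fun t => by
        rw [RingHom.id_apply, XSpace.smul_apply, hW, hW, map_smul] } C
    fun f => XSpace.norm_le_of_forall (mul_nonneg hC.nonneg (norm_nonneg f)) fun t => ?_, hW⟩
  exact (congrArg norm (hW f t)).trans_le (hb f t)

/-- The mild formulation is the equation `u = S (v g + Ψ v) + W v₀`. -/
theorem isMildImage_iff {κ T : ℝ} (hκ : κ ∈ Ioo (0 : ℝ) (1 / 4))
    {m : NegHolderSpace (-κ) →L[ℝ] HolderSpace (1 / 2 + κ) →L[ℝ] NegHolderSpace (-κ)}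
    (hm : ∀ g v, IsProduct v.toBCF g.toDist (m g v).toDist)
    {P : ℝ → NegHolderSpace (-κ) →L[ℝ] HolderSpace (1 / 2 + κ)} {C : ℝ}
    (hP : ∀ t, 0 < t → IsCauchyOperator t (P t))
    (hC : IsSingularKernel P (1 / 2 + 2 * κ) C T)
    {S : XSpace (NegHolderSpace (-κ)) κ T →L[ℝ] XSpace (HolderSpace (1 / 2 + κ)) κ T}
    (hS : ∀ w (t : Ioc (0 : ℝ) T), S w t = volterra P w t)
    {Q : ℝ → NegHolderSpace (-(1 / 2) + 2 * κ) →L[ℝ] HolderSpace (1 / 2 + κ)}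
    (hQ : ∀ t, 0 < t → IsCauchyOperator t (Q t))
    {W : NegHolderSpace (-(1 / 2) + 2 * κ) →L[ℝ] XSpace (HolderSpace (1 / 2 + κ)) κ T}
    (hW : ∀ f (t : Ioc (0 : ℝ) T), W f t = Q t f)
    (g : NegHolderSpace (-κ)) (Ψ : HolderSpace (1 / 2 + κ) →L[ℝ] NegHolderSpace (-κ))
    (v₀ : NegHolderSpace (-(1 / 2) + 2 * κ)) (v u : XSpace (HolderSpace (1 / 2 + κ)) κ T) :
    IsMildImage g Ψ v₀ v u ↔
      u = S (XSpace.compCLM (HolderSpace (1 / 2 + κ)) κ T (NegHolderSpace (-κ)) (m g + Ψ) v) +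
        W v₀ := by
  have : CompleteSpace (HolderSpace (1 / 2 + κ)) :=
    HolderSpace.completeSpace (by linarith [hκ.1])
  have ha : 1 / 2 + 2 * κ < 1 := by linarith [hκ.2]
  set w := XSpace.compCLM (HolderSpace (1 / 2 + κ)) κ T (NegHolderSpace (-κ)) (m g + Ψ) v with hw
  have hws : ∀ s : Ioc (0 : ℝ) T, timeExt w s = m g (v s) + Ψ (v s) := fun s => by
    rw [timeExt_of_mem w s.2, hw]
    exact XSpace.compCLM_apply _ _ _
  have hcauchy : ∀ (t s : Ioc (0 : ℝ) T) (x : ℝ), (s : ℝ) < t →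
      HasCauchyConv ((t : ℝ) - s) (m g (v s) + Ψ (v s)).toDist x
        (P (t - s) (timeExt w s) x) := fun t s x hst => by
    rw [hws]
    exact hP _ (sub_pos.2 hst) _ _
  -- Evaluation at `x` is a bounded functional, so it commutes with the Hölder-valued integral.
  have hint : ∀ (t : Ioc (0 : ℝ) T) (x : ℝ),
      IntervalIntegrable (fun s => P (t - s) (timeExt w s) x) volume 0 t ∧
      S w t x = ∫ s in (0 : ℝ)..t, P (t - s) (timeExt w s) x := fun t x => by
    obtain ⟨h1, h2⟩ := hC.intervalIntegrable_and_volterra_eq ha hκ.1 w t.2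
    refine ⟨⟨(HolderSpace.evalCLM _ x).integrable_comp h1.1,
      (HolderSpace.evalCLM _ x).integrable_comp h1.2⟩, ?_⟩
    rw [hS, h2, ← HolderSpace.evalCLM_apply]
    exact (ContinuousLinearMap.intervalIntegral_comp_comm (HolderSpace.evalCLM _ x) h1).symm
  constructor
  · rintro ⟨h, hh, hF⟩
    refine XSpace.ext_apply fun t => HolderSpace.ext_apply fun x => ?_
    obtain ⟨F, p, hF1, hp, -, hu⟩ := hF t x
    have hhm : ∀ s, h s = m g (v s) := fun s => Subtype.ext ((hh s).unique (hm g (v s)))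
    rw [hu, XSpace.add_apply, HolderSpace.add_apply, (hint t x).2, hW,
      hp.unique (hQ t t.2.1 v₀ x)]
    congr 1
    refine intervalIntegral.integral_congr_ae ?_
    -- The formulation prescribes `F s` only for `s < t`; the endpoint is a null set.
    have hne : ∀ᵐ s : ℝ, s ≠ t := Measure.ae_ne volume (t : ℝ)
    filter_upwards [hne] with s hs hmem
    rw [uIoc_of_le t.2.1.le] at hmem
    have hst : s < t := lt_of_le_of_ne hmem.2 hs
    have hsT : s ∈ Ioc (0 : ℝ) T := ⟨hmem.1, hmem.2.trans t.2.2⟩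
    have h1 := hF1 ⟨s, hsT⟩ hst
    rw [hhm] at h1
    exact h1.unique (hcauchy t ⟨s, hsT⟩ x hst)
  · rintro rfl
    refine ⟨fun s => m g (v s), fun s => hm g (v s), fun t x =>
      ⟨fun s => P (t - s) (timeExt w s) x, Q t v₀ x, fun s hst => hcauchy t s x hst,
        hQ t t.2.1 v₀ x, (hint t x).1, ?_⟩⟩
    rw [XSpace.add_apply, HolderSpace.add_apply, (hint t x).2, hW]

end

/-- For each `(g, Ψ, v₀)` the map `ℳ_{g, Ψ, v₀}` has exactly one fixed point `V (g, Ψ, v₀)`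
in `𝒳^κ_T(𝒞^{1/2+κ})`, and `V` is continuous for the norm topologies. -/
theorem proposition6p4 (κ : ℝ) (hκ : κ ∈ Ioo (0 : ℝ) (1 / 4)) (T : ℝ) (hT : 0 < T) :
    ∃ V : NegHolderSpace (-κ) × (HolderSpace (1 / 2 + κ) →L[ℝ] NegHolderSpace (-κ)) ×
          NegHolderSpace (-(1 / 2) + 2 * κ) →
        XSpace (HolderSpace (1 / 2 + κ)) κ T,
      (∀ (g : NegHolderSpace (-κ)) (Ψ : HolderSpace (1 / 2 + κ) →L[ℝ] NegHolderSpace (-κ))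
          (v₀ : NegHolderSpace (-(1 / 2) + 2 * κ)) (v : XSpace (HolderSpace (1 / 2 + κ)) κ T),
        IsMildImage g Ψ v₀ v v ↔ v = V (g, Ψ, v₀)) ∧
      Continuous V := by

  have hκ0 := hκ.1
  have hκ1 := hκ.2
  have hβ0 : 0 < 1 / 2 + κ := by linarith
  have hβ1 : 1 / 2 + κ < 1 := by linarith
  have ha0 : 0 ≤ 1 / 2 + 2 * κ := by linarith
  have ha1 : 1 / 2 + 2 * κ < 1 := by linarith
  obtain ⟨m, hm⟩ := exists_mulCLM (α := -κ) (β := 1 / 2 + κ) (by linarith) hβ0 hβ1 (by linarith)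
  -- The zero operator at `t ≤ 0` is a filler, so that a family indexed by all real times can be
  -- chosen.
  have hPex : ∀ (α t : ℝ), ∃ P : NegHolderSpace α →L[ℝ] HolderSpace (1 / 2 + κ),
      0 < t → IsCauchyOperator t P := fun α t => by
    by_cases ht : 0 < t
    · obtain ⟨P, hP⟩ := exists_isCauchyOperator (α := α) hβ0 hβ1 ht
      exact ⟨P, fun _ => hP⟩
    · exact ⟨0, fun h => absurd h ht⟩
  choose P hP using hPex
  obtain ⟨C, hC⟩ := isSingularKernel_of_isCauchyOperator (T := T) (by linarith) hβ0 hβ1 (hP (-κ))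
  have ea : 1 / 2 + κ - -κ = 1 / 2 + 2 * κ := by ring
  rw [ea] at hC
  have hcomp : CompleteSpace (HolderSpace (1 / 2 + κ)) := HolderSpace.completeSpace hβ0
  have hcompX : CompleteSpace (XSpace (HolderSpace (1 / 2 + κ)) κ T) := XSpace.completeSpace
  obtain ⟨S, hS⟩ := hC.exists_volterraCLM ha0 ha1 hκ0
  obtain ⟨W, hW⟩ := exists_heatCLM (κ := κ) (T := T) (α := -(1 / 2) + 2 * κ) (by linarith) hβ0 hβ1
    (by ring) (hP (-(1 / 2) + 2 * κ))
  let K : (HolderSpace (1 / 2 + κ) →L[ℝ] NegHolderSpace (-κ)) →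
      (XSpace (HolderSpace (1 / 2 + κ)) κ T →L[ℝ] XSpace (HolderSpace (1 / 2 + κ)) κ T) :=
    fun A => S ∘L XSpace.compCLM (HolderSpace (1 / 2 + κ)) κ T (NegHolderSpace (-κ)) A
  have hK : Continuous K := continuous_const.clm_comp (XSpace.compCLM _ _ _ _).continuous
  have hunit : ∀ A, IsUnit (1 - K A) := fun A =>
    hC.isUnit_one_sub_volterra ha0 ha1 hκ0 hS A
  refine ⟨fun d => Ring.inverse (1 - K (m d.1 + d.2.1)) (W d.2.2), fun g Ψ v₀ v => ?_, ?_⟩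
  · rw [isMildImage_iff hκ hm (hP _) hC hS (hP _) hW]
    have h1 : v = S (XSpace.compCLM (HolderSpace (1 / 2 + κ)) κ T (NegHolderSpace (-κ))
        (m g + Ψ) v) + W v₀ ↔ (1 - K (m g + Ψ)) v = W v₀ := by
      rw [← sub_eq_iff_eq_add']
      rfl
    rw [h1]
    constructor
    · intro h
      change v = Ring.inverse (1 - K (m g + Ψ)) (W v₀)
      rw [← h]
      exact (DFunLike.congr_fun (Ring.inverse_mul_cancel _ (hunit (m g + Ψ))) v).symm
    · intro h
      have h2 : v = Ring.inverse (1 - K (m g + Ψ)) (W v₀) := h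
      rw [h2]
      exact DFunLike.congr_fun (Ring.mul_inverse_cancel _ (hunit (m g + Ψ))) (W v₀)
  · have h1 : Continuous fun d : NegHolderSpace (-κ) ×
        (HolderSpace (1 / 2 + κ) →L[ℝ] NegHolderSpace (-κ)) ×
          NegHolderSpace (-(1 / 2) + 2 * κ) => Ring.inverse (1 - K (m d.1 + d.2.1)) := by
      refine continuous_iff_continuousAt.2 fun d => ?_
      -- In a complete normed ring inversion is continuous at every unit, and `1 - K A` is a unit
      -- for every `A`, so no restriction on the data arises.
      have h2 : ContinuousAt Ring.inverse (1 - K (m d.1 + d.2.1)) := by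
        obtain ⟨U, hU⟩ := hunit (m d.1 + d.2.1)
        rw [← hU]
        exact NormedRing.inverse_continuousAt U
      have h3 : Continuous fun d : NegHolderSpace (-κ) ×
          (HolderSpace (1 / 2 + κ) →L[ℝ] NegHolderSpace (-κ)) ×
            NegHolderSpace (-(1 / 2) + 2 * κ) => 1 - K (m d.1 + d.2.1) :=
        continuous_const.sub (hK.comp ((m.continuous.comp continuous_fst).add
          (continuous_fst.comp continuous_snd)))
      exact ContinuousAt.comp (f := fun d : NegHolderSpace (-κ) ×
          (HolderSpace (1 / 2 + κ) →L[ℝ] NegHolderSpace (-κ)) ×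
            NegHolderSpace (-(1 / 2) + 2 * κ) => 1 - K (m d.1 + d.2.1)) h2 h3.continuousAt
    exact h1.clm_apply (W.continuous.comp (continuous_snd.comp continuous_snd))
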